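/- Let $\Sigma$ be an alphabet of constant size. A text is a string $T[1,n]$ over $\Sigma$, $n\ge 2$, whose last character $T[n]$ occurs nowhere else in $T$ and is smaller than all other characters. Its suffix array is the permutation $\mathsf{sa}[1,n]$ of $[1,n]$ such that $T[\mathsf{sa}[i],n]$ lexicographically precedes $T[\mathsf{sa}[i+1],n]$ for $1\le i<n$. Model: a word RAM with words of $\Theta(\log n)$ bits and unit-cost word operations, with an internal memory of $O(M)$ words (that is, $\Theta(M\log n)$ bits) and three disks that can be accessed only by sequential scans: a read-only input disk holding $T$ with $\lceil\log_2|\Sigma|\rceil$ bits per character, an output disk of $n$ entries of $\lfloor\log_2 n\rfloor+1$ bits each, and a work disk. Disk pages consist of $B$ words, and $1\le B\le M\le n$. The working space is the disk space used in addition to that for input and output. A pass is a maximal run of head movements on one disk in the same direction; the number of passes is summed over the disks. An I/O is the fetch or write-back of a disk page. Theorem. For every fixed alphabet $\Sigma$ there is a single program (the same for all $n$, $M$, $B$ and $T$, receiving $n,M,B$ as parameters) that, for every text $T[1,n]$ over $\Sigma$, computes the suffix array of $T$ and leaves it on the output disk, in $O(n/M)$ passes over a total of $\Theta(n\log n)$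 bits of disk data, using $n$ bits of disk working space. It performs $O(n^2/(MB))$ I/Os and takes $O(n^2/M)$ CPU time. The constants depend only on $|\Sigma|$. -/

import Mathlib

namespace ScanModel

/-! ## The suffix array of a text -/

/-- The suffix `T[i], T[i+1], …` of the text `T` (positions are counted from `0`). -/
def suffix {n σ : ℕ} (T : Fin n → Fin σ) (i : Fin n) : List (Fin σ) :=
  (List.ofFn T).drop i

/-- The last character of `T` occurs nowhere else and is smaller than all other characters. -/
def HasSentinel {n σ : ℕ} (T : Fin n → Fin σ) : Prop :=
  ∀ i j : Fin n, (j : ℕ) + 1 = n → i ≠ j → T j < T i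

/-- `sa` is the permutation of the positions that lists the suffixes of `T` in increasing
lexicographic order (`<` on lists is the lexicographic order). -/
def IsSuffixArray {n σ : ℕ} (T : Fin n → Fin σ) (sa : Equiv.Perm (Fin n)) : Prop :=
  StrictMono fun i => suffix T (sa i)

/-! ## The machine: a word RAM with three sequentially accessed disks -/

/-- A read-only input disk, an output disk, and a disk for the working space. -/
inductive Disk
  | input
  | output
  | work
  deriving DecidableEq

/-- The sizes that fix a machine. -/
structure Machine where
  /-- alphabet size -/
  alphabet : ℕ
  /-- text length -/
  textLen : ℕ
  /-- number of bits of a word -/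
  wordBits : ℕ
  /-- number of addressable words of internal memory -/
  ramWords : ℕ
  /-- number of words of a disk page -/
  pageWords : ℕ
  /-- number of bits of disk working space -/
  workBits : ℕ

/-- Number of cells of a disk. -/
def Machine.len (m : Machine) : Disk → ℕ
  | .input => m.textLen
  | .output => m.textLen
  | .work => m.workBits

/-- Number of bits of a cell: the input disk holds one character per cell, the output disk
one number in `[0, n]`, the work disk one bit. -/
def Machine.width (m : Machine) : Disk → ℕ
  | .input => Nat.clog 2 m.alphabet
  | .output => Nat.size m.textLen
  | .work => 1

/-- Size of a disk in bits. -/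
def Machine.diskBits (m : Machine) (d : Disk) : ℕ := m.len d * m.width d

/-- Number of the page that contains cell `p`. A page has `pageWords` words and is filled
with whole cells. -/
def Machine.page (m : Machine) (d : Disk) (p : ℕ) : ℕ :=
  p / max 1 (m.pageWords * m.wordBits / m.width d)

/-- The unit-cost word operations. -/
inductive Op
  | add
  | sub
  | mul
  | div
  | mod
  | lt
  | eq

/-- The value of an operation before reduction modulo `2 ^ wordBits`; subtraction is cut off
at `0`, comparisons return `0` or `1`. -/
def Op.eval : Op → ℕ → ℕ → ℕ
  | .add, x, y => x + y
  | .sub, x, y => x - y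
  | .mul, x, y => x * y
  | .div, x, y => x / y
  | .mod, x, y => x % y
  | .lt, x, y => if x < y then 1 else 0
  | .eq, x, y => if x = y then 1 else 0

/-- Expressions over the internal memory; `load a` is the content of the word with
address `a`. -/
inductive Expr
  | lit (k : ℕ)
  | load (a : Expr)
  | bin (op : Op) (a b : Expr)

/-- Evaluation of an expression takes one time unit for each of its nodes. -/
def Expr.cost : Expr → ℕ
  | .lit _ => 1
  | .load a => a.cost + 1
  | .bin _ a b => a.cost + b.cost + 1

/-- The value of an expression; undefined if it loads from an address outside the memory. -/
def Expr.eval (m : Machine) (mem : ℕ → ℕ) : Expr → Option ℕ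
  | .lit k => some (k % 2 ^ m.wordBits)
  | .load a =>
    (a.eval m mem).bind fun x => if x < m.ramWords then some (mem x) else none
  | .bin op a b =>
    (a.eval m mem).bind fun x =>
      (b.eval m mem).bind fun y => some (op.eval x y % 2 ^ m.wordBits)

/-- Elementary commands. -/
inductive Atom
  /-- store a value at an address of the internal memory -/
  | store (addr val : Expr)
  /-- copy the cell under the head of a disk to an address of the internal memory -/
  | read (d : Disk) (addr : Expr)
  /-- write a value into the cell under the head of a disk -/
  | write (d : Disk) (val : Expr)
  /-- move the head of a disk by one cell, to the right if the flag is `true`, else to the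
  left -/
  | move (d : Disk) (right : Bool)

/-- Programs. -/
inductive Cmd
  | skip
  | atom (a : Atom)
  | seq (p q : Cmd)
  | ite (cond : Expr) (p q : Cmd)
  | loop (cond : Expr) (body : Cmd)

/-- Contents of memory and disks, position of the heads, direction of the current scan of each
disk, and the resources used so far. -/
structure State where
  mem : ℕ → ℕ
  disk : Disk → ℕ → ℕ
  head : Disk → ℕ
  right : Disk → Bool
  /-- CPU time -/
  time : ℕ
  /-- number of passes, summed over the disks -/
  passes : ℕ
  /-- number of disk page accesses -/
  accesses : ℕ

/-- Let `t` units of time elapse. -/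
def State.tick (s : State) (t : ℕ) : State := { s with time := s.time + t }

/-- The cell to the right or to the left of cell `p`, if there is one. -/
def Machine.neighbour (m : Machine) (d : Disk) (p : ℕ) : Bool → Option ℕ
  | true => if p + 1 < m.len d then some (p + 1) else none
  | false => if 0 < p then some (p - 1) else none

/-- Effect of an elementary command; `none` is a fault (an address outside the memory, a head
leaving its disk, writing to the input disk). A change of direction of a head begins a new pass
over the disk. Moving to another page costs two page accesses: the old page is written back and
the new page is fetched. -/
def Atom.exec (m : Machine) (s : State) : Atom → Option State
  | .store addr val =>
    (addr.eval m s.mem).bind fun x => (val.eval m s.mem).bind fun v =>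
      if x < m.ramWords then
        some { s with
          mem := Function.update s.mem x v
          time := s.time + addr.cost + val.cost + 1 }
      else none
  | .read d addr =>
    (addr.eval m s.mem).bind fun x =>
      if x < m.ramWords then
        some { s with
          mem := Function.update s.mem x (s.disk d (s.head d) % 2 ^ m.wordBits)
          time := s.time + addr.cost + 1 }
      else none
  | .write d val =>
    (val.eval m s.mem).bind fun v =>
      if d = .input then none
      else
        some { s with
          disk := Function.update s.disk d
            (Function.update (s.disk d) (s.head d) (v % 2 ^ m.width d))
          time := s.time + val.cost + 1 }
  | .move d r =>
    (m.neighbour d (s.head d) r).bind fun p =>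
      some { s with
        head := Function.update s.head d p
        right := Function.update s.right d r
        time := s.time + 1
        passes := s.passes + if s.right d = r then 0 else 1
        accesses := s.accesses + if m.page d p = m.page d (s.head d) then 0 else 2 }

/-- `Exec m p s s'`: on machine `m`, program `p` started in state `s` runs without fault and
halts in state `s'`. -/
inductive Exec (m : Machine) : Cmd → State → State → Prop
  | skip (s : State) : Exec m .skip s s
  | atom {a : Atom} {s s' : State} : a.exec m s = some s' → Exec m (.atom a) s s'
  | seq {p q : Cmd} {s s' s'' : State} :
      Exec m p s s' → Exec m q s' s'' → Exec m (.seq p q) s s''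
  | ite_true {e : Expr} {p q : Cmd} {s s' : State} {v : ℕ} :
      e.eval m s.mem = some v → v ≠ 0 → Exec m p (s.tick (e.cost + 1)) s' →
      Exec m (.ite e p q) s s'
  | ite_false {e : Expr} {p q : Cmd} {s s' : State} :
      e.eval m s.mem = some 0 → Exec m q (s.tick (e.cost + 1)) s' →
      Exec m (.ite e p q) s s'
  | loop_done {e : Expr} {p : Cmd} {s : State} :
      e.eval m s.mem = some 0 → Exec m (.loop e p) s (s.tick (e.cost + 1))
  | loop_step {e : Expr} {p : Cmd} {s s' s'' : State} {v : ℕ} :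
      e.eval m s.mem = some v → v ≠ 0 → Exec m p (s.tick (e.cost + 1)) s' →
      Exec m (.loop e p) s' s'' → Exec m (.loop e p) s s''

/-- Initial state: the first three words of the internal memory hold the given parameters
`n`, `M`, `B` (if the memory is large enough to be addressed there), the input disk holds the
text, everything else is `0`, and all heads stand on the first cell. The first pass over each
disk, the fetch of its first page and the final write-back of a page are charged in advance. -/
def State.start {n σ : ℕ} (T : Fin n → Fin σ) (M B : ℕ) : State where
  mem a := if a = 0 then n else if a = 1 then M else if a = 2 then B else 0
  disk d p := if d = .input then (if h : p < n then (T ⟨p, h⟩ : ℕ) else 0) else 0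
  head _ := 0
  right _ := true
  time := 0
  passes := 3
  accesses := 6

end ScanModel

/-! The text is processed from right to left in blocks of at most `M` characters, with a constant
number of sweeps over the disks for each block. Let the suffixes that begin at or after `b` be
sorted on the output disk, and let the work disk hold, for every position `j`, one bit telling
whether the suffix at `j` exceeds the suffix at `b` (`PhaseInv`). The preceding block is `[a, a +
L)` with `a + L = b`.

Sorting the block. Comparing two suffixes that begin in the block may require text behind the block.
The bits replace that text: pair each character with the bit that says whether the suffix following
it exceeds the suffix at `b`, with bit `1` for the last character of the block. The suffixes of the
resulting string of length `L`, taken on its own, are ordered like the corresponding suffixes of the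
text (`slt_of_slt_block`, `sorted_of_block`). The string is sorted in internal memory in linear time
by the skew algorithm of Kärkkäinen and Sanders: sort the suffixes at positions not divisible by `3`
through the string of names of their triples, derive the order of the others, and merge. The
recursion is unrolled into a descent (`descend_run`) and an ascent (`ascend_run`), combined in
`sufSort_run`.

Ranks. Let `rk` of a position `j` be the number of block suffixes that precede the suffix at `j`.
Scanning from right to left, the rank at `j` follows from the character at `j`, the rank at `j + 1`
and the bit at `j + 1`, by a table with about `σ * L` entries (`BlockSA.rk_step`); this is backward
search. Comparing the rank at `j` with the rank of the suffix at `a` gives the new bit of `j`, which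
replaces the old one. The sweep also counts, in `gap`, how many tail suffixes have each rank.

Merging. The numbers `gap r` tell how many old entries precede the next block suffix, so no text is
needed for the merge (`Merged.stepg`, `Merged.stepf`). It takes place in place on the output disk:
writing is ahead of the consumption of old entries by the number of block suffixes already written,
which is at most `M`, so a cyclic buffer of `M + 1` entries suffices (`merge_sweep_run`).

Costs. A phase consists of four sweeps over three disks: at most `12` passes, `O(n / B)` page
accesses and `O(n)` time (`phase_run`). There are at most `n / M + 1` phases (`scanSort_run`).

The program is written in a small structured language and compiled to the machine. `BRun` and `MRun`
are Hoare triples with a time bound for code without head movements; `DRun` and `TRun` also account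
for passes and page accesses. The three heads always stand on the same cell number. -/

namespace ScanSort
open ScanModel

/-! ## A structured language whose memory is a family of rows -/

/-- The rows of the internal memory: scalar variables (cell `0` of their rows), arrays, three
lists of positions, and one array for each character. -/
inductive Row
  | vn | vM | vB | vx | va | vb | vL | vR | vg | vpa | vch | vr | vq
  | vN | vn1 | vm | voff | vlev | vkk | vi | vk | vsum | vy | vnm | vprev | vp | vc
  | aX | aG | aS | aSA | aRK | acnt | agap | aQ | aNN
  | l (k : Fin 3)
  | z (c : ℕ)
  deriving DecidableEq

/-- Number of rows other than the rows `z c`. -/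
abbrev rowBase : ℕ := 39

/-- The numbers `0`, `1`, `2` of `vn`, `vM`, `vB` are the addresses at which the machine deposits
its parameters, so these variables need no initialisation. -/
def Row.idx : Row → ℕ
  | .vn => 0 | .vM => 1 | .vB => 2 | .vx => 3 | .va => 4 | .vb => 5 | .vL => 6 | .vR => 7 | .vg => 8
  | .vpa => 9 | .vch => 10 | .vr => 11 | .vq => 12 | .vN => 13 | .vn1 => 14 | .vm => 15 | .voff => 16
  | .vlev => 17 | .vkk => 18 | .vi => 19 | .vk => 20 | .vsum => 21 | .vy => 22 | .vnm => 23
  | .vprev => 24 | .vp => 25 | .vc => 26 | .aX => 27 | .aG => 28 | .aS => 29 | .aSA => 30 | .aRK => 31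
  | .acnt => 32 | .agap => 33 | .aQ => 34 | .aNN => 35 | .l k => 36 + k
  | .z c => rowBase + c

def Row.ofIdx : ℕ → Row
  | 0 => .vn | 1 => .vM | 2 => .vB | 3 => .vx | 4 => .va | 5 => .vb | 6 => .vL | 7 => .vR | 8 => .vg
  | 9 => .vpa | 10 => .vch | 11 => .vr | 12 => .vq | 13 => .vN | 14 => .vn1 | 15 => .vm | 16 => .voff
  | 17 => .vlev | 18 => .vkk | 19 => .vi | 20 => .vk | 21 => .vsum | 22 => .vy | 23 => .vnm
  | 24 => .vprev | 25 => .vp | 26 => .vc | 27 => .aX | 28 => .aG | 29 => .aS | 30 => .aSA | 31 => .aRK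
  | 32 => .acnt | 33 => .agap | 34 => .aQ | 35 => .aNN | 36 => .l 0 | 37 => .l 1 | 38 => .l 2
  | k => .z (k - rowBase)

theorem Row.ofIdx_idx (r : Row) : Row.ofIdx r.idx = r := by
  cases r with
  | z c =>
    rw [Row.idx, Row.ofIdx]
    · simp
    all_goals (intros; simp only [rowBase] at *; omega)
  | l k => fin_cases k <;> rfl
  | _ => rfl

theorem Row.idx_injective : Function.Injective Row.idx :=
  Function.LeftInverse.injective Row.ofIdx_idx

/-- The rows that exist for an alphabet of size `σ`. -/
def Row.Valid (σ : ℕ) : Row → Prop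
  | .z c => c < σ
  | _ => True

theorem Row.Valid.idx_lt {σ : ℕ} {r : Row} (h : r.Valid σ) : r.idx < rowBase + σ := by
  cases r <;> simp_all [Row.idx, Row.Valid, rowBase] <;> omega

abbrev Mem := Row → ℕ → ℕ

abbrev Contents := Disk → ℕ → ℕ

def Mem.set (μ : Mem) (r : Row) (i v : ℕ) : Mem :=
  Function.update μ r (Function.update (μ r) i v)

@[simp] theorem Mem.set_self (μ : Mem) (r : Row) (i v : ℕ) :
    μ.set r i v r = Function.update (μ r) i v := by simp [Mem.set]

@[simp] theorem Mem.set_of_ne (μ : Mem) {r r' : Row} (h : r' ≠ r) (i v : ℕ) :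
    μ.set r i v r' = μ r' := by simp [Mem.set, h]

/-- Expressions over the rows. -/
inductive HE
  | lit (k : ℕ)
  | cell (r : Row) (i : HE)
  | zc (c i : HE)
  | bin (op : Op) (a b : HE)

instance (k : ℕ) : OfNat HE k := ⟨.lit k⟩
instance : Add HE := ⟨.bin .add⟩
instance : Sub HE := ⟨.bin .sub⟩
instance : Mul HE := ⟨.bin .mul⟩
instance : Div HE := ⟨.bin .div⟩
instance : Mod HE := ⟨.bin .mod⟩
abbrev HE.lt (a b : HE) : HE := .bin .lt a b
abbrev HE.eq (a b : HE) : HE := .bin .eq a b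
/-- The value of a scalar variable. -/
abbrev Row.v (r : Row) : HE := .cell r (.lit 0)

/-- Sizes: alphabet size, length of a row, and number of values of a word. -/
structure Cfg where
  σ : ℕ
  I : ℕ
  W : ℕ

def HE.val (μ : Mem) : HE → ℕ
  | .lit k => k
  | .cell r i => μ r (i.val μ)
  | .zc c i => μ (.z (c.val μ)) (i.val μ)
  | .bin op a b => op.eval (a.val μ) (b.val μ)

/-- No overflow. -/
def safe (W : ℕ) : Op → ℕ → ℕ → Prop
  | .add, x, y => x + y < W
  | .mul, x, y => x * y < W
  | _, _, _ => True

/-- The conditions under which the arithmetic of the machine, modulo the number of values of a word,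
agrees with the arithmetic of natural numbers in `HE.val`. Only constants, sums and products can
overflow. -/
def HE.ok (C : Cfg) (μ : Mem) : HE → Prop
  | .lit k => k < C.W
  | .cell r i => i.ok C μ ∧ i.val μ < C.I ∧ r.Valid C.σ
  | .zc c i => c.ok C μ ∧ i.ok C μ ∧ c.val μ < C.σ ∧ i.val μ < C.I
  | .bin op a b => a.ok C μ ∧ b.ok C μ ∧ safe C.W op (a.val μ) (b.val μ)

section simps
variable (C : Cfg) (μ : Mem) (a b : HE) (k : ℕ) (r : Row)

@[simp] theorem HE.val_ofNat : HE.val μ (ofNat(k) : HE) = k := rfl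
@[simp] theorem HE.val_lit : HE.val μ (.lit k) = k := rfl
@[simp] theorem HE.val_cell : HE.val μ (.cell r a) = μ r (a.val μ) := rfl
@[simp] theorem HE.val_zc : HE.val μ (.zc a b) = μ (.z (a.val μ)) (b.val μ) := rfl
@[simp] theorem HE.val_add : (a + b).val μ = a.val μ + b.val μ := rfl
@[simp] theorem HE.val_sub : (a - b).val μ = a.val μ - b.val μ := rfl
@[simp] theorem HE.val_mul : (a * b).val μ = a.val μ * b.val μ := rfl
@[simp] theorem HE.val_div : (a / b).val μ = a.val μ / b.val μ := rfl
@[simp] theorem HE.val_mod : (a % b).val μ = a.val μ % b.val μ := rfl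
@[simp] theorem HE.val_lt : (HE.bin .lt a b).val μ = if a.val μ < b.val μ then 1 else 0 := rfl
@[simp] theorem HE.val_eq : (HE.bin .eq a b).val μ = if a.val μ = b.val μ then 1 else 0 := rfl
@[simp] theorem HE.ok_ofNat : HE.ok C μ (ofNat(k) : HE) ↔ k < C.W := Iff.rfl
@[simp] theorem HE.ok_lit : HE.ok C μ (.lit k) ↔ k < C.W := Iff.rfl
@[simp] theorem HE.ok_cell :
    HE.ok C μ (.cell r a) ↔ a.ok C μ ∧ a.val μ < C.I ∧ r.Valid C.σ := Iff.rfl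
@[simp] theorem HE.ok_zc :
    HE.ok C μ (.zc a b) ↔ a.ok C μ ∧ b.ok C μ ∧ a.val μ < C.σ ∧ b.val μ < C.I := Iff.rfl
@[simp] theorem HE.ok_add :
    (a + b).ok C μ ↔ a.ok C μ ∧ b.ok C μ ∧ a.val μ + b.val μ < C.W := Iff.rfl
@[simp] theorem HE.ok_mul :
    (a * b).ok C μ ↔ a.ok C μ ∧ b.ok C μ ∧ a.val μ * b.val μ < C.W := Iff.rfl
@[simp] theorem HE.ok_sub : (a - b).ok C μ ↔ a.ok C μ ∧ b.ok C μ :=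
  ⟨fun h => ⟨h.1, h.2.1⟩, fun h => ⟨h.1, h.2, trivial⟩⟩
@[simp] theorem HE.ok_div : (a / b).ok C μ ↔ a.ok C μ ∧ b.ok C μ :=
  ⟨fun h => ⟨h.1, h.2.1⟩, fun h => ⟨h.1, h.2, trivial⟩⟩
@[simp] theorem HE.ok_mod : (a % b).ok C μ ↔ a.ok C μ ∧ b.ok C μ :=
  ⟨fun h => ⟨h.1, h.2.1⟩, fun h => ⟨h.1, h.2, trivial⟩⟩
@[simp] theorem HE.ok_lt : (HE.bin .lt a b).ok C μ ↔ a.ok C μ ∧ b.ok C μ :=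
  ⟨fun h => ⟨h.1, h.2.1⟩, fun h => ⟨h.1, h.2, trivial⟩⟩
@[simp] theorem HE.ok_eq : (HE.bin .eq a b).ok C μ ↔ a.ok C μ ∧ b.ok C μ :=
  ⟨fun h => ⟨h.1, h.2.1⟩, fun h => ⟨h.1, h.2, trivial⟩⟩

end simps

/-! ## Compilation -/

/-- Rows are interleaved: the stride is the number of rows, which depends on `σ` alone. Rows stored
one behind the other would bring their length, hence `M`, into the fixed program. -/
def addrE (σ : ℕ) (r i : Expr) : Expr := .bin .add (.bin .mul (.lit (rowBase + σ)) i) r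

def HE.compile (σ : ℕ) : HE → Expr
  | .lit k => .lit k
  | .cell r i => .load (addrE σ (.lit r.idx) (i.compile σ))
  | .zc c i => .load (addrE σ (.bin .add (.lit rowBase) (c.compile σ)) (i.compile σ))
  | .bin op a b => .bin op (a.compile σ) (b.compile σ)

/-- Programs without head movements. -/
inductive HC
  | skip
  | set (r : Row) (i e : HE)
  | setz (c i e : HE)
  | read (d : Disk) (r : Row) (i : HE)
  | write (d : Disk) (e : HE)
  | seq (p q : HC)
  | ite (e : HE) (p q : HC)
  | loop (e : HE) (p : HC)

infixr:60 " ;; " => HC.seq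

/-- Assignment to a scalar variable. -/
abbrev HC.asg (r : Row) (e : HE) : HC := .set r (.lit 0) e

def HC.compile (σ : ℕ) : HC → Cmd
  | .skip => .skip
  | .set r i e => .atom (.store (addrE σ (.lit r.idx) (i.compile σ)) (e.compile σ))
  | .setz c i e => .atom (.store
      (addrE σ (.bin .add (.lit rowBase) (c.compile σ)) (i.compile σ)) (e.compile σ))
  | .read d r i => .atom (.read d (addrE σ (.lit r.idx) (i.compile σ)))
  | .write d e => .atom (.write d (e.compile σ))
  | .seq p q => .seq (p.compile σ) (q.compile σ)
  | .ite e p q => .ite (e.compile σ) (p.compile σ) (q.compile σ)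
  | .loop e p => .loop (e.compile σ) (p.compile σ)

def HE.cost : HE → ℕ
  | .lit _ => 1
  | .cell _ i => i.cost + 5
  | .zc c i => c.cost + i.cost + 6
  | .bin _ a b => a.cost + b.cost + 1

theorem HE.cost_compile (σ : ℕ) (e : HE) : (e.compile σ).cost = e.cost := by
  induction e <;> simp_all [HE.compile, HE.cost, Expr.cost, addrE] <;> omega

/-- Time bound for programs without loops. -/
def HC.bound : HC → ℕ
  | .skip => 0
  | .set _ i e => i.cost + e.cost + 5
  | .setz c i e => c.cost + i.cost + e.cost + 6
  | .read _ _ i => i.cost + 5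
  | .write _ e => e.cost + 1
  | .seq p q => p.bound + q.bound
  | .ite e p q => e.cost + 1 + max p.bound q.bound
  | .loop _ _ => 0

/-- The machine has room for the rows. -/
structure Fits (C : Cfg) (m : Machine) : Prop where
  word : C.W = 2 ^ m.wordBits
  ram : (rowBase + C.σ) * C.I ≤ m.ramWords
  small : (rowBase + C.σ) * C.I ≤ C.W
  pos : 1 < C.I

/-- The internal memory holds the given rows. -/
def Rep (C : Cfg) (mem : ℕ → ℕ) (μ : Mem) : Prop :=
  ∀ r : Row, r.Valid C.σ → ∀ i < C.I,
    mem ((rowBase + C.σ) * i + r.idx) = μ r i ∧ μ r i < C.W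

section compile
variable {C : Cfg} {m : Machine} {mem : ℕ → ℕ} {μ : Mem}

theorem Row.addr_lt (r : Row) (hr : r.Valid C.σ) {i : ℕ} (hi : i < C.I) :
    (rowBase + C.σ) * i + r.idx < (rowBase + C.σ) * C.I := by
  have h1 := hr.idx_lt
  have h2 : (rowBase + C.σ) * (i + 1) ≤ (rowBase + C.σ) * C.I := Nat.mul_le_mul_left _ hi
  rw [Nat.mul_add] at h2
  omega

theorem Row.addr_inj {r r' : Row} (hr : r.Valid C.σ) (hr' : r'.Valid C.σ) {i i' : ℕ}
    (h : (rowBase + C.σ) * i + r.idx = (rowBase + C.σ) * i' + r'.idx) : r = r' ∧ i = i' := by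
  have h1 := hr.idx_lt
  have h2 := hr'.idx_lt
  have e1 : i = i' := by
    have := congrArg (· / (rowBase + C.σ)) h
    rwa [Nat.mul_add_div (by omega), Nat.mul_add_div (by omega), Nat.div_eq_of_lt h1,
      Nat.div_eq_of_lt h2, add_zero, add_zero] at this
  subst e1
  exact ⟨Row.idx_injective (by omega), rfl⟩

theorem eval_bin {op : Op} {a b : Expr} {x y : ℕ} (ha : a.eval m mem = some x)
    (hb : b.eval m mem = some y) :
    (Expr.bin op a b).eval m mem = some (op.eval x y % 2 ^ m.wordBits) := by
  simp [Expr.eval, ha, hb]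

theorem eval_lit (hF : Fits C m) {k : ℕ} (h : k < C.W) : (Expr.lit k).eval m mem = some k := by
  rw [hF.word] at h
  simp [Expr.eval, Nat.mod_eq_of_lt h]

theorem eval_addr (hF : Fits C m) {r : Row} (hr : r.Valid C.σ) {er ei : Expr} {i : ℕ}
    (her : er.eval m mem = some r.idx) (hei : ei.eval m mem = some i) (hi : i < C.I) :
    (addrE C.σ er ei).eval m mem = some ((rowBase + C.σ) * i + r.idx) := by
  have h1 := r.addr_lt hr hi
  have h2 := hF.small
  have h3 : rowBase + C.σ < C.W := by
    have : (rowBase + C.σ) * 2 ≤ (rowBase + C.σ) * C.I := Nat.mul_le_mul_left _ hF.pos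
    have : 0 < rowBase := by decide
    omega
  have e1 := eval_bin (op := .mul) (eval_lit (mem := mem) hF h3) hei
  rw [show Op.eval .mul (rowBase + C.σ) i = (rowBase + C.σ) * i from rfl,
    Nat.mod_eq_of_lt (by rw [← hF.word]; omega)] at e1
  have e2 := eval_bin (op := .add) e1 her
  rwa [show Op.eval .add ((rowBase + C.σ) * i) r.idx = (rowBase + C.σ) * i + r.idx from rfl,
    Nat.mod_eq_of_lt (by rw [← hF.word]; omega)] at e2

theorem op_lt (hF : Fits C m) {op : Op} {x y : ℕ} (hx : x < C.W) (hs : safe C.W op x y) :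
    op.eval x y < C.W := by
  have h1 : 1 < C.W := by
    have h2 : (rowBase + C.σ) * 2 ≤ (rowBase + C.σ) * C.I := Nat.mul_le_mul_left _ hF.pos
    have h3 := hF.small
    have h4 : 0 < rowBase := by decide
    omega
  cases op <;> simp only [Op.eval, safe] at *
  · exact hs
  · omega
  · exact hs
  · exact lt_of_le_of_lt (Nat.div_le_self _ _) hx
  · exact lt_of_le_of_lt (Nat.mod_le _ _) hx
  · split_ifs <;> omega
  · split_ifs <;> omega

theorem HE.eval_compile (hF : Fits C m) (hR : Rep C mem μ) (e : HE) (h : e.ok C μ) :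
    (e.compile C.σ).eval m mem = some (e.val μ) ∧ e.val μ < C.W := by
  induction e with
  | lit k => exact ⟨eval_lit hF h, h⟩
  | cell r i ih =>
    obtain ⟨h1, h2, h3⟩ := h
    have e1 := eval_addr hF h3 (eval_lit (k := r.idx) hF ?_) (ih h1).1 h2
    · have h4 := r.addr_lt h3 h2
      refine ⟨?_, (hR r h3 _ h2).2⟩
      simp only [HE.compile, Expr.eval, e1, Option.bind_some, HE.val]
      rw [if_pos (lt_of_lt_of_le h4 hF.ram), (hR r h3 _ h2).1]
    · have h5 := h3.idx_lt
      have := hF.small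
      have : (rowBase + C.σ) * 1 ≤ (rowBase + C.σ) * C.I := Nat.mul_le_mul_left _ hF.pos.le
      omega
  | zc c i ihc ihi =>
    obtain ⟨h1, h2, h3, h4⟩ := h
    have h6 := hF.small
    have h7 : (rowBase + C.σ) * 1 ≤ (rowBase + C.σ) * C.I := Nat.mul_le_mul_left _ hF.pos.le
    have e0 := eval_bin (op := .add) (eval_lit (m := m) (mem := mem) (k := rowBase) hF (by omega))
      (ihc h1).1
    rw [show Op.eval .add rowBase (c.val μ) = rowBase + c.val μ from rfl,
      Nat.mod_eq_of_lt (by rw [← hF.word]; omega)] at e0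
    have e1 := eval_addr (r := .z (c.val μ)) hF h3 e0 (ihi h2).1 h4
    have h5 := Row.addr_lt (C := C) (.z (c.val μ)) h3 h4
    refine ⟨?_, (hR (.z _) h3 _ h4).2⟩
    simp only [HE.compile, Expr.eval, e1, Option.bind_some, HE.val]
    rw [if_pos (lt_of_lt_of_le h5 hF.ram), (hR (.z _) h3 _ h4).1]
  | bin op a b iha ihb =>
    obtain ⟨h1, h2, h3⟩ := h
    have h4 : op.eval (a.val μ) (b.val μ) < C.W := op_lt hF (iha h1).2 h3
    refine ⟨?_, h4⟩
    have := eval_bin (op := op) (iha h1).1 (ihb h2).1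
    rwa [← hF.word, Nat.mod_eq_of_lt h4] at this

theorem HE.eval_addr_cell (hF : Fits C m) (hR : Rep C mem μ) {r : Row} {i : HE} (hi : i.ok C μ)
    (hI : i.val μ < C.I) (hr : r.Valid C.σ) :
    (addrE C.σ (.lit r.idx) (i.compile C.σ)).eval m mem =
      some ((rowBase + C.σ) * i.val μ + r.idx) := by
  refine eval_addr hF hr (eval_lit hF ?_) (i.eval_compile hF hR hi).1 hI
  have h5 := hr.idx_lt
  have := hF.small
  have : (rowBase + C.σ) * 1 ≤ (rowBase + C.σ) * C.I := Nat.mul_le_mul_left _ hF.pos.le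
  omega

theorem HE.eval_addr_zc (hF : Fits C m) (hR : Rep C mem μ) {c i : HE} (hc : c.ok C μ)
    (hi : i.ok C μ) (hI : i.val μ < C.I) (hσ : c.val μ < C.σ) :
    (addrE C.σ (.bin .add (.lit rowBase) (c.compile C.σ)) (i.compile C.σ)).eval m mem =
      some ((rowBase + C.σ) * i.val μ + (Row.z (c.val μ)).idx) := by
  have h6 := hF.small
  have h7 : (rowBase + C.σ) * 1 ≤ (rowBase + C.σ) * C.I := Nat.mul_le_mul_left _ hF.pos.le
  have e0 := eval_bin (op := .add) (eval_lit (m := m) (mem := mem) (k := rowBase) hF (by omega))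
    (c.eval_compile hF hR hc).1
  rw [show Op.eval .add rowBase (c.val μ) = rowBase + c.val μ from rfl,
    Nat.mod_eq_of_lt (by rw [← hF.word]; omega)] at e0
  exact eval_addr (r := .z (c.val μ)) hF hσ e0 (i.eval_compile hF hR hi).1 hI

theorem Rep.set (hR : Rep C mem μ) {r : Row} {i v : ℕ} (hr : r.Valid C.σ) (hv : v < C.W) :
    Rep C (Function.update mem ((rowBase + C.σ) * i + r.idx) v) (μ.set r i v) := by
  intro r' hr' i' hi'
  by_cases h : r' = r
  · subst h
    by_cases h2 : i' = i
    · subst h2; simp [hv]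
    · have : (rowBase + C.σ) * i' + r'.idx ≠ (rowBase + C.σ) * i + r'.idx :=
        fun h => h2 (Row.addr_inj hr' hr h).2
      simpa [this, h2] using hR r' hr' i' hi'
  · have : (rowBase + C.σ) * i' + r'.idx ≠ (rowBase + C.σ) * i + r.idx :=
      fun h' => h (Row.addr_inj hr' hr h').1
    simpa [this, h] using hR r' hr' i' hi'

end compile

/-! ## Total correctness with time bounds -/

def Contents.put (D : Contents) (d : Disk) (x v : ℕ) : Contents :=
  Function.update D d (Function.update (D d) x v)

/-- Weakest precondition of a program without loops, with all heads on cell `x`. -/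
def wp (C : Cfg) (m : Machine) (x : ℕ) :
    HC → (Mem → Contents → Prop) → Mem → Contents → Prop
  | .skip, P => P
  | .set r i e, P => fun μ D => i.ok C μ ∧ e.ok C μ ∧ i.val μ < C.I ∧ r.Valid C.σ ∧
      P (μ.set r (i.val μ) (e.val μ)) D
  | .setz c i e, P => fun μ D => c.ok C μ ∧ i.ok C μ ∧ e.ok C μ ∧ i.val μ < C.I ∧ c.val μ < C.σ ∧
      P (μ.set (.z (c.val μ)) (i.val μ) (e.val μ)) D
  | .read d r i, P => fun μ D => i.ok C μ ∧ i.val μ < C.I ∧ r.Valid C.σ ∧ D d x < C.W ∧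
      P (μ.set r (i.val μ) (D d x)) D
  | .write d e, P => fun μ D => d ≠ .input ∧ e.ok C μ ∧
      P μ (D.put d x (e.val μ % 2 ^ m.width d))
  | .seq p q, P => wp C m x p (wp C m x q P)
  | .ite e p q, P => fun μ D => e.ok C μ ∧ (e.val μ ≠ 0 → wp C m x p P μ D) ∧
      (e.val μ = 0 → wp C m x q P μ D)
  | .loop _ _, _ => fun _ _ => False

/-- Started with all heads on cell `x`, memory `μ` and disks `D`, the program runs without head
movements for at most `t` units of time and establishes `P`. -/
def BRun (C : Cfg) (m : Machine) (x : ℕ) (p : HC) (μ : Mem) (D : Contents) (t : ℕ)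
    (P : Mem → Contents → Prop) : Prop :=
  ∀ s : State, Rep C s.mem μ → s.disk = D → (∀ d, s.head d = x) →
    ∃ s' μ' D', Exec m (p.compile C.σ) s s' ∧ P μ' D' ∧ Rep C s'.mem μ' ∧ s'.disk = D' ∧
      s'.head = s.head ∧ s'.right = s.right ∧ s'.passes = s.passes ∧
      s'.accesses = s.accesses ∧ s'.time ≤ s.time + t

section rules
variable {C : Cfg} {m : Machine} {x : ℕ} {p q : HC} {e : HE} {μ : Mem} {D : Contents}
  {t t' : ℕ} {P P' : Mem → Contents → Prop}

theorem BRun.mono (h : BRun C m x p μ D t P) (ht : t ≤ t') (hP : ∀ μ D, P μ D → P' μ D) :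
    BRun C m x p μ D t' P' := by
  intro s h1 h2 h3
  obtain ⟨s', μ', D', g1, g2, g3, g4, g5, g6, g7, g8, g9⟩ := h s h1 h2 h3
  exact ⟨s', μ', D', g1, hP _ _ g2, g3, g4, g5, g6, g7, g8, by omega⟩

theorem BRun.seq (h : BRun C m x p μ D t fun μ' D' => BRun C m x q μ' D' t' P) :
    BRun C m x (p ;; q) μ D (t + t') P := by
  intro s h1 h2 h3
  obtain ⟨s', μ', D', g1, g2, g3, g4, g5, g6, g7, g8, g9⟩ := h s h1 h2 h3
  obtain ⟨s2, μ2, D2, k1, k2, k3, k4, k5, k6, k7, k8, k9⟩ := g2 s' g3 g4 (by simpa [g5] using h3)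
  exact ⟨s2, μ2, D2, .seq g1 k1, k2, k3, k4, k5.trans g5, k6.trans g6, k7.trans g7, k8.trans g8,
    by omega⟩

theorem BRun.bind {P₁ : Mem → Contents → Prop} (h : BRun C m x p μ D t P₁)
    (h' : ∀ μ D, P₁ μ D → BRun C m x q μ D t' P) : BRun C m x (p ;; q) μ D (t + t') P :=
  (h.mono le_rfl h').seq

theorem BRun.ite (hF : Fits C m) (he : e.ok C μ) (hp : e.val μ ≠ 0 → BRun C m x p μ D t P)
    (hq : e.val μ = 0 → BRun C m x q μ D t P) : BRun C m x (.ite e p q) μ D (t + e.cost + 1) P := by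
  intro s h1 h2 h3
  have e2 := e.eval_compile hF h1 he
  by_cases h0 : e.val μ = 0
  · obtain ⟨s', μ', D', g1, g2, g3, g4, g5, g6, g7, g8, g9⟩ :=
      hq h0 (s.tick ((e.compile C.σ).cost + 1)) h1 h2 h3
    refine ⟨s', μ', D', .ite_false (h0 ▸ e2.1) g1, g2, g3, g4, g5, g6, g7, g8, ?_⟩
    simp only [State.tick, HE.cost_compile] at *
    omega
  · obtain ⟨s', μ', D', g1, g2, g3, g4, g5, g6, g7, g8, g9⟩ :=
      hp h0 (s.tick ((e.compile C.σ).cost + 1)) h1 h2 h3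
    refine ⟨s', μ', D', .ite_true e2.1 h0 g1, g2, g3, g4, g5, g6, g7, g8, ?_⟩
    simp only [State.tick, HE.cost_compile] at *
    omega

/-- Code without loops is verified by unfolding `wp`, which leaves arithmetic side conditions; its
time bound is read off the syntax. Invariants are needed for loops only. -/
theorem BRun.of_wp (hF : Fits C m) (h : wp C m x p P μ D) : BRun C m x p μ D p.bound P := by
  induction p generalizing P μ D with
  | skip =>
    intro s h1 h2 h3
    exact ⟨s, μ, D, .skip s, h, h1, h2, rfl, rfl, rfl, rfl, by simp⟩
  | set r i e =>
    intro s h1 h2 h3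
    obtain ⟨k1, k2, k3, k4, k5⟩ := h
    have e1 := HE.eval_addr_cell hF h1 k1 k3 k4
    have e2 := e.eval_compile hF h1 k2
    have h4 := lt_of_lt_of_le (r.addr_lt k4 k3) hF.ram
    have hx : Atom.exec m s (.store (addrE C.σ (.lit r.idx) (i.compile C.σ)) (e.compile C.σ)) = some { s with
        mem := Function.update s.mem ((rowBase + C.σ) * i.val μ + r.idx) (e.val μ)
        time := s.time + (addrE C.σ (.lit r.idx) (i.compile C.σ)).cost + (e.compile C.σ).cost + 1 } := by
      simp only [Atom.exec, e1, e2.1, Option.bind_some, if_pos h4]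
    exact ⟨_, _, _, .atom hx, k5, h1.set k4 e2.2, h2, rfl, rfl, rfl, rfl, by
        simp only [HC.bound, addrE, Expr.cost, HE.cost_compile]; omega⟩
  | setz c i e =>
    intro s h1 h2 h3
    obtain ⟨k0, k1, k2, k3, k4, k5⟩ := h
    have e1 := HE.eval_addr_zc hF h1 k0 k1 k3 k4
    have e2 := e.eval_compile hF h1 k2
    have h4 := lt_of_lt_of_le (Row.addr_lt (.z (c.val μ)) k4 k3) hF.ram
    have hx : Atom.exec m s (.store (addrE C.σ (.bin .add (.lit rowBase) (c.compile C.σ)) (i.compile C.σ)) (e.compile C.σ)) = some { s with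
        mem := Function.update s.mem ((rowBase + C.σ) * i.val μ + (Row.z (c.val μ)).idx) (e.val μ)
        time := s.time + (addrE C.σ (.bin .add (.lit rowBase) (c.compile C.σ)) (i.compile C.σ)).cost + (e.compile C.σ).cost + 1 } := by
      simp only [Atom.exec, e1, e2.1, Option.bind_some, if_pos h4]
    exact ⟨_, _, _, .atom hx, k5, h1.set (r := .z (c.val μ)) k4 e2.2, h2, rfl, rfl, rfl, rfl, by
        simp only [HC.bound, addrE, Expr.cost, HE.cost_compile]; omega⟩
  | read d r i =>
    intro s h1 h2 h3
    obtain ⟨k1, k3, k4, k5, k6⟩ := h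
    have e1 := HE.eval_addr_cell hF h1 k1 k3 k4
    have h4 := lt_of_lt_of_le (r.addr_lt k4 k3) hF.ram
    have hx : Atom.exec m s (.read d (addrE C.σ (.lit r.idx) (i.compile C.σ))) = some { s with
        mem := Function.update s.mem ((rowBase + C.σ) * i.val μ + r.idx) (D d x)
        time := s.time + (addrE C.σ (.lit r.idx) (i.compile C.σ)).cost + 1 } := by
      simp only [Atom.exec, e1, Option.bind_some, if_pos h4, h2, h3, ← hF.word, Nat.mod_eq_of_lt k5]
    exact ⟨_, _, _, .atom hx, k6, h1.set k4 k5, h2, rfl, rfl, rfl, rfl, by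
        simp only [HC.bound, addrE, Expr.cost, HE.cost_compile]; omega⟩
  | write d e =>
    intro s h1 h2 h3
    obtain ⟨k1, k2, k3⟩ := h
    have e2 := e.eval_compile hF h1 k2
    have hx : Atom.exec m s (.write d (e.compile C.σ)) = some { s with
        disk := D.put d x (e.val μ % 2 ^ m.width d)
        time := s.time + (e.compile C.σ).cost + 1 } := by
      simp only [Atom.exec, e2.1, Option.bind_some, if_neg k1, h2, h3, Contents.put]
    exact ⟨_, _, _, .atom hx, k3, h1, rfl, rfl, rfl, rfl, rfl, by
        simp only [HC.bound, HE.cost_compile]; omega⟩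
  | seq p q ihp ihq => exact (ihp (P := wp C m x q P) h |>.mono le_rfl fun _ _ h => ihq h).seq
  | ite e p q ihp ihq =>
    refine (BRun.ite hF h.1 (fun h0 => (ihp (h.2.1 h0)).mono (le_max_left _ _) fun _ _ h => h)
      fun h0 => (ihq (h.2.2 h0)).mono (le_max_right _ _) fun _ _ h => h).mono ?_ fun _ _ h => h
    simp only [HC.bound]
    omega
  | loop e p => exact h.elim

/-- A loop whose invariant carries a bound on the remaining time. -/
theorem BRun.loop (hF : Fits C m) (Inv : ℕ → Mem → Contents → Prop) {k : ℕ} (h0 : Inv k μ D)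
    (hok : ∀ k μ D, Inv k μ D → e.ok C μ)
    (hstep : ∀ k μ D, Inv k μ D → e.val μ ≠ 0 → ∃ t k', t + (e.cost + 1) + k' ≤ k ∧
      BRun C m x p μ D t (Inv k')) :
    BRun C m x (.loop e p) μ D (k + (e.cost + 1))
      fun μ' D' => ∃ k', Inv k' μ' D' ∧ e.val μ' = 0 := by
  induction k using Nat.strong_induction_on generalizing μ D with
  | _ k ih =>
    intro s h1 h2 h3
    have e2 := e.eval_compile hF h1 (hok _ _ _ h0)
    by_cases hv : e.val μ = 0
    · refine ⟨_, μ, D, .loop_done (hv ▸ e2.1), ⟨k, h0, hv⟩, h1, h2, rfl, rfl, rfl, rfl, ?_⟩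
      simp only [State.tick, HE.cost_compile]
      omega
    · obtain ⟨t, k', hk, hb⟩ := hstep _ _ _ h0 hv
      obtain ⟨s', μ', D', g1, g2, g3, g4, g5, g6, g7, g8, g9⟩ :=
        hb (s.tick ((e.compile C.σ).cost + 1)) h1 h2 h3
      obtain ⟨s2, μ2, D2, k1, k2, k3, k4, k5, k6, k7, k8, k9⟩ :=
        ih k' (by omega) g2 s' g3 g4 (by rw [g5]; exact h3)
      refine ⟨s2, μ2, D2, .loop_step e2.1 hv g1 k1, k2, k3, k4, k5.trans g5, k6.trans g6,
        k7.trans g7, k8.trans g8, ?_⟩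
      simp only [State.tick, HE.cost_compile] at *
      omega

/-- `for r = 0, …, e - 1 do p` -/
def forUp (r : Row) (e : HE) (p : HC) : HC :=
  .asg r 0 ;; .loop (.lt r.v e) (p ;; .asg r (r.v + 1))

/-- The rule itself performs the increment, so the body has to leave the counter at `i` and to
establish the invariant for the memory in which the counter is already `i + 1`. The summand `22`
pays for the test and the increment, `20` for the initialisation and the last test. -/
theorem BRun.forUp (hF : Fits C m) {r : Row} (hr : r.Valid C.σ) {N : ℕ} (hN : N < C.W)
    (Inv : ℕ → Mem → Contents → Prop) (h0 : Inv 0 (μ.set r 0 0) D)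
    (he : ∀ i μ D, i ≤ N → Inv i μ D → e.ok C μ ∧ e.val μ = N ∧ μ r 0 = i)
    (hstep : ∀ i μ D, i < N → Inv i μ D → BRun C m x p μ D t
      fun μ' D' => μ' r 0 = i ∧ Inv (i + 1) (μ'.set r 0 (i + 1)) D') :
    BRun C m x (forUp r e p) μ D (N * (t + e.cost + 22) + (e.cost + 20)) (Inv N) := by
  have hW : 1 < C.W := by
    have h2 : (rowBase + C.σ) * 2 ≤ (rowBase + C.σ) * C.I := Nat.mul_le_mul_left _ hF.pos
    have h3 := hF.small
    have h4 : 0 < rowBase := by decide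
    omega
  have hI := hF.pos
  have hA : BRun C m x (.asg r 0) μ D (HC.bound (.asg r 0)) (Inv 0) :=
    .of_wp hF <| by
      simp only [wp, HE.ok_lit, HE.val_lit, HE.ok_ofNat, HE.val_ofNat]
      exact ⟨by omega, by omega, by omega, hr, h0⟩
  refine (hA.bind (t' := N * (t + e.cost + 22) + (HE.cost (.lt r.v e) + 1)) fun μ1 D1 h1 => ?_).mono
    ?_ fun _ _ h => h
  · refine (BRun.loop hF (fun k μ D => ∃ i ≤ N, k = (N - i) * (t + e.cost + 22) ∧ Inv i μ D)
      ⟨0, Nat.zero_le _, by simp, h1⟩ ?_ ?_).mono le_rfl ?_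
    · rintro k μ D ⟨i, hi, -, h⟩
      obtain ⟨a1, -, -⟩ := he i μ D hi h
      simp only [HE.ok_lt, HE.ok_cell, HE.ok_lit, HE.val_lit]
      exact ⟨⟨by omega, by omega, hr⟩, a1⟩
    · rintro k μ D ⟨i, hi, rfl, h⟩ hv
      obtain ⟨a1, a2, a3⟩ := he i μ D hi h
      simp only [HE.val_lt, HE.val_cell, HE.val_lit, a2, a3, ne_eq, ite_eq_right_iff, one_ne_zero,
        imp_false, not_not] at hv
      refine ⟨t + HC.bound (.asg r (r.v + 1)), (N - (i + 1)) * (t + e.cost + 22), ?_, ?_⟩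
      · rw [show N - i = N - (i + 1) + 1 by omega, Nat.add_mul]
        simp only [HC.bound, HE.cost]
        omega
      · refine BRun.seq ((hstep i μ D hv h).mono le_rfl fun μ' D' hh => ?_)
        refine .of_wp hF ?_
        simp only [wp, HE.ok_add, HE.ok_cell, HE.ok_lit, HE.val_lit, HE.ok_ofNat, HE.val_cell,
          HE.val_ofNat, HE.val_add, hh.1]
        exact ⟨by omega, ⟨⟨by omega, by omega, hr⟩, by omega, by omega⟩, by omega, hr, i + 1, hv,
          rfl, hh.2⟩
    · rintro μ D ⟨k, ⟨i, hi, -, h⟩, hv⟩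
      obtain ⟨a1, a2, a3⟩ := he i μ D hi h
      simp only [HE.val_lt, HE.val_cell, HE.val_lit, a2, a3, ite_eq_right_iff, one_ne_zero,
        imp_false, not_lt] at hv
      rwa [show N = i by omega]
  · simp only [HC.bound, HE.cost]
    omega

end rules

/-! ## Programs that use the internal memory only -/

/-- The program runs from memory `μ` for at most `t` units of time, leaves the disks alone and
establishes `P`. -/
def MRun (C : Cfg) (m : Machine) (p : HC) (μ : Mem) (t : ℕ) (P : Mem → Prop) : Prop :=
  ∀ x D, BRun C m x p μ D t fun μ' D' => D' = D ∧ P μ'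

section memory
variable {C : Cfg} {m : Machine} {p q : HC} {e : HE} {μ : Mem} {t t' : ℕ} {P P' : Mem → Prop}

theorem MRun.mono (h : MRun C m p μ t P) (ht : t ≤ t') (hP : ∀ μ, P μ → P' μ) :
    MRun C m p μ t' P' :=
  fun x D => (h x D).mono ht fun μ _ h => ⟨h.1, hP μ h.2⟩

theorem MRun.bind {P₁ : Mem → Prop} (h : MRun C m p μ t P₁)
    (h' : ∀ μ, P₁ μ → MRun C m q μ t' P) : MRun C m (p ;; q) μ (t + t') P :=
  fun x D => (h x D).bind fun μ' D' h1 => by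
    obtain ⟨rfl, h1⟩ := h1
    exact h' μ' h1 x D'

theorem MRun.of_wp (hF : Fits C m)
    (h : ∀ x D, wp C m x p (fun μ' D' => D' = D ∧ P μ') μ D) : MRun C m p μ p.bound P :=
  fun x D => .of_wp hF (h x D)

theorem MRun.ite (hF : Fits C m) (he : e.ok C μ) (hp : e.val μ ≠ 0 → MRun C m p μ t P)
    (hq : e.val μ = 0 → MRun C m q μ t P) : MRun C m (.ite e p q) μ (t + e.cost + 1) P :=
  fun x D => .ite hF he (fun h => hp h x D) fun h => hq h x D

theorem MRun.loop (hF : Fits C m) (Inv : ℕ → Mem → Prop) {k : ℕ} (h0 : Inv k μ)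
    (hok : ∀ k μ, Inv k μ → e.ok C μ)
    (hstep : ∀ k μ, Inv k μ → e.val μ ≠ 0 → ∃ t k', t + (e.cost + 1) + k' ≤ k ∧
      MRun C m p μ t (Inv k')) :
    MRun C m (.loop e p) μ (k + (e.cost + 1)) fun μ' => ∃ k', Inv k' μ' ∧ e.val μ' = 0 := by
  intro x D
  refine (BRun.loop hF (fun k μ' D' => D' = D ∧ Inv k μ') ⟨rfl, h0⟩ (fun k μ' D' h => hok _ _ h.2)
    ?_).mono le_rfl ?_
  · rintro k μ' D' ⟨rfl, h⟩ hv
    obtain ⟨t, k', h1, h2⟩ := hstep k μ' h hv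
    exact ⟨t, k', h1, h2 x D'⟩
  · rintro μ' D' ⟨k', ⟨h1, h2⟩, h3⟩
    exact ⟨h1, k', h2, h3⟩

theorem MRun.forUp (hF : Fits C m) {r : Row} (hr : r.Valid C.σ) {N : ℕ} (hN : N < C.W)
    (Inv : ℕ → Mem → Prop) (h0 : Inv 0 (μ.set r 0 0))
    (he : ∀ i μ, i ≤ N → Inv i μ → e.ok C μ ∧ e.val μ = N ∧ μ r 0 = i)
    (hstep : ∀ i μ, i < N → Inv i μ → MRun C m p μ t
      fun μ' => μ' r 0 = i ∧ Inv (i + 1) (μ'.set r 0 (i + 1))) :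
    MRun C m (forUp r e p) μ (N * (t + e.cost + 22) + (e.cost + 20)) (Inv N) := by
  intro x D
  refine BRun.forUp hF hr hN (fun i μ' D' => D' = D ∧ Inv i μ') ⟨rfl, h0⟩
    (fun i μ' D' h1 h2 => he i μ' h1 h2.2) ?_
  rintro i μ' D' h1 ⟨rfl, h2⟩
  refine (hstep i μ' h1 h2 x D').mono le_rfl ?_
  rintro μ2 D2 ⟨rfl, h3, h4⟩
  exact ⟨h3, rfl, h4⟩

end memory

/-- The slack from which `omega` derives that sums of a few indices do not overflow. -/
theorem Fits.mul_I_le {C : Cfg} {m : Machine} (hF : Fits C m) : 39 * C.I ≤ C.W :=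
  (Nat.mul_le_mul_right _ (by simp [rowBase])).trans hF.small

/-! ### Frame conditions. -/

/-- All rows outside of `l` agree. -/
def Frame (l : List Row) (μ μ' : Mem) : Prop := ∀ r, r ∉ l → μ' r = μ r

theorem Frame.refl (l : List Row) (μ : Mem) : Frame l μ μ := fun _ _ => rfl

theorem Frame.set {l : List Row} {μ μ' : Mem} (h : Frame l μ μ') {r : Row} (hr : r ∈ l)
    (i v : ℕ) : Frame l μ (μ'.set r i v) := by
  intro r' hr'
  rw [Mem.set_of_ne _ (by rintro rfl; exact hr' hr), h r' hr']

@[simp] theorem Frame.set_iff {l : List Row} {μ μ' : Mem} {r : Row} (hr : r ∈ l) (i v : ℕ) :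
    Frame l μ (μ'.set r i v) ↔ Frame l μ μ' := by
  refine ⟨fun h r' hr' => ?_, fun h => h.set hr i v⟩
  rw [← h r' hr', Mem.set_of_ne _ (by rintro rfl; exact hr' hr)]

theorem Frame.mono {l l' : List Row} {μ μ' : Mem} (h : Frame l μ μ') (hl : ∀ r ∈ l, r ∈ l') :
    Frame l' μ μ' := fun r hr => h r fun h => hr (hl r h)

theorem Frame.trans {l l' : List Row} {μ μ' μ'' : Mem} (h : Frame l μ μ')
    (h' : Frame l' μ' μ'') (hl : ∀ r ∈ l', r ∈ l) : Frame l μ μ'' :=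
  fun r hr => (h' r fun h => hr (hl r h)).trans (h r hr)

end ScanSort

namespace ScanSort
open ScanModel

/-! ## Counting sort -/

/-- `g` is the list `f` of length `N`, stably sorted by `key`. -/
def StableSort (key : ℕ → ℕ) (N : ℕ) (f g : ℕ → ℕ) : Prop :=
  ∃ π : ℕ → ℕ, (∀ t < N, π t < N ∧ g t = f (π t)) ∧ (∀ u < N, ∃ t < N, π t = u) ∧
    ∀ t t', t < t' → t' < N → key (g t) < key (g t') ∨ key (g t) = key (g t') ∧ π t < π t'

/-- Number of `t < T` with `κ t = c`. -/
def cntEq (κ : ℕ → ℕ) (T c : ℕ) : ℕ := ((Finset.range T).filter fun t => κ t = c).card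

/-- Number of `t < T` with `κ t < c`. -/
def cntLt (κ : ℕ → ℕ) (T c : ℕ) : ℕ := ((Finset.range T).filter fun t => κ t < c).card

theorem cntEq_succ (κ : ℕ → ℕ) (T c : ℕ) :
    cntEq κ (T + 1) c = cntEq κ T c + if κ T = c then 1 else 0 := by
  unfold cntEq
  rw [Finset.range_add_one, Finset.filter_insert]
  split_ifs <;> simp

theorem cntEq_mono (κ : ℕ → ℕ) {T T' : ℕ} (h : T ≤ T') (c : ℕ) : cntEq κ T c ≤ cntEq κ T' c :=
  Finset.card_le_card (Finset.filter_subset_filter _ (Finset.range_mono h))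

theorem cntLt_succ (κ : ℕ → ℕ) (T c : ℕ) : cntLt κ T (c + 1) = cntLt κ T c + cntEq κ T c := by
  unfold cntLt cntEq
  rw [← Finset.card_union_of_disjoint]
  · congr 1
    ext t
    simp only [Finset.mem_filter, Finset.mem_union, Finset.mem_range]
    omega
  · rw [Finset.disjoint_filter]
    intros
    omega

theorem cntLt_mono (κ : ℕ → ℕ) (T : ℕ) {c c' : ℕ} (h : c ≤ c') : cntLt κ T c ≤ cntLt κ T c' :=
  Finset.card_le_card fun t ht => by
    simp only [Finset.mem_filter] at *
    exact ⟨ht.1, ht.2.trans_le h⟩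

theorem cntLt_le (κ : ℕ → ℕ) (T c : ℕ) : cntLt κ T c ≤ T :=
  (Finset.card_filter_le _ _).trans (by simp)

/-- The place of item `t` in the sorted list. -/
def place (κ : ℕ → ℕ) (N t : ℕ) : ℕ := cntLt κ N (κ t) + cntEq κ t (κ t)

theorem place_lt_of_lt (κ : ℕ → ℕ) {N t t' : ℕ} (ht : t < N) (h : κ t < κ t') :
    place κ N t < place κ N t' := by
  have h1 := cntEq_succ κ t (κ t)
  rw [if_pos rfl] at h1
  have h2 := cntEq_mono κ (show t + 1 ≤ N from ht) (κ t)
  have h3 := cntLt_succ κ N (κ t)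
  have h4 := cntLt_mono κ N (show κ t + 1 ≤ κ t' from h)
  unfold place
  omega

theorem place_lt_of_eq (κ : ℕ → ℕ) {N t t' : ℕ} (h : κ t = κ t') (htt : t < t') :
    place κ N t < place κ N t' := by
  have h1 := cntEq_succ κ t (κ t)
  rw [if_pos rfl] at h1
  have h2 := cntEq_mono κ (show t + 1 ≤ t' from htt) (κ t)
  unfold place
  rw [← h]
  omega

theorem place_lt (κ : ℕ → ℕ) {N t : ℕ} (ht : t < N) : place κ N t < N := by
  have h1 := cntEq_succ κ t (κ t)
  rw [if_pos rfl] at h1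
  have h2 := cntEq_mono κ (show t + 1 ≤ N from ht) (κ t)
  have h3 := cntLt_succ κ N (κ t)
  have h4 := cntLt_le κ N (κ t + 1)
  unfold place
  omega

theorem place_inj (κ : ℕ → ℕ) {N t t' : ℕ} (ht : t < N) (ht' : t' < N)
    (h : place κ N t = place κ N t') : t = t' := by
  rcases lt_trichotomy (κ t) (κ t') with h1 | h1 | h1
  · exact absurd h (place_lt_of_lt κ ht h1).ne
  · rcases lt_trichotomy t t' with h2 | h2 | h2
    · exact absurd h (place_lt_of_eq κ h1 h2).ne
    · exact h2
    · exact absurd h (place_lt_of_eq κ h1.symm h2).ne'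
  · exact absurd h (place_lt_of_lt κ ht' h1).ne'

theorem place_surj (κ : ℕ → ℕ) {N u : ℕ} (hu : u < N) : ∃ t < N, place κ N t = u := by
  have hinj : Function.Injective fun t : Fin N => (⟨place κ N t, place_lt κ t.2⟩ : Fin N) :=
    fun t t' h => Fin.ext (place_inj κ t.2 t'.2 (by simpa using h))
  obtain ⟨t, ht⟩ := Finite.surjective_of_injective hinj ⟨u, hu⟩
  exact ⟨t, t.2, congrArg Fin.val ht⟩

/-- `place` is a bijection that increases with the key and, among equal keys, with the index. Its
inverse is the permutation that witnesses stability. -/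
theorem stableSort_of_place {key : ℕ → ℕ} {N : ℕ} {f g : ℕ → ℕ}
    (h : ∀ t < N, g (place (fun t => key (f t)) N t) = f t) : StableSort key N f g := by
  choose! π h1 h2 using fun u (hu : u < N) => place_surj (fun t => key (f t)) hu
  have h3 : ∀ t < N, g t = f (π t) := fun t ht => by rw [← h _ (h1 t ht), h2 t ht]
  refine ⟨π, fun t ht => ⟨h1 t ht, h3 t ht⟩, fun u hu => ?_, fun t t' htt ht' => ?_⟩
  · exact ⟨_, place_lt _ hu, place_inj _ (h1 _ (place_lt _ hu)) hu (h2 _ (place_lt _ hu))⟩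
  · have ht : t < N := htt.trans ht'
    rw [h3 t ht, h3 t' ht']
    rcases lt_trichotomy (key (f (π t))) (key (f (π t'))) with h4 | h4 | h4
    · exact .inl h4
    · refine .inr ⟨h4, ?_⟩
      by_contra h5
      rcases (not_lt.1 h5).lt_or_eq with h6 | h6
      · have := place_lt_of_eq (fun t => key (f t)) (N := N) h4.symm h6
        rw [h2 t ht, h2 t' ht'] at this
        omega
      · have := h2 t ht
        rw [← h6, h2 t' ht'] at this
        omega
    · have := place_lt_of_lt (fun t => key (f t)) (h1 t' ht') h4
      rw [h2 t ht, h2 t' ht'] at this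
      omega

/-- The sort key: the character at distance `d` from the position in the list `j`. -/
def keyE (j : Fin 3) (d : ℕ) : HE := .cell .aS (Row.voff.v + .cell (.l j) Row.vi.v + .lit d)

/-- Sort the list `j` of length `vc` stably into the list `k`; keys are smaller than `vkk`. -/
def csort (j k : Fin 3) (d : ℕ) : HC :=
  forUp .vi Row.vkk.v (.set .acnt Row.vi.v 0) ;;
  forUp .vi Row.vc.v
    (.asg .vk (keyE j d) ;; .set .acnt Row.vk.v (.cell .acnt Row.vk.v + 1)) ;;
  (.asg .vsum 0 ;; forUp .vi Row.vkk.v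
    (.asg .vk (.cell .acnt Row.vi.v) ;; .set .acnt Row.vi.v Row.vsum.v ;;
      .asg .vsum (Row.vsum.v + Row.vk.v))) ;;
  forUp .vi Row.vc.v
    (.asg .vk (keyE j d) ;; .set (.l k) (.cell .acnt Row.vk.v) (.cell (.l j) Row.vi.v) ;;
      .set .acnt Row.vk.v (.cell .acnt Row.vk.v + 1))

section csort
variable {C : Cfg} {m : Machine} {μ : Mem}

theorem csort_run (hF : Fits C m) {j k : Fin 3} (hjk : j ≠ k) (d : ℕ) {N K o : ℕ}
    (hN : μ .vc 0 = N) (hK : μ .vkk 0 = K) (ho : μ .voff 0 = o) (hNI : N < C.I) (hKI : K < C.I)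
    (hkey : ∀ t < N, o + μ (.l j) t + d < C.I ∧ μ .aS (o + μ (.l j) t + d) < K) {T : ℕ}
    (hNT : N ≤ T) (hKT : K ≤ T) (hT : 1 ≤ T) :
    MRun C m (csort j k d) μ (700 * T) fun μ' =>
      Frame [.l k, .vi, .vk, .vsum, .acnt] μ μ' ∧
      StableSort (fun p => μ .aS (o + p + d)) N (μ (.l j)) (μ' (.l k)) := by
  have hW := hF.mul_I_le
  set κ : ℕ → ℕ := fun t => μ .aS (o + μ (.l j) t + d) with hκ
  obtain ⟨fr, hfr⟩ : ∃ fr : List Row, fr = [.l k, .vi, .vk, .vsum, .acnt] := ⟨_, rfl⟩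
  have hj : Row.l j ∉ fr := by simp [hfr, hjk]
  have hS : Row.aS ∉ fr := by simp [hfr]
  have hvo : Row.voff ∉ fr := by simp [hfr]
  have hvk : Row.vkk ∉ fr := by simp [hfr]
  have hvc : Row.vc ∉ fr := by simp [hfr]
  have m1 : Row.l k ∈ fr := by simp [hfr]
  have m2 : Row.vi ∈ fr := by simp [hfr]
  have m3 : Row.vk ∈ fr := by simp [hfr]
  have m4 : Row.vsum ∈ fr := by simp [hfr]
  have m5 : Row.acnt ∈ fr := by simp [hfr]
  have cle : ∀ i c, cntEq κ i c ≤ i := fun i c => (Finset.card_filter_le _ _).trans (by simp)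
  rw [← hfr]
  -- clearing the counters
  have r1 : MRun C m (forUp .vi Row.vkk.v (.set .acnt Row.vi.v 0)) μ (100 * T) fun μ' =>
      Frame fr μ μ' ∧ ∀ c < K, μ' .acnt c = 0 := by
    refine (MRun.forUp hF (r := .vi) trivial (N := K) (t := 12) (by omega) (fun i μ' =>
      Frame fr μ μ' ∧ μ' .vi 0 = i ∧ ∀ c < i, μ' .acnt c = 0) ?_ ?_ ?_).mono ?_ ?_
    · simp [Frame.refl, m2]
    · rintro i μ' hi ⟨h1, h2, h3⟩
      simp [h1 _ hvk, hK, h2, Row.Valid]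
      omega
    · rintro i μ' hi ⟨h1, h2, h3⟩
      refine (MRun.of_wp hF ?_).mono (Nat.le_of_ble_eq_true rfl) (fun _ h => h)
      intro x D
      simp [wp, h2, Row.Valid, h1, m2, m5]
      refine ⟨by omega, by omega, by omega, fun c hc => ?_⟩
      grind
    · simp only [HE.cost]; omega
    · rintro μ' ⟨h1, -, h2⟩
      exact ⟨h1, h2⟩
  -- counting the keys
  have r2 : ∀ μ1, (Frame fr μ μ1 ∧ ∀ c < K, μ1 .acnt c = 0) →
      MRun C m (forUp .vi Row.vc.v
        (.asg .vk (keyE j d) ;; .set .acnt Row.vk.v (.cell .acnt Row.vk.v + 1))) μ1 (150 * T)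
      fun μ' => Frame fr μ μ' ∧ ∀ c < K, μ' .acnt c = cntEq κ N c := by
    rintro μ1 ⟨h1, h2⟩
    refine (MRun.forUp hF (r := .vi) trivial (N := N) (t := 60) (by omega) (fun i μ' =>
      Frame fr μ μ' ∧ μ' .vi 0 = i ∧ ∀ c < K, μ' .acnt c = cntEq κ i c) ?_ ?_ ?_).mono ?_ ?_
    · simpa [h1, m2, cntEq] using h2
    · rintro i μ' hi ⟨h1, h2, h3⟩
      simp [h1 _ hvc, hN, h2, Row.Valid]
      omega
    · rintro i μ' hi ⟨h1, h2, h3⟩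
      refine (MRun.of_wp hF ?_).mono (Nat.le_of_ble_eq_true rfl) (fun _ h => h)
      intro x D
      obtain ⟨k1, k2⟩ := hkey i hi
      have k3 := h3 (κ i) k2
      have k4 := cle i (κ i)
      have k5 : μ .aS (o + μ (.l j) i + d) = κ i := rfl
      rw [k5] at k2
      simp only [cntEq_succ]
      simp [wp, keyE, h2, Row.Valid, h1, m2, m3, m5, h1 _ hj, h1 _ hS, h1 _ hvo, ho, k5, k3]
      and_intros
      all_goals try omega
      intro c hc
      have := h3 c hc
      grind
    · simp only [HE.cost]; omega
    · rintro μ' ⟨h1, -, h2⟩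
      exact ⟨h1, h2⟩
  -- prefix sums
  have r3 : ∀ μ1, (Frame fr μ μ1 ∧ ∀ c < K, μ1 .acnt c = cntEq κ N c) →
      MRun C m (.asg .vsum 0 ;; forUp .vi Row.vkk.v
        (.asg .vk (.cell .acnt Row.vi.v) ;; .set .acnt Row.vi.v Row.vsum.v ;;
        .asg .vsum (Row.vsum.v + Row.vk.v))) μ1 (150 * T)
      fun μ' => Frame fr μ μ' ∧ ∀ c < K, μ' .acnt c = cntLt κ N c := by
    rintro μ1 ⟨h1, h2⟩
    have ra : MRun C m (.asg .vsum 0) μ1 7 fun μ' => Frame fr μ μ' ∧ μ' .vsum 0 = 0 ∧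
        ∀ c < K, μ' .acnt c = cntEq κ N c := by
      refine (MRun.of_wp hF ?_).mono (Nat.le_of_ble_eq_true rfl) (fun _ h => h)
      intro x D
      simp [wp, h1, m4, Row.Valid]
      exact ⟨by omega, by omega, h2⟩
    refine (ra.bind (t' := 140 * T) ?_).mono (by omega) (fun _ h => h)
    rintro μ1 ⟨h1, h2, h3⟩
    -- The sums replace the counts in place: below `i` the array holds prefix sums, from `i` on
    -- still the counts.
    refine (MRun.forUp hF (r := .vi) trivial (N := K) (t := 70) (by omega) (fun i μ' =>
      Frame fr μ μ' ∧ μ' .vi 0 = i ∧ μ' .vsum 0 = cntLt κ N i ∧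
        (∀ c < i, μ' .acnt c = cntLt κ N c) ∧ ∀ c < K, i ≤ c → μ' .acnt c = cntEq κ N c)
      ?_ ?_ ?_).mono ?_ ?_
    · simpa [h1, m2, h2, cntLt] using h3
    · rintro i μ' hi ⟨h1, h2, h3⟩
      simp [h1 _ hvk, hK, h2, Row.Valid]
      omega
    · rintro i μ' hi ⟨h1, h2, h3, h4, h5⟩
      refine (MRun.of_wp hF ?_).mono (Nat.le_of_ble_eq_true rfl) (fun _ h => h)
      intro x D
      have k1 := cntLt_succ κ N i
      have k2 := cntLt_le κ N (i + 1)
      have k3 := h5 i hi le_rfl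
      simp [wp, h2, Row.Valid, h1, m2, m3, m4, m5, h3, k3, k1]
      and_intros
      all_goals try omega
      · intro c hc
        have := h4 c
        grind
      · intro c hc hc'
        have := h5 c hc (by omega)
        grind
    · simp only [HE.cost]; omega
    · rintro μ' ⟨h1, -, -, h2, -⟩
      exact ⟨h1, h2⟩
  -- distribution
  have r4 : ∀ μ1, (Frame fr μ μ1 ∧ ∀ c < K, μ1 .acnt c = cntLt κ N c) →
      MRun C m (forUp .vi Row.vc.v
        (.asg .vk (keyE j d) ;; .set (.l k) (.cell .acnt Row.vk.v) (.cell (.l j) Row.vi.v) ;;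
        .set .acnt Row.vk.v (.cell .acnt Row.vk.v + 1))) μ1 (250 * T)
      fun μ' => Frame fr μ μ' ∧ ∀ t < N, μ' (.l k) (place κ N t) = μ (.l j) t := by
    rintro μ1 ⟨h1, h2⟩
    -- After `i` items, `acnt c` is the place of the next item with key `c`.
    refine (MRun.forUp hF (r := .vi) trivial (N := N) (t := 100) (by omega) (fun i μ' =>
      Frame fr μ μ' ∧ μ' .vi 0 = i ∧ (∀ c < K, μ' .acnt c = cntLt κ N c + cntEq κ i c) ∧
        ∀ t < i, μ' (.l k) (place κ N t) = μ (.l j) t) ?_ ?_ ?_).mono ?_ ?_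
    · simpa [h1, m2, cntEq] using h2
    · rintro i μ' hi ⟨h1, h2, h3⟩
      simp [h1 _ hvc, hN, h2, Row.Valid]
      omega
    · rintro i μ' hi ⟨h1, h2, h3, h4⟩
      refine (MRun.of_wp hF ?_).mono (Nat.le_of_ble_eq_true rfl) (fun _ h => h)
      intro x D
      obtain ⟨k1, k2⟩ := hkey i hi
      have k3 := h3 (κ i) k2
      have k5 : μ .aS (o + μ (.l j) i + d) = κ i := rfl
      have k6 : cntLt κ N (κ i) + cntEq κ i (κ i) = place κ N i := rfl
      have k7 := place_lt κ hi
      rw [k5] at k2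
      rw [k6] at k3
      simp only [cntEq_succ]
      simp [wp, keyE, h2, Row.Valid, h1, m1, m2, m3, m5, h1 _ hj, h1 _ hS, h1 _ hvo, ho, k5, k3]
      and_intros
      all_goals try omega
      · intro c hc
        have := h3 c hc
        grind
      · intro t ht
        rcases Nat.lt_or_ge t i with h | h
        · have h6 : place κ N t ≠ place κ N i := fun h6 => by
            have := place_inj κ (h.trans hi) hi h6
            omega
          simp [h6, h4 t h]
        · obtain rfl : t = i := by omega
          simp
    · simp only [HE.cost]; omega
    · rintro μ' ⟨h1, -, -, h2⟩
      exact ⟨h1, h2⟩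
  refine (r1.bind fun μ1 h1 => (r2 μ1 h1).bind fun μ2 h2 => (r3 μ2 h2).bind fun μ3 h3 =>
    r4 μ3 h3).mono (by omega) fun μ' h => ⟨h.1, stableSort_of_place h.2⟩
end csort
end ScanSort

namespace ScanSort
open ScanModel

/-! ## The order of suffixes -/

/-- The suffix of `s` at `i` precedes the suffix at `j`. -/
def slt (s : ℕ → ℕ) (i j : ℕ) : Prop :=
  ∃ h, (∀ h' < h, s (i + h') = s (j + h')) ∧ s (i + h) < s (j + h)

/-- `s` is a string of length `N`, continued by zeros. -/
def IsStr (s : ℕ → ℕ) (N : ℕ) : Prop := ∀ i, s i = 0 ↔ N ≤ i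

theorem slt_irrefl (s : ℕ → ℕ) (i : ℕ) : ¬ slt s i i := fun ⟨_, _, h⟩ => lt_irrefl _ h

theorem slt_trans {s : ℕ → ℕ} {i j k : ℕ} (h : slt s i j) (h' : slt s j k) : slt s i k := by
  obtain ⟨x, h1, h2⟩ := h
  obtain ⟨y, h3, h4⟩ := h'
  rcases lt_trichotomy x y with h | rfl | h
  · exact ⟨x, fun z hz => (h1 z hz).trans (h3 z (hz.trans h)), (h3 x h) ▸ h2⟩
  · exact ⟨x, fun z hz => (h1 z hz).trans (h3 z hz), h2.trans h4⟩
  · exact ⟨y, fun z hz => (h1 z (hz.trans h)).trans (h3 z hz), (h1 y h) ▸ h4⟩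

theorem slt_asymm {s : ℕ → ℕ} {i j : ℕ} (h : slt s i j) : ¬ slt s j i :=
  fun h' => slt_irrefl s i (slt_trans h h')

theorem slt_iff (s : ℕ → ℕ) (i j : ℕ) :
    slt s i j ↔ s i < s j ∨ s i = s j ∧ slt s (i + 1) (j + 1) := by
  constructor
  · rintro ⟨h, h1, h2⟩
    rcases h with _ | h
    · exact .inl h2
    · refine .inr ⟨h1 0 (by omega), h, fun x hx => ?_, ?_⟩
      · simpa [add_assoc, add_comm, add_left_comm] using h1 (x + 1) (by omega)
      · simpa [add_assoc, add_comm, add_left_comm] using h2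
  · rintro (h | ⟨h0, h, h1, h2⟩)
    · exact ⟨0, by simp, h⟩
    · refine ⟨h + 1, fun x hx => ?_, ?_⟩
      · rcases x with _ | x
        · exact h0
        · simpa [add_assoc, add_comm, add_left_comm] using h1 x (by omega)
      · simpa [add_assoc, add_comm, add_left_comm] using h2

/-- Zeros occur only behind the end of the string. Two different suffixes, one of them nonempty,
reach the end at different distances, so they differ somewhere, and the first difference decides. -/
theorem IsStr.slt_total {s : ℕ → ℕ} {N : ℕ} (hs : IsStr s N) {i j : ℕ} (hij : i ≠ j)
    (hi : i < N) : slt s i j ∨ slt s j i := by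
  have hex : ∃ h, s (i + h) ≠ s (j + h) := by
    by_contra! hc
    have h1 := hc (N - i)
    have h2 := hc (N - j)
    have h3 := hs (i + (N - i))
    have h4 := hs (j + (N - i))
    have h5 := hs (i + (N - j))
    have h6 := hs (j + (N - j))
    grind
  classical
  have h1 := Nat.find_spec hex
  have h2 : ∀ h' < Nat.find hex, s (i + h') = s (j + h') := fun h' hh => by
    simpa using Nat.find_min hex hh
  rcases lt_or_gt_of_ne h1 with h | h
  · exact .inl ⟨_, h2, h⟩
  · exact .inr ⟨_, fun x hx => (h2 x hx).symm, h⟩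

theorem IsStr.lt_of_slt {s : ℕ → ℕ} {N : ℕ} (hs : IsStr s N) {i j : ℕ} (h : slt s i j) :
    j < N := by
  obtain ⟨x, -, h⟩ := h
  by_contra hc
  have := (hs (j + x)).2 (by omega)
  omega

/-- `f` lists positions in increasing order of their suffixes. -/
def Sorted (s : ℕ → ℕ) (N : ℕ) (f : ℕ → ℕ) : Prop :=
  ∀ t t', t < t' → t' < N → slt s (f t) (f t')

theorem Sorted.ne {s : ℕ → ℕ} {N : ℕ} {f : ℕ → ℕ} (h : Sorted s N f) {t t' : ℕ} (ht : t < N)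
    (ht' : t' < N) (hne : t ≠ t') : f t ≠ f t' := by
  intro he
  rcases lt_or_gt_of_ne hne with h1 | h1
  · have := h t t' h1 ht'
    rw [he] at this
    exact slt_irrefl _ _ this
  · have := h t' t h1 ht
    rw [he] at this
    exact slt_irrefl _ _ this

theorem Sorted.lt_iff {s : ℕ → ℕ} {N : ℕ} {f : ℕ → ℕ} (h : Sorted s N f) {t t' : ℕ} (ht : t < N)
    (ht' : t' < N) : slt s (f t) (f t') ↔ t < t' := by
  refine ⟨fun h1 => ?_, fun h1 => h t t' h1 ht'⟩
  by_contra h2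
  rcases (not_lt.1 h2).lt_or_eq with h3 | rfl
  · exact slt_asymm h1 (h t' t h3 ht)
  · exact slt_irrefl _ _ h1

/-- A list of `N` distinct numbers below `N` contains all of them. -/
theorem exists_index {N : ℕ} {f : ℕ → ℕ} (hf : ∀ t < N, f t < N)
    (hinj : ∀ t < N, ∀ t' < N, t ≠ t' → f t ≠ f t') {u : ℕ} (hu : u < N) : ∃ t < N, f t = u := by
  have hinj : Function.Injective fun t : Fin N => (⟨f t, hf t t.2⟩ : Fin N) := fun t t' h => by
    by_contra hne
    exact hinj t t.2 t' t'.2 (fun h => hne (Fin.ext h)) (by simpa using h)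
  obtain ⟨t, ht⟩ := Finite.surjective_of_injective hinj ⟨u, hu⟩
  exact ⟨t, t.2, congrArg Fin.val ht⟩

/-- Counting through a permutation. -/
theorem card_filter_perm {N : ℕ} {f : ℕ → ℕ} (hf : ∀ t < N, f t < N)
    (hinj : ∀ t < N, ∀ t' < N, t ≠ t' → f t ≠ f t') (p : ℕ → Prop) [DecidablePred p] :
    ((Finset.range N).filter fun t => p (f t)).card = ((Finset.range N).filter p).card := by
  rw [← Finset.card_image_of_injOn (f := f)]
  · congr 1
    ext u
    simp only [Finset.mem_image, Finset.mem_filter, Finset.mem_range]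
    constructor
    · rintro ⟨t, ⟨h1, h2⟩, rfl⟩
      exact ⟨hf t h1, h2⟩
    · rintro ⟨h1, h2⟩
      obtain ⟨t, h3, rfl⟩ := exists_index hf hinj h1
      exact ⟨t, ⟨h3, h2⟩, rfl⟩
  · intro t ht t' ht' h
    simp only [Finset.coe_filter, Finset.mem_range, Set.mem_ofPred_eq] at ht ht'
    by_contra hne
    exact hinj t ht.1 t' ht'.1 hne h

/-! ## Reduction to the sample of two thirds of the positions -/

/-- The triple at `p` precedes the triple at `q`. -/
def tlt (s : ℕ → ℕ) (p q : ℕ) : Prop :=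
  s p < s q ∨ s p = s q ∧ (s (p + 1) < s (q + 1) ∨ s (p + 1) = s (q + 1) ∧ s (p + 2) < s (q + 2))

def teq (s : ℕ → ℕ) (p q : ℕ) : Prop :=
  s p = s q ∧ s (p + 1) = s (q + 1) ∧ s (p + 2) = s (q + 2)

/-- The sample of a string of length `N`: the positions `1` modulo `3`, then the positions `2`
modulo `3`. -/
def spos (N u : ℕ) : ℕ := if u < (N + 2) / 3 then 3 * u + 1 else 3 * (u - (N + 2) / 3) + 2

/-- Size of the sample. -/
def ssize (N : ℕ) : ℕ := (N + 2) / 3 + N / 3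

/-- The index of a position in the sample. -/
def sidx (N p : ℕ) : ℕ := if p % 3 = 1 then p / 3 else (N + 2) / 3 + p / 3

theorem sidx_spos {N u : ℕ} : sidx N (spos N u) = u := by
  unfold sidx spos
  split_ifs <;> omega

theorem spos_lt {N u : ℕ} (hu : u < ssize N) : spos N u ≤ N ∧ spos N u % 3 ≠ 0 := by
  unfold spos
  unfold ssize at hu
  split_ifs <;> omega

theorem spos_eq_iff {N u : ℕ} (hu : u < ssize N) : spos N u = N → N % 3 = 1 := by
  unfold spos
  unfold ssize at hu
  split_ifs <;> omega

theorem spos_sidx {N p : ℕ} (h : p < N ∧ p % 3 ≠ 0 ∨ p = N ∧ N % 3 = 1) :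
    sidx N p < ssize N ∧ spos N (sidx N p) = p := by
  unfold sidx spos ssize
  split_ifs <;> omega

theorem spos_inj {N u v : ℕ} (h : spos N u = spos N v) : u = v := by
  rw [← sidx_spos (N := N) (u := u), h, sidx_spos]

theorem spos_add {N u y : ℕ}
    (h : spos N u + 3 * y < N ∨ spos N u % 3 = 1 ∧ spos N u + 3 * y ≤ N) :
    u + y < ssize N ∧ spos N (u + y) = spos N u + 3 * y := by
  unfold spos ssize at *
  split_ifs at * <;> omega

/-- `r` is a string of names of the triples in the sample of `s`. -/
structure IsNaming (s : ℕ → ℕ) (N : ℕ) (r : ℕ → ℕ) : Prop where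
  str : IsStr r (ssize N)
  lt : ∀ u v, u < ssize N → v < ssize N → tlt s (spos N u) (spos N v) → r u < r v
  eq : ∀ u v, u < ssize N → v < ssize N → teq s (spos N u) (spos N v) → r u = r v

/-- Cut both suffixes into triples. If `H` is the distance of the first difference, the first `H /
3` triples agree, and so do their names; the next triple decides. The names must not run from the
first part of the sample into the second before that: this is why position `N` belongs to the sample
when `N % 3 = 1`, a triple of zeros that closes the first part. -/
theorem IsNaming.slt_of_slt {s : ℕ → ℕ} {N : ℕ} {r : ℕ → ℕ} (hr : IsNaming s N r) (hs : IsStr s N)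
    {u v : ℕ} (hu : u < ssize N) (h : slt s (spos N u) (spos N v)) :
    slt r u v := by
  obtain ⟨H, h1, h2⟩ := h
  set p := spos N u with hp
  set q := spos N v with hq
  -- Neither suffix ends before the first difference: at equal characters they would end together
  -- and agree from there on.
  have hin : ∀ x < H, p + x < N ∧ q + x < N := by
    intro x hx
    have a1 := h1 x hx
    have a2 := hs (p + x)
    have a3 := hs (q + x)
    have a4 := hs (p + H)
    have a5 := hs (q + H)
    by_cases h0 : s (p + x) = 0
    · have b1 := a2.1 h0
      have b2 := a3.1 (a1 ▸ h0)
      have b3 := a5.2 (by omega)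
      omega
    · constructor
      · by_contra hc
        exact h0 (a2.2 (by omega))
      · by_contra hc
        exact h0 (a1.trans (a3.2 (by omega)))
  have hqH : q + H < N := by
    by_contra hc
    have := (hs (q + H)).2 (by omega)
    omega
  have hpN := spos_lt hu
  have hstep : ∀ y < H / 3, (u + y < ssize N ∧ spos N (u + y) = p + 3 * y) ∧
      v + y < ssize N ∧ spos N (v + y) = q + 3 * y := by
    intro y hy
    have := hin (3 * y) (by omega)
    exact ⟨spos_add (.inl this.1), spos_add (.inl this.2)⟩
  refine ⟨H / 3, fun y hy => ?_, ?_⟩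
  · obtain ⟨⟨b1, b2⟩, b3, b4⟩ := hstep y hy
    refine hr.eq _ _ b1 b3 ?_
    rw [b2, b4]
    exact ⟨h1 _ (by omega), h1 (3 * y + 1) (by omega), h1 (3 * y + 2) (by omega)⟩
  · obtain ⟨c1, c2⟩ := spos_add (u := v) (N := N) (y := H / 3) (.inl (by omega))
    by_cases hlt : u + H / 3 < ssize N
    · have d : spos N (u + H / 3) = p + 3 * (H / 3) := by
        rcases Nat.eq_zero_or_pos (H / 3) with h0 | h0
        · rw [h0]; simp [hp]
        · have := (hin (3 * (H / 3) - 1) (by omega)).1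
          unfold ssize at hlt
          simp only [hp] at *
          unfold spos at *
          split_ifs at * <;> omega
      refine hr.lt _ _ hlt c1 ?_
      rw [d, c2]
      unfold tlt
      have e1 := h1 (3 * (H / 3))
      have e2 := h1 (3 * (H / 3) + 1)
      rcases (by omega : H = 3 * (H / 3) ∨ H = 3 * (H / 3) + 1 ∨ H = 3 * (H / 3) + 2) with g | g | g
      · rw [g] at h2
        exact .inl (by simpa using h2)
      · rw [g] at h2
        exact .inr ⟨e1 (by omega), .inl (by simpa [add_assoc] using h2)⟩
      · rw [g] at h2
        exact .inr ⟨e1 (by omega), .inr ⟨e2 (by omega), by simpa [add_assoc] using h2⟩⟩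
    -- The string of names has ended for `u`, while `v` still has a name there, and names are
    -- positive.
    · have d1 := (hr.str (u + H / 3)).2 (by omega)
      have d2 := hr.str (v + H / 3)
      omega

/-- Names are only known to preserve the order of suffixes. They also reflect it, because different
suffixes of `s` are comparable and the order of the name suffixes is asymmetric. -/
theorem IsNaming.sorted {s : ℕ → ℕ} {N : ℕ} {r : ℕ → ℕ} (hr : IsNaming s N r) (hs : IsStr s N)
    {f : ℕ → ℕ} (hf : ∀ t < ssize N, f t < ssize N) (h : Sorted r (ssize N) f) :
    Sorted s (ssize N) fun t => spos N (f t) := by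
  intro t t' htt ht'
  have h1 := h t t' htt ht'
  have h2 := hf t (htt.trans ht')
  have h3 := hf t' ht'
  have hne : spos N (f t) ≠ spos N (f t') := fun he =>
    h.ne (htt.trans ht') ht' htt.ne (spos_inj he)
  have h5 := spos_lt h2
  have h6 := spos_lt h3
  have h4 : slt s (spos N (f t)) (spos N (f t')) ∨ slt s (spos N (f t')) (spos N (f t)) := by
    rcases h5.1.lt_or_eq with h | h
    · exact hs.slt_total hne h
    · exact (hs.slt_total hne.symm (by omega)).symm
  rcases h4 with h4 | h4
  · exact h4
  · exact absurd (hr.slt_of_slt hs h3 h4) (slt_asymm h1)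

/-! ## Naming -/

open Classical in
/-- Number of different triples in the sorted list `f` up to index `t`. -/
noncomputable def names (s : ℕ → ℕ) (f : ℕ → ℕ) : ℕ → ℕ
  | 0 => 1
  | t + 1 => names s f t + if teq s (f t) (f (t + 1)) then 0 else 1

theorem names_pos (s f : ℕ → ℕ) (t : ℕ) : 0 < names s f t := by
  induction t with
  | zero => simp [names]
  | succ t ih => simp only [names]; omega

theorem names_le (s f : ℕ → ℕ) (t : ℕ) : names s f t ≤ t + 1 := by
  induction t with
  | zero => simp [names]
  | succ t ih => simp only [names]; split_ifs <;> omega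

theorem tlt_irrefl {s : ℕ → ℕ} {p q : ℕ} (h : tlt s p q) : ¬ teq s p q := by
  unfold tlt teq at *
  omega

/-- Along a list sorted by triples the counter grows exactly where the triple changes; induction on
the later index. -/
theorem names_spec {s f : ℕ → ℕ} {n : ℕ}
    (h : ∀ t t', t < t' → t' < n → tlt s (f t) (f t') ∨ teq s (f t) (f t')) {t t' : ℕ}
    (htt : t ≤ t') (ht' : t' < n) :
    (teq s (f t) (f t') → names s f t = names s f t') ∧
      (tlt s (f t) (f t') → names s f t < names s f t') ∧ names s f t ≤ names s f t' := by
  induction t' with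
  | zero =>
    obtain rfl : t = 0 := by omega
    refine ⟨fun _ => rfl, fun h => ?_, le_rfl⟩
    unfold tlt at h
    omega
  | succ t' ih =>
    rcases htt.lt_or_eq with h1 | rfl
    · obtain ⟨i1, i2, i3⟩ := ih (by omega) (by omega)
      have h2 := h t' (t' + 1) (by omega) ht'
      have h3 : tlt s (f t) (f t') ∨ teq s (f t) (f t') := by
        rcases (show t ≤ t' by omega).lt_or_eq with h4 | rfl
        · exact h t t' h4 (by omega)
        · exact .inr ⟨rfl, rfl, rfl⟩
      simp only [names]
      have h5 : tlt s (f t') (f (t' + 1)) → ¬ teq s (f t') (f (t' + 1)) := tlt_irrefl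
      split_ifs with h6
      · refine ⟨fun h7 => i1 ?_, fun h7 => i2 ?_, by omega⟩
        · unfold teq at *; omega
        · unfold teq tlt at *; omega
      · refine ⟨fun h7 => ?_, fun h7 => by omega, by omega⟩
        rcases h2 with h2 | h2
        · unfold teq tlt at *; omega
        · exact absurd h2 h6
    · refine ⟨fun _ => rfl, fun h => ?_, le_rfl⟩
      unfold tlt at h
      omega

end ScanSort

namespace ScanSort
open ScanModel

/-! ## Suffix sorting: descent to shorter strings -/

/-- The string of length `N` stored at offset `o`. -/
def strOf (S : ℕ → ℕ) (o N : ℕ) : ℕ → ℕ := fun i => if i < N then S (o + i) else 0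

/-- A string of length `N` over `1, …, N + κ - 1`, followed by three zeros, is stored at `o`. -/
structure LevelAt (S : ℕ → ℕ) (κ o N : ℕ) : Prop where
  pos : 0 < N
  char : ∀ i < N, 0 < S (o + i) ∧ S (o + i) < N + κ
  zero : ∀ d < 3, S (o + N + d) = 0

theorem LevelAt.isStr {S : ℕ → ℕ} {κ o N : ℕ} (h : LevelAt S κ o N) : IsStr (strOf S o N) N := by
  intro i
  unfold strOf
  split_ifs with h1
  · have := (h.char i h1).1
    omega
  · simpa using h1

theorem LevelAt.apply {S : ℕ → ℕ} {κ o N : ℕ} (h : LevelAt S κ o N) {i : ℕ} (hi : i < N + 3) :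
    S (o + i) = strOf S o N i := by
  unfold strOf
  split_ifs with h1
  · rfl
  · have := h.zero (i - N) (by omega)
    rwa [show o + N + (i - N) = o + i by omega] at this

theorem LevelAt.lt {S : ℕ → ℕ} {κ o N : ℕ} (h : LevelAt S κ o N) {i : ℕ} (hi : i < N + 3) :
    S (o + i) < N + κ := by
  have h0 := h.pos
  rcases Nat.lt_or_ge i N with h1 | h1
  · exact (h.char i h1).2
  · have := h.zero (i - N) (by omega)
    rw [show o + N + (i - N) = o + i by omega] at this
    omega

/-- Put the sample positions into list `0`. -/
def fillSample (κ : ℕ) : HC :=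
  (.asg .vn1 ((Row.vN.v + 2) / 3) ;; .asg .vc (Row.vn1.v + Row.vN.v / 3) ;;
    .asg .vkk (Row.vN.v + .lit κ)) ;;
  forUp .vi Row.vn1.v (.set (.l 0) Row.vi.v (3 * Row.vi.v + 1)) ;;
  forUp .vi (Row.vN.v / 3) (.set (.l 0) (Row.vn1.v + Row.vi.v) (3 * Row.vi.v + 2))

section
variable {C : Cfg} {m : Machine} {μ : Mem}

theorem fillSample_run (hF : Fits C m) {κ N : ℕ} (hN : μ .vN 0 = N) (hN2 : 1 ≤ N)
    (hNI : 3 * (N + κ) + 5 ≤ C.I) :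
    MRun C m (fillSample κ) μ (300 * (N + κ)) fun μ' =>
      Frame [.vn1, .vc, .vkk, .vi, .l 0] μ μ' ∧ μ' .vn1 0 = (N + 2) / 3 ∧ μ' .vc 0 = ssize N ∧
      μ' .vkk 0 = N + κ ∧ ∀ u < ssize N, μ' (.l 0) u = spos N u := by
  have hW := hF.mul_I_le
  have h3 : (N + 2) / 3 + N / 3 = ssize N := rfl
  have r1 : MRun C m (.asg .vn1 ((Row.vN.v + 2) / 3) ;; .asg .vc (Row.vn1.v + Row.vN.v / 3) ;;
    .asg .vkk (Row.vN.v + .lit κ)) μ 60 fun μ' => Frame [.vn1, .vc, .vkk, .vi, .l 0] μ μ' ∧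
      μ' .vn1 0 = (N + 2) / 3 ∧ μ' .vc 0 = ssize N ∧ μ' .vkk 0 = N + κ := by
    refine (MRun.of_wp hF ?_).mono (Nat.le_of_ble_eq_true rfl) (fun _ h => h)
    intro x D
    simp [wp, Row.Valid, Frame.refl, hN, h3]
    unfold ssize
    omega
  have r2 : ∀ μ1, (Frame [.vn1, .vc, .vkk, .vi, .l 0] μ μ1 ∧
      μ1 .vn1 0 = (N + 2) / 3 ∧ μ1 .vc 0 = ssize N ∧ μ1 .vkk 0 = N + κ) →
      MRun C m (forUp .vi Row.vn1.v (.set (.l 0) Row.vi.v (3 * Row.vi.v + 1))) μ1 (100 * (N + κ))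
      fun μ' => Frame [.vn1, .vc, .vkk, .vi, .l 0] μ μ' ∧
        μ' .vn1 0 = (N + 2) / 3 ∧ μ' .vc 0 = ssize N ∧ μ' .vkk 0 = N + κ ∧
        ∀ u < (N + 2) / 3, μ' (.l 0) u = 3 * u + 1 := by
    rintro μ1 ⟨h1, h2, h3, h4⟩
    refine (MRun.forUp hF (r := .vi) trivial (N := (N + 2) / 3) (t := 30) (by omega) (fun i μ' =>
      Frame [.vn1, .vc, .vkk, .vi, .l 0] μ μ' ∧
        (μ' .vn1 0 = (N + 2) / 3 ∧ μ' .vc 0 = ssize N ∧ μ' .vkk 0 = N + κ) ∧ μ' .vi 0 = i ∧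
        ∀ u < i, μ' (.l 0) u = 3 * u + 1) ?_ ?_ ?_).mono ?_ ?_
    · simp [h1, h2, h3, h4]
    · rintro i μ' hi ⟨h1, ⟨h2, h3, h4⟩, h5, h6⟩
      simp [h2, h5, Row.Valid]
      omega
    · rintro i μ' hi ⟨h1, ⟨h2, h3, h4⟩, h5, h6⟩
      refine (MRun.of_wp hF ?_).mono (Nat.le_of_ble_eq_true rfl) (fun _ h => h)
      intro x D
      simp [wp, h2, Row.Valid, h1, h3, h4, h5]
      and_intros
      all_goals try omega
      grind
    · simp only [HE.cost]; omega
    · rintro μ' ⟨h1, ⟨h2, h3, h4⟩, -, h6⟩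
      exact ⟨h1, h2, h3, h4, h6⟩
  refine (r1.bind fun μ1 h1 => (r2 μ1 h1).bind (t' := 140 * (N + κ)) ?_).mono (by omega) fun _ h => h
  rintro μ1 ⟨h1, h2, h3, h4, h5⟩
  refine (MRun.forUp hF (r := .vi) trivial (N := N / 3) (t := 30) (by omega) (fun i μ' =>
    Frame [.vn1, .vc, .vkk, .vi, .l 0] μ μ' ∧
      (μ' .vn1 0 = (N + 2) / 3 ∧ μ' .vc 0 = ssize N ∧ μ' .vkk 0 = N + κ) ∧ μ' .vi 0 = i ∧
      ∀ u < (N + 2) / 3 + i, μ' (.l 0) u = spos N u) ?_ ?_ ?_).mono ?_ ?_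
  · simp [h1, h2, h3, h4]
    intro u hu
    rw [h5 u hu, spos, if_pos hu]
  · rintro i μ' hi ⟨h1, ⟨h2, h3, h4⟩, h5, h6⟩
    simp [h1 .vN (by simp), hN, h5, Row.Valid]
    omega
  · rintro i μ' hi ⟨h1, ⟨h2, h3, h4⟩, h5, h6⟩
    refine (MRun.of_wp hF ?_).mono (Nat.le_of_ble_eq_true rfl) (fun _ h => h)
    intro x D
    simp [wp, h2, Row.Valid, h1, h3, h4, h5]
    and_intros
    all_goals try omega
    intro u hu
    rcases Nat.lt_or_ge u ((N + 2) / 3 + i) with h7 | h7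
    · rw [Function.update_of_ne (by omega), h6 u h7]
    · obtain rfl : u = (N + 2) / 3 + i := by omega
      rw [Function.update_self, spos, if_neg (by omega)]
      omega
  · change N / 3 * (30 + 8 + 22) + (8 + 20) ≤ _
    omega
  · rintro μ' ⟨h1, ⟨h2, h3, h4⟩, -, h6⟩
    exact ⟨h1, h2, h3, h4, h6⟩

/-- `f` lists the sample of `s` in the order of the triples. -/
def SampleSorted (s : ℕ → ℕ) (N : ℕ) (f : ℕ → ℕ) : Prop :=
  ∃ π : ℕ → ℕ, (∀ t < ssize N, π t < ssize N ∧ f t = spos N (π t)) ∧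
    (∀ u < ssize N, ∃ t < ssize N, π t = u) ∧
    ∀ t t', t < t' → t' < ssize N → tlt s (f t) (f t') ∨ teq s (f t) (f t')

/-- Radix sort of the sample by triples, from list `0` to list `1`. -/
def sortSample : HC := csort 0 1 2 ;; csort 1 0 1 ;; csort 0 1 0

/-- Radix sort from the third character of the triples to the first: stability makes each pass keep
the order of the earlier passes among equal keys. The three permutations are composed at the end. -/
theorem sortSample_run (hF : Fits C m) {κ o N : ℕ} (ho : μ .voff 0 = o)
    (hc : μ .vc 0 = ssize N) (hkk : μ .vkk 0 = N + κ) (hL : LevelAt (μ .aS) κ o N)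
    (hl : ∀ u < ssize N, μ (.l 0) u = spos N u) (hI : o + N + κ + 5 ≤ C.I) :
    MRun C m sortSample μ (2100 * (N + κ)) fun μ' =>
      Frame [.l 0, .l 1, .vi, .vk, .vsum, .acnt] μ μ' ∧
      SampleSorted (strOf (μ .aS) o N) N (μ' (.l 1)) := by
  have hW := hF.mul_I_le
  have h0 := hL.pos
  have hm : ssize N ≤ N + κ := by unfold ssize; omega
  have hkey : ∀ p d, p ≤ N → d < 3 → o + p + d < C.I ∧ μ .aS (o + p + d) < N + κ :=
    fun p d hp hd => ⟨by omega, by rw [add_assoc]; exact hL.lt (by omega)⟩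
  have hstr : ∀ p d, p ≤ N → d < 3 → μ .aS (o + p + d) = strOf (μ .aS) o N (p + d) :=
    fun p d hp hd => by rw [add_assoc]; exact hL.apply (by omega)
  refine ((csort_run hF (by decide) 2 hc hkk ho (by omega) (by omega) (T := N + κ) ?_ hm
    le_rfl (by omega)).bind (t' := 1400 * (N + κ)) ?_).mono (by omega) fun _ h => h
  · intro t ht
    rw [hl t ht]
    exact hkey _ _ (spos_lt ht).1 (by omega)
  rintro μ1 ⟨f1, π1, a1, b1, c1⟩
  have eS1 : μ1 .aS = μ .aS := f1 _ (by simp)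
  have e1 : ∀ t < ssize N, μ1 (.l 1) t = spos N (π1 t) := fun t ht => by
    rw [(a1 t ht).2, hl _ (a1 t ht).1]
  refine ((csort_run hF (by decide) 1 (by rw [f1 _ (by simp), hc]) (by rw [f1 _ (by simp), hkk])
    (by rw [f1 _ (by simp), ho]) (by omega) (by omega) (T := N + κ) ?_ hm
    le_rfl (by omega)).bind (t' := 700 * (N + κ)) ?_).mono (by omega) fun _ h => h
  · intro t ht
    rw [e1 t ht, eS1]
    exact hkey _ _ (spos_lt (a1 t ht).1).1 (by omega)
  rintro μ2 ⟨f2, π2, a2, b2, c2⟩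
  have eS2 : μ2 .aS = μ .aS := (f2 _ (by simp)).trans eS1
  have e2 : ∀ t < ssize N, μ2 (.l 0) t = spos N (π1 (π2 t)) := fun t ht => by
    rw [(a2 t ht).2, e1 _ (a2 t ht).1]
  refine (csort_run hF (by decide) 0 (by rw [f2 _ (by simp), f1 _ (by simp), hc])
    (by rw [f2 _ (by simp), f1 _ (by simp), hkk]) (by rw [f2 _ (by simp), f1 _ (by simp), ho])
    (by omega) (by omega) (T := N + κ) ?_ hm le_rfl (by omega)).mono le_rfl ?_
  · intro t ht
    rw [e2 t ht, eS2]
    exact hkey _ _ (spos_lt (a1 _ (a2 t ht).1).1).1 (by omega)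
  rintro μ3 ⟨f3, π3, a3, b3, c3⟩
  have e3 : ∀ t < ssize N, μ3 (.l 1) t = spos N (π1 (π2 (π3 t))) := fun t ht => by
    rw [(a3 t ht).2, e2 _ (a3 t ht).1]
  have hlt : ∀ t < ssize N, π1 (π2 (π3 t)) < ssize N := fun t ht =>
    (a1 _ (a2 _ (a3 t ht).1).1).1
  refine ⟨((f1.mono ?_).trans f2 ?_).trans f3 ?_, ?_⟩
  · simp
  · simp
  · simp
  refine ⟨fun t => π1 (π2 (π3 t)), fun t ht => ⟨hlt t ht, e3 t ht⟩, ?_, ?_⟩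
  · intro u hu
    obtain ⟨t1, h1, rfl⟩ := b1 u hu
    obtain ⟨t2, h2, rfl⟩ := b2 t1 h1
    obtain ⟨t3, h3, rfl⟩ := b3 t2 h2
    exact ⟨t3, h3, rfl⟩
  · intro t t' htt ht'
    have ht := htt.trans ht'
    have p3 := c3 t t' htt ht'
    have q2 := fun h => c2 (π3 t) (π3 t') h (a3 t' ht').1
    have q1 := fun h => c1 (π2 (π3 t)) (π2 (π3 t')) h (a2 _ (a3 t' ht').1).1
    have g := (spos_lt (hlt t ht)).1
    have g' := (spos_lt (hlt t' ht')).1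
    simp only [e3 t ht, e3 t' ht', eS2, e2 _ (a3 t ht).1, e2 _ (a3 t' ht').1, eS1,
      e1 _ (a2 _ (a3 t ht).1).1, e1 _ (a2 _ (a3 t' ht').1).1] at p3 q2 q1 ⊢
    rw [hstr _ 0 g (by omega), hstr _ 0 g' (by omega)] at p3
    rw [hstr _ 1 g (by omega), hstr _ 1 g' (by omega)] at q2
    rw [hstr _ 2 g (by omega), hstr _ 2 g' (by omega)] at q1
    simp only [add_zero] at p3
    unfold tlt teq
    grind
end
end ScanSort

/-! ### The string of names. -/

namespace ScanSort
open ScanModel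

theorem eq_of_surj {N : ℕ} {f : ℕ → ℕ} (hf : ∀ t < N, f t < N) (hs : ∀ u < N, ∃ t < N, f t = u)
    {t t' : ℕ} (ht : t < N) (ht' : t' < N) (h : f t = f t') : t = t' := by
  have hsurj : Function.Surjective fun t : Fin N => (⟨f t, hf t t.2⟩ : Fin N) := fun u => by
    obtain ⟨t, h1, h2⟩ := hs u u.2
    exact ⟨⟨t, h1⟩, Fin.ext h2⟩
  have := Finite.injective_iff_surjective.2 hsurj (a₁ := ⟨t, ht⟩) (a₂ := ⟨t', ht'⟩) (Fin.ext h)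
  simpa using this

/-- Transports `names_spec` from indices in the sorted list to indices in the sample, along the
permutation `π`. -/
theorem isNaming_of_sorted {s : ℕ → ℕ} {N : ℕ} {f r : ℕ → ℕ} (hf : SampleSorted s N f)
    (hr : IsStr r (ssize N)) (h : ∀ t < ssize N, r (sidx N (f t)) = names s f t) :
    IsNaming s N r := by
  obtain ⟨π, h1, h2, h3⟩ := hf
  have h4 : ∀ t < ssize N, r (π t) = names s f t := fun t ht => by
    rw [← h t ht, (h1 t ht).2, sidx_spos]
  refine ⟨hr, fun u v hu hv huv => ?_, fun u v hu hv huv => ?_⟩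
  · obtain ⟨t, ht, rfl⟩ := h2 u hu
    obtain ⟨t', ht', rfl⟩ := h2 v hv
    rw [← (h1 t ht).2, ← (h1 t' ht').2] at huv
    rw [h4 t ht, h4 t' ht']
    rcases le_or_gt t t' with h5 | h5
    · exact (names_spec h3 h5 ht').2.1 huv
    · have := h3 t' t h5 ht
      unfold tlt teq at *
      omega
  · obtain ⟨t, ht, rfl⟩ := h2 u hu
    obtain ⟨t', ht', rfl⟩ := h2 v hv
    rw [← (h1 t ht).2, ← (h1 t' ht').2] at huv
    rw [h4 t ht, h4 t' ht']
    rcases le_or_gt t t' with h5 | h5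
    · exact (names_spec h3 h5 ht').1 huv
    · refine ((names_spec h3 h5.le ht).1 ?_).symm
      unfold teq at *
      omega

/-- The character at distance `d` from the position `p`. -/
def chr (p : Row) (d : ℕ) : HE := .cell .aS (Row.voff.v + p.v + .lit d)

/-- Increase the name if the triples at `p` and `prev` differ. -/
def nextName : HC :=
  .ite (.eq (chr .vp 0) (chr .vprev 0))
    (.ite (.eq (chr .vp 1) (chr .vprev 1))
      (.ite (.eq (chr .vp 2) (chr .vprev 2)) .skip (.asg .vnm (Row.vnm.v + 1)))
      (.asg .vnm (Row.vnm.v + 1)))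
    (.asg .vnm (Row.vnm.v + 1))

def nameLoop : HC :=
  forUp .vi Row.vc.v
    (.asg .vp (.cell (.l 1) Row.vi.v) ;; nextName ;;
      (.asg .vprev Row.vp.v ;;
        .ite (.eq (Row.vp.v % 3) 1) (.set .aS (Row.vy.v + Row.vp.v / 3) Row.vnm.v)
          (.set .aS (Row.vy.v + Row.vn1.v + Row.vp.v / 3) Row.vnm.v)))

section
variable {C : Cfg} {m : Machine} {μ : Mem}

open Classical in
theorem nextName_run (hF : Fits C m) {κ o N p p' x : ℕ} {S : ℕ → ℕ} (ho : μ .voff 0 = o)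
    (hL : LevelAt S κ o N) (hS : ∀ a < o + N + 3, μ .aS a = S a) (hp : μ .vp 0 = p)
    (hp' : μ .vprev 0 = p') (hpN : p ≤ N) (hpN' : p' ≤ N) (hx : μ .vnm 0 = x) (hxI : x < C.I)
    (hI : o + N + 5 ≤ C.I) :
    MRun C m nextName μ 150 fun μ' => Frame [.vnm] μ μ' ∧
      μ' .vnm 0 = x + if teq (strOf S o N) p' p then 0 else 1 := by
  have hW := hF.mul_I_le
  refine (MRun.of_wp hF ?_).mono (Nat.le_of_ble_eq_true rfl) (fun _ h => h)
  intro x D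
  have e : ∀ p ≤ N, ∀ d < 3, μ .aS (o + p + d) = strOf S o N (p + d) := fun p hp d hd => by
    rw [hS _ (by omega), add_assoc, hL.apply (by omega)]
  have e0 := e p hpN 0 (by omega)
  have e1 := e p hpN 1 (by omega)
  have e2 := e p hpN 2 (by omega)
  have f0 := e p' hpN' 0 (by omega)
  have f1 := e p' hpN' 1 (by omega)
  have f2 := e p' hpN' 2 (by omega)
  simp only [add_zero] at e0 f0
  obtain ⟨v, hv⟩ : ∃ v, v = if teq (strOf S o N) p' p then 0 else 1 := ⟨_, rfl⟩
  have hv1 : teq (strOf S o N) p' p → v = 0 := fun h => by rw [hv, if_pos h]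
  have hv2 : ¬ teq (strOf S o N) p' p → v = 1 := fun h => by rw [hv, if_neg h]
  rw [← hv]
  unfold teq at hv1 hv2
  simp [wp, nextName, chr, Row.Valid, ho, hp, hp', e0, e1, e2, f0, f1, f2, hx, Frame.refl]
  omega

def namesFrame : List Row := [.vi, .vp, .vprev, .vnm, .aS]

theorem nameLoop_run (hF : Fits C m) {κ o N : ℕ} (hL : LevelAt (μ .aS) κ o N) (hN : 2 ≤ N)
    (ho : μ .voff 0 = o) (hc : μ .vc 0 = ssize N) (hn1 : μ .vn1 0 = (N + 2) / 3)
    (hy : μ .vy 0 = o + N + 3) (hnm : μ .vnm 0 = 1) (hprev : μ .vprev 0 = μ (.l 1) 0)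
    (hP : SampleSorted (strOf (μ .aS) o N) N (μ (.l 1))) (hI : o + 3 * N + 10 ≤ C.I) :
    MRun C m nameLoop μ (300 * N) fun μ' => Frame namesFrame μ μ' ∧
      (∀ a < o + N + 3, μ' .aS a = μ .aS a) ∧
      ∀ t < ssize N, μ' .aS (o + N + 3 + sidx N (μ (.l 1) t)) =
        names (strOf (μ .aS) o N) (μ (.l 1)) t := by
  classical
  have hW := hF.mul_I_le
  obtain ⟨P, hPP⟩ : ∃ P, P = μ (.l 1) := ⟨_, rfl⟩
  obtain ⟨s, hs⟩ : ∃ s, s = strOf (μ .aS) o N := ⟨_, rfl⟩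
  obtain ⟨fr, hfr⟩ : ∃ fr, fr = namesFrame := ⟨_, rfl⟩
  have m1 : Row.vi ∈ fr := by simp [hfr, namesFrame]
  have m2 : Row.vp ∈ fr := by simp [hfr, namesFrame]
  have m3 : Row.vprev ∈ fr := by simp [hfr, namesFrame]
  have m4 : Row.vnm ∈ fr := by simp [hfr, namesFrame]
  have m5 : Row.aS ∈ fr := by simp [hfr, namesFrame]
  have n1 : Row.l 1 ∉ fr := by simp [hfr, namesFrame]
  have n2 : Row.voff ∉ fr := by simp [hfr, namesFrame]
  have n3 : Row.vc ∉ fr := by simp [hfr, namesFrame]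
  have n4 : Row.vn1 ∉ fr := by simp [hfr, namesFrame]
  have n5 : Row.vy ∉ fr := by simp [hfr, namesFrame]
  rw [← hPP, ← hs] at hP ⊢
  rw [← hPP] at hprev
  rw [← hfr]
  obtain ⟨π, a1, a2, a3⟩ := hP
  have hm : ssize N ≤ N := by unfold ssize; omega
  have hidx : ∀ t < ssize N, sidx N (P t) < ssize N := fun t ht => by
    rw [(a1 t ht).2, sidx_spos]
    exact (a1 t ht).1
  have hinj : ∀ t < ssize N, ∀ t' < ssize N, t ≠ t' → sidx N (P t) ≠ sidx N (P t') := by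
    intro t ht t' ht' hne h
    rw [(a1 t ht).2, (a1 t' ht').2, sidx_spos, sidx_spos] at h
    exact hne (eq_of_surj (fun t ht => (a1 t ht).1) a2 ht ht' h)
  have hPN : ∀ t < ssize N, P t ≤ N ∧ P t % 3 ≠ 0 := fun t ht => by
    rw [(a1 t ht).2]
    exact spos_lt (a1 t ht).1
  -- The last item that received a name is `i - 1`. For `i = 0` the cut-off subtraction makes this
  -- item `0`, in accordance with the initial values of `vprev` and `vnm`.
  refine (MRun.forUp hF (r := .vi) trivial (N := ssize N) (t := 250) (by omega) (fun i μ' =>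
    Frame fr μ μ' ∧ μ' .vi 0 = i ∧ μ' .vnm 0 = names s P (i - 1) ∧ μ' .vprev 0 = P (i - 1) ∧
      (∀ a < o + N + 3, μ' .aS a = μ .aS a) ∧
      ∀ t < i, μ' .aS (o + N + 3 + sidx N (P t)) = names s P t) ?_ ?_ ?_).mono ?_ ?_
  · simp [Frame.refl, m1, hnm, names, hprev]
  · rintro i μ' hi ⟨h1, h2, h3⟩
    simp [h1 _ n3, hc, h2, Row.Valid]
    omega
  · rintro i μ' hi ⟨h1, h2, h3, h4, h5, h6⟩
    have hP' : μ' (.l 1) = P := (h1 _ n1).trans hPP.symm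
    have r1 : MRun C m (.asg .vp (.cell (.l 1) Row.vi.v)) μ' 20 fun μ' =>
        Frame fr μ μ' ∧ μ' .vi 0 = i ∧ μ' .vnm 0 = names s P (i - 1) ∧ μ' .vprev 0 = P (i - 1) ∧
        μ' .vp 0 = P i ∧ (∀ a < o + N + 3, μ' .aS a = μ .aS a) ∧
        ∀ t < i, μ' .aS (o + N + 3 + sidx N (P t)) = names s P t := by
      refine (MRun.of_wp hF ?_).mono (Nat.le_of_ble_eq_true rfl) (fun _ h => h)
      intro x D
      simp [wp, h2, Row.Valid, h1, m2, hP', h3, h4]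
      exact ⟨by omega, by omega, by omega, h5, h6⟩
    -- For `i = 0` the first triple is compared with itself and keeps the name `1`.
    have hnext : (names s P (i - 1) + if teq s (P (i - 1)) (P i) then 0 else 1) = names s P i := by
      rcases i with _ | i
      · simp [names, teq]
      · simp [names]
    refine (r1.bind (t' := 230) ?_).mono (by omega) fun _ h => h
    clear r1 h1 h2 h3 h4 h5 h6 hP' μ'
    rintro μ' ⟨h1, h2, h3, h4, h5, h6, h7⟩
    have hnl := names_le s P (i - 1)
    refine ((nextName_run hF ((congrFun (h1 _ n2) 0).trans ho) hL h6 h5 h4 (hPN i hi).1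
      (hPN (i - 1) (by omega)).1 h3 (by omega) (by omega)).bind (t' := 80) ?_).mono (by omega)
      fun _ h => h
    rw [← hs, hnext]
    rintro μ2 ⟨g1, g2⟩
    have h1' : Frame fr μ μ2 := h1.trans g1 (by simp [m4])
    have e1 := g1 .vi (by simp)
    have e2 := g1 .vprev (by simp)
    have e3 := g1 .vp (by simp)
    have e4 := g1 .aS (by simp)
    rw [← e1] at h2
    rw [← e3] at h5
    rw [← e4] at h6 h7
    clear g1 e1 e2 e3 e4 h1 h3 h4 hnext
    have hnl := names_le s P i
    have hq := (hPN i hi).1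
    refine (MRun.of_wp hF ?_).mono (Nat.le_of_ble_eq_true rfl) (fun _ h => h)
    intro x D
    have k1 : ∀ v : ℕ, (∀ a < o + N + 3, Function.update (μ2 .aS) (o + N + 3 + sidx N (P i)) v a =
        μ .aS a) := fun v a ha => by
      rw [Function.update_of_ne (by omega), h6 a ha]
    have k2 : ∀ t < i + 1, Function.update (μ2 .aS) (o + N + 3 + sidx N (P i)) (names s P i)
        (o + N + 3 + sidx N (P t)) = names s P t := fun t ht => by
      rcases Nat.lt_or_ge t i with h | h
      · have := hinj t (by omega) i hi (by omega)
        rw [Function.update_of_ne (by omega), h7 t h]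
      · obtain rfl : t = i := by omega
        rw [Function.update_self]
    simp [wp, Row.Valid, h1', h2, h5, m1, m3, m5, h1' _ n4, h1' _ n5, hn1, hy, g2]
    have q1 : P i % 3 = 1 → o + N + 3 + P i / 3 = o + N + 3 + sidx N (P i) := fun h => by
      rw [sidx, if_pos h]
    have q2 : ¬ P i % 3 = 1 →
        o + N + 3 + (N + 2) / 3 + P i / 3 = o + N + 3 + sidx N (P i) := fun h => by
      rw [sidx, if_neg h, add_assoc]
    refine ⟨by omega, by omega, by omega, by omega, fun h => ?_, fun h => ?_⟩
    · rw [q1 h]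
      have := hidx i hi
      exact ⟨by omega, by omega, by omega, k1 _, fun t ht => k2 t (by omega)⟩
    · rw [q2 h]
      have := hidx i hi
      exact ⟨by omega, by omega, by omega, k1 _, fun t ht => k2 t (by omega)⟩
  · simp only [HE.cost]; omega
  · rintro μ' ⟨h1, -, -, -, h2, h3⟩
    exact ⟨h1, h2, h3⟩

/-! ### The stack of strings and the descent. -/

/-- The levels of the recursion that are stored in `S`; `Z` holds the lengths of the strings. -/
inductive Chain (S Z : ℕ → ℕ) (κ L : ℕ) : ℕ → ℕ → ℕ → Prop
  | base : LevelAt S κ 0 L → Chain S Z κ L 0 0 L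
  | step {lev o N : ℕ} : Chain S Z κ L lev o N → 2 ≤ N → Z lev = N →
      LevelAt S κ (o + N + 3) (ssize N) →
      IsNaming (strOf S o N) N (strOf S (o + N + 3) (ssize N)) →
      Chain S Z κ L (lev + 1) (o + N + 3) (ssize N)

theorem LevelAt.congr {S S' : ℕ → ℕ} {κ o N : ℕ} (h : LevelAt S κ o N)
    (hS : ∀ a < o + N + 3, S' a = S a) : LevelAt S' κ o N := by
  refine ⟨h.pos, fun i hi => ?_, fun d hd => ?_⟩
  · rw [hS _ (by omega)]
    exact h.char i hi
  · rw [hS _ (by omega)]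
    exact h.zero d hd

theorem strOf_congr {S S' : ℕ → ℕ} {o N : ℕ} (hS : ∀ a < o + N, S' a = S a) :
    strOf S' o N = strOf S o N := by
  funext i
  unfold strOf
  split_ifs with h
  · exact hS _ (by omega)
  · rfl

theorem Chain.levelAt {S Z : ℕ → ℕ} {κ L lev o N : ℕ} (h : Chain S Z κ L lev o N) :
    LevelAt S κ o N := by
  cases h <;> assumption

/-- All levels up to the current one lie below the end of its three zeros, so whatever is written
behind it leaves them intact. -/
theorem Chain.congr {S S' Z Z' : ℕ → ℕ} {κ L lev o N : ℕ} (h : Chain S Z κ L lev o N)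
    (hS : ∀ a < o + N + 3, S' a = S a) (hZ : ∀ a < lev, Z' a = Z a) :
    Chain S' Z' κ L lev o N := by
  induction h with
  | base h => exact .base (h.congr hS)
  | step h1 h2 h3 h4 h5 ih =>
    refine .step (ih (fun a ha => hS a (by omega)) fun a ha => hZ a (by omega)) h2
      ((hZ _ (by omega)).trans h3) (h4.congr hS) ?_
    rwa [strOf_congr fun a ha => hS a (by omega), strOf_congr fun a ha => hS a (by omega)]

/-- One step of the recursion: from a string to the string of names of its sample. -/
def descend (κ : ℕ) : HC :=
  fillSample κ ;; sortSample ;;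
  (.asg .vy (Row.voff.v + Row.vN.v + 3) ;; .asg .vnm 1 ;; .asg .vprev (.cell (.l 1) 0)) ;;
  nameLoop ;;
  (.set .aS (Row.vy.v + Row.vc.v) 0 ;; .set .aS (Row.vy.v + Row.vc.v + 1) 0 ;;
    .set .aS (Row.vy.v + Row.vc.v + 2) 0 ;; .set .aNN Row.vlev.v Row.vN.v ;;
    .asg .vlev (Row.vlev.v + 1) ;; .asg .voff Row.vy.v ;; .asg .vN Row.vc.v)

def descendRows : List Row :=
  [.vn1, .vc, .vkk, .vi, .vk, .vsum, .acnt, .l 0, .l 1, .vy, .vnm, .vprev, .vp, .aS, .aNN, .vlev,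
    .voff, .vN]

/-- The string of names is placed directly behind the current string and its three zeros. Saving the
length `N` in `aNN` is enough to find the way back. -/
theorem descend_run (hF : Fits C m) {κ L lev o N : ℕ}
    (hch : Chain (μ .aS) (μ .aNN) κ L lev o N) (hN : 2 ≤ N) (hκ : 1 ≤ κ) (hlev : μ .vlev 0 = lev)
    (ho : μ .voff 0 = o) (hNv : μ .vN 0 = N) (hlI : lev + 2 ≤ C.I)
    (hI : o + 3 * N + 3 * κ + 10 ≤ C.I) :
    MRun C m (descend κ) μ (3000 * (N + κ)) fun μ' => Frame descendRows μ μ' ∧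
      Chain (μ' .aS) (μ' .aNN) κ L (lev + 1) (o + N + 3) (ssize N) ∧ μ' .vlev 0 = lev + 1 ∧
      μ' .voff 0 = o + N + 3 ∧ μ' .vN 0 = ssize N ∧ ∀ a < o + N + 3, μ' .aS a = μ .aS a := by
  have hW := hF.mul_I_le
  have hL := hch.levelAt
  have hm : ssize N ≤ N := by unfold ssize; omega
  refine ((fillSample_run hF hNv (by omega) (κ := κ) (by omega)).bind (t' := 2700 * (N + κ))
    ?_).mono (by omega) fun _ h => h
  rintro μ1 ⟨f1, b1, b2, b3, b4⟩
  have eS1 : μ1 .aS = μ .aS := f1 _ (by simp)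
  refine ((sortSample_run hF (κ := κ) (o := o) (N := N) (by rw [f1 _ (by simp), ho]) b2 b3
    (by rw [eS1]; exact hL) b4 (by omega)).bind (t' := 600 * (N + κ)) ?_).mono (by omega) fun _ h => h
  rintro μ2 ⟨f2, c1⟩
  have eS2 : μ2 .aS = μ .aS := (f2 _ (by simp)).trans eS1
  have g2 : Frame descendRows μ μ2 :=
    (f1.mono (by simp [descendRows])).trans f2 (by simp [descendRows])
  rw [eS1] at c1
  have d1 : μ2 .vn1 0 = (N + 2) / 3 := by rw [f2 _ (by simp), b1]
  have d2 : μ2 .vc 0 = ssize N := by rw [f2 _ (by simp), b2]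
  have d3 : μ2 .voff 0 = o := by rw [f2 _ (by simp), f1 _ (by simp), ho]
  have d4 : μ2 .vN 0 = N := by rw [f2 _ (by simp), f1 _ (by simp), hNv]
  have d5 : μ2 .vlev 0 = lev := by rw [f2 _ (by simp), f1 _ (by simp), hlev]
  have d6 : μ2 .aNN = μ .aNN := by rw [f2 _ (by simp), f1 _ (by simp)]
  clear f1 b1 b2 b3 b4 eS1 f2
  have r1 : MRun C m (.asg .vy (Row.voff.v + Row.vN.v + 3) ;; .asg .vnm 1 ;;
      .asg .vprev (.cell (.l 1) 0)) μ2 60 fun μ3 => Frame [.vy, .vnm, .vprev] μ2 μ3 ∧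
        μ3 .vy 0 = o + N + 3 ∧ μ3 .vnm 0 = 1 ∧ μ3 .vprev 0 = μ3 (.l 1) 0 := by
    refine (MRun.of_wp hF ?_).mono (Nat.le_of_ble_eq_true rfl) (fun _ h => h)
    intro x D
    simp [wp, Row.Valid, Frame.refl, d3, d4]
    omega
  refine (r1.bind (t' := 500 * (N + κ)) ?_).mono (by omega) fun _ h => h
  rintro μ3 ⟨f3, k1, k2, k3⟩
  have eS3 : μ3 .aS = μ .aS := (f3 _ (by simp)).trans eS2
  have el3 : μ3 (.l 1) = μ2 (.l 1) := f3 _ (by simp)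
  refine ((nameLoop_run hF (κ := κ) (o := o) (N := N) (by rw [eS3]; exact hL) hN
    (by rw [f3 _ (by simp), d3]) (by rw [f3 _ (by simp), d2]) (by rw [f3 _ (by simp), d1]) k1 k2 k3
    (by rw [eS3, el3]; exact c1) (by omega)).bind (t' := 200 * (N + κ)) ?_).mono (by omega)
    fun _ h => h
  rintro μ4 ⟨f4, k4, k5⟩
  rw [eS3, el3] at k5
  rw [eS3] at k4
  have g4 : Frame descendRows μ μ4 :=
    (g2.trans f3 (by simp [descendRows])).trans f4 (by simp [descendRows, namesFrame])
  have j2 : μ4 .vc 0 = ssize N := by rw [f4 _ (by simp [namesFrame]), f3 _ (by simp), d2]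
  have j4 : μ4 .vN 0 = N := by rw [f4 _ (by simp [namesFrame]), f3 _ (by simp), d4]
  have j5 : μ4 .vlev 0 = lev := by rw [f4 _ (by simp [namesFrame]), f3 _ (by simp), d5]
  have j6 : μ4 .aNN = μ .aNN := by rw [f4 _ (by simp [namesFrame]), f3 _ (by simp), d6]
  have j7 : μ4 .vy 0 = o + N + 3 := by rw [f4 _ (by simp [namesFrame]), k1]
  refine (MRun.of_wp hF (P := fun μ' => Frame descendRows μ μ' ∧
    (μ' .aS = Function.update (Function.update (Function.update (μ4 .aS) (o + N + 3 + ssize N) 0)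
      (o + N + 3 + ssize N + 1) 0) (o + N + 3 + ssize N + 2) 0 ∧
    μ' .aNN = Function.update (μ .aNN) lev N) ∧ μ' .vlev 0 = lev + 1 ∧
      μ' .voff 0 = o + N + 3 ∧ μ' .vN 0 = ssize N) ?_).mono ?_ ?_
  · intro x D
    simp [wp, Row.Valid, descendRows, j2, j4, j5, j6, j7]
    simp [descendRows] at g4
    and_intros
    all_goals first | exact g4 | omega
  · refine le_trans (Nat.le_of_ble_eq_true rfl : _ ≤ 200) (by omega)
  · rintro μ' ⟨h1, ⟨h2, h3⟩, h4⟩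
    obtain ⟨h4, h5, h6⟩ := h4
    refine ⟨h1, ?_, h4, h5, h6, ?_⟩; rotate_left
    · intro a ha
      rw [h2, Function.update_of_ne (by omega), Function.update_of_ne (by omega),
        Function.update_of_ne (by omega), k4 a ha]
    have hold : ∀ a < o + N + 3, μ' .aS a = μ .aS a := fun a ha => by
      rw [h2, Function.update_of_ne (by omega), Function.update_of_ne (by omega),
        Function.update_of_ne (by omega), k4 a ha]
    have hname : ∀ t < ssize N, μ' .aS (o + N + 3 + sidx N (μ2 (.l 1) t)) =
        names (strOf (μ .aS) o N) (μ2 (.l 1)) t := fun t ht => by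
      obtain ⟨π, a1, -⟩ := c1
      have := (a1 t ht).1
      have e : sidx N (μ2 (.l 1) t) = π t := by rw [(a1 t ht).2, sidx_spos]
      rw [← k5 t ht, h2, e, Function.update_of_ne (by omega), Function.update_of_ne (by omega),
        Function.update_of_ne (by omega)]
    have hL' : LevelAt (μ' .aS) κ (o + N + 3) (ssize N) := by
      -- Names lie between `1` and the sample size, hence within the alphabet allowed for the new
      -- level because `κ` is positive.
      refine ⟨by unfold ssize; omega, fun u hu => ?_, fun d hd => ?_⟩
      · obtain ⟨π, a1, a2, -⟩ := c1
        obtain ⟨t, ht, rfl⟩ := a2 u hu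
        have e : sidx N (μ2 (.l 1) t) = π t := by rw [(a1 t ht).2, sidx_spos]
        rw [← e, hname t ht]
        have := names_pos (strOf (μ .aS) o N) (μ2 (.l 1)) t
        have := names_le (strOf (μ .aS) o N) (μ2 (.l 1)) t
        omega
      · rw [h2]
        interval_cases d <;> simp
    refine .step (hch.congr hold fun a ha => ?_) hN ?_ hL' ?_
    · rw [h3, Function.update_of_ne (by omega)]
    · rw [h3, Function.update_self]
    · rw [strOf_congr fun a ha => hold a (by omega)]
      refine isNaming_of_sorted c1 hL'.isStr fun t ht => ?_
      rw [← hname t ht, strOf, if_pos]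
      obtain ⟨π, a1, -⟩ := c1
      rw [(a1 t ht).2, sidx_spos]
      exact (a1 t ht).1
end
end ScanSort

namespace ScanSort
open ScanModel

/-! ## Suffix sorting: ascent -/

/-- `rk` orders the suffixes at positions that are not divisible by `3`. -/
def RankOK (s : ℕ → ℕ) (N : ℕ) (rk : ℕ → ℕ) : Prop :=
  ∀ x y, x ≤ N + 1 → y ≤ N + 1 → x % 3 ≠ 0 → y % 3 ≠ 0 → slt s x y → rk x < rk y

/-- From positions congruent to `0` and `1` a single step leads to positions congruent to `1` and
`2`, which `rk` compares. If the second position is congruent to `2`, two steps are needed, as in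
`RankOK.slt_iff_two`. -/
theorem RankOK.slt_iff_one {s : ℕ → ℕ} {N : ℕ} {rk : ℕ → ℕ} (h : RankOK s N rk) (hs : IsStr s N)
    {p q : ℕ} (hp : p < N) (hp3 : p % 3 = 0) (hq : q < N) (hq3 : q % 3 = 1) :
    slt s p q ↔ s p < s q ∨ s p = s q ∧ rk (p + 1) < rk (q + 1) := by
  have h1 := h (p + 1) (q + 1) (by omega) (by omega) (by omega) (by omega)
  have h2 := h (q + 1) (p + 1) (by omega) (by omega) (by omega) (by omega)
  have h3 : slt s p q ∨ slt s q p := hs.slt_total (by omega) hp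
  have h4 : slt s p q → ¬ slt s q p := slt_asymm
  have h5 := slt_iff s p q
  have h6 := slt_iff s q p
  grind

theorem RankOK.slt_iff_two {s : ℕ → ℕ} {N : ℕ} {rk : ℕ → ℕ} (h : RankOK s N rk) (hs : IsStr s N)
    {p q : ℕ} (hp : p < N) (hp3 : p % 3 = 0) (hq : q < N) (hq3 : q % 3 = 2) :
    slt s p q ↔ s p < s q ∨ s p = s q ∧
      (s (p + 1) < s (q + 1) ∨ s (p + 1) = s (q + 1) ∧ rk (p + 2) < rk (q + 2)) := by
  have h1 := h (p + 2) (q + 2) (by omega) (by omega) (by omega) (by omega)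
  have h2 := h (q + 2) (p + 2) (by omega) (by omega) (by omega) (by omega)
  have h3 : slt s p q ∨ slt s q p := hs.slt_total (by omega) hp
  have h4 : slt s p q → ¬ slt s q p := slt_asymm
  have h5 := slt_iff s p q
  have h6 := slt_iff s q p
  have h7 := slt_iff s (p + 1) (q + 1)
  have h8 := slt_iff s (q + 1) (p + 1)
  grind

/-- Set `vnm` if the suffix at `p` precedes the suffix at `prev`. -/
def cmpSuffix : HC :=
  .ite (.lt (chr .vp 0) (chr .vprev 0)) (.asg .vnm 1)
    (.ite (.eq (chr .vp 0) (chr .vprev 0))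
      (.ite (.eq (Row.vprev.v % 3) 1)
        (.asg .vnm (.lt (.cell .aRK (Row.vp.v + 1)) (.cell .aRK (Row.vprev.v + 1))))
        (.ite (.lt (chr .vp 1) (chr .vprev 1)) (.asg .vnm 1)
          (.ite (.eq (chr .vp 1) (chr .vprev 1))
            (.asg .vnm (.lt (.cell .aRK (Row.vp.v + 2)) (.cell .aRK (Row.vprev.v + 2))))
            .skip)))
      .skip)

/-- Decide which of two sorted lists the next position is taken from: list `2` at `vy` or list
`0` at `vsum`. -/
def pick : HC :=
  .asg .vnm 0 ;;
  .ite (.lt Row.vy.v Row.vn1.v)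
    (.ite (.lt Row.vsum.v Row.vc.v)
      ((.asg .vp (.cell (.l 2) Row.vy.v) ;; .asg .vprev (.cell (.l 0) Row.vsum.v)) ;; cmpSuffix)
      (.asg .vnm 1))
    .skip

section
variable {C : Cfg} {m : Machine} {μ : Mem}

theorem cmpSuffix_run (hF : Fits C m) {κ o N p q : ℕ} (hL : LevelAt (μ .aS) κ o N)
    (hrk : RankOK (strOf (μ .aS) o N) N (μ .aRK)) (ho : μ .voff 0 = o) (hp : μ .vp 0 = p)
    (hq : μ .vprev 0 = q) (hnm : μ .vnm 0 = 0) (hpN : p < N) (hp3 : p % 3 = 0) (hqN : q < N)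
    (hq3 : q % 3 ≠ 0) (hI : o + N + 5 ≤ C.I) :
    MRun C m cmpSuffix μ 400 fun μ' => Frame [.vnm] μ μ' ∧
      (μ' .vnm 0 ≠ 0 ↔ slt (strOf (μ .aS) o N) p q) := by
  have hW := hF.mul_I_le
  refine (MRun.of_wp hF ?_).mono (Nat.le_of_ble_eq_true rfl) (fun _ h => h)
  intro x D
  have e : ∀ p < N, ∀ d < 3, μ .aS (o + p + d) = strOf (μ .aS) o N (p + d) := fun p hp d hd => by
    rw [add_assoc, hL.apply (by omega)]
  have e0 := e p hpN 0 (by omega)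
  have e1 := e p hpN 1 (by omega)
  have f0 := e q hqN 0 (by omega)
  have f1 := e q hqN 1 (by omega)
  simp only [add_zero] at e0 f0
  obtain ⟨s, hs⟩ : ∃ s, s = strOf (μ .aS) o N := ⟨_, rfl⟩
  have hstr := hL.isStr
  rw [← hs] at e0 e1 f0 f1 hrk hstr ⊢
  have c1 := hrk.slt_iff_one hstr hpN hp3 hqN
  have c2 := hrk.slt_iff_two hstr hpN hp3 hqN
  -- The comparison is encoded by a number, so that `omega` can settle the case distinction of the
  -- program.
  obtain ⟨b, hb⟩ : ∃ b : ℕ, slt s p q ↔ b = 1 := by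
    by_cases h : slt s p q
    · exact ⟨1, by simp [h]⟩
    · exact ⟨0, by simp [h]⟩
  rw [hb] at c1 c2 ⊢
  simp [wp, cmpSuffix, chr, Row.Valid, ho, hp, hq, e0, e1, f0, f1, Frame.refl, hnm]
  omega

theorem pick_run (hF : Fits C m) {κ o N n1 l x y : ℕ} {A B : ℕ → ℕ} (hL : LevelAt (μ .aS) κ o N)
    (hrk : RankOK (strOf (μ .aS) o N) N (μ .aRK)) (ho : μ .voff 0 = o) (hn1 : μ .vn1 0 = n1)
    (hc : μ .vc 0 = l) (hx : μ .vsum 0 = x) (hy : μ .vy 0 = y) (hA : μ (.l 0) = A)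
    (hB : μ (.l 2) = B) (hAN : x < l → A x < N ∧ A x % 3 ≠ 0)
    (hBN : y < n1 → B y < N ∧ B y % 3 = 0) (hlI : l < C.I) (hn1I : n1 < C.I)
    (hI : o + N + 5 ≤ C.I) :
    MRun C m pick μ 500 fun μ' => Frame [.vnm, .vp, .vprev] μ μ' ∧
      (μ' .vnm 0 ≠ 0 ↔ y < n1 ∧ (x < l → slt (strOf (μ .aS) o N) (B y) (A x))) := by
  have hW := hF.mul_I_le
  have r0 : MRun C m (.asg .vnm 0) μ 7 fun μ' => Frame [.vnm] μ μ' ∧ μ' .vnm 0 = 0 := by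
    refine (MRun.of_wp hF ?_).mono (Nat.le_of_ble_eq_true rfl) (fun _ h => h)
    intro x D
    simp [wp, Row.Valid, Frame.refl]
    omega
  refine (r0.bind (t' := 450 + 13 + 1 + 13 + 1) ?_).mono (by omega) fun _ h => h
  rintro μ1 ⟨f1, g1⟩
  have e1 : μ1 .vy 0 = y := by rw [f1 _ (by simp), hy]
  have e2 : μ1 .vn1 0 = n1 := by rw [f1 _ (by simp), hn1]
  have e3 : μ1 .vsum 0 = x := by rw [f1 _ (by simp), hx]
  have e4 : μ1 .vc 0 = l := by rw [f1 _ (by simp), hc]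
  have e5 : μ1 (.l 0) = A := by rw [f1 _ (by simp), hA]
  have e6 : μ1 (.l 2) = B := by rw [f1 _ (by simp), hB]
  have hok : ∀ r s : Row, r.Valid C.σ → s.Valid C.σ → (HE.lt r.v s.v).ok C μ1 := by
    intro r s hr hs
    simp [hr, hs]
    omega
  refine MRun.ite hF (hok _ _ trivial trivial) (fun hv => ?_) fun hv => ?_
  · have hyn : y < n1 := by simpa [e1, e2] using hv
    refine MRun.ite hF (hok _ _ trivial trivial) (fun hv => ?_) fun hv => ?_
    · have hxl : x < l := by simpa [e3, e4] using hv
      have r1 : MRun C m (.asg .vp (.cell (.l 2) Row.vy.v) ;; .asg .vprev (.cell (.l 0) Row.vsum.v))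
          μ1 50 fun μ' => Frame [.vp, .vprev] μ1 μ' ∧ μ' .vp 0 = B y ∧ μ' .vprev 0 = A x := by
        refine (MRun.of_wp hF ?_).mono (Nat.le_of_ble_eq_true rfl) (fun _ h => h)
        intro x D
        simp [wp, Row.Valid, Frame.refl, e1, e3, e5, e6]
        omega
      refine (r1.bind (t' := 400) ?_).mono (by omega) fun _ h => h
      rintro μ2 ⟨f2, g2, g3⟩
      have eS : μ2 .aS = μ .aS := (f2 _ (by simp)).trans (f1 _ (by simp))
      have eR : μ2 .aRK = μ .aRK := (f2 _ (by simp)).trans (f1 _ (by simp))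
      refine (cmpSuffix_run hF (o := o) (N := N) (κ := κ) (by rwa [eS]) (by rwa [eS, eR])
        (by rw [f2 _ (by simp), f1 _ (by simp), ho]) g2 g3 (by rw [f2 _ (by simp), g1])
        (hBN hyn).1 (hBN hyn).2 (hAN hxl).1 (hAN hxl).2 hI).mono le_rfl ?_
      rintro μ3 ⟨f3, g4⟩
      rw [eS] at g4
      refine ⟨((f1.mono (by simp)).trans f2 (by simp)).trans f3 (by simp), g4.trans ?_⟩
      simp [hyn, hxl]
    · have hxl : ¬ x < l := by simpa [e3, e4] using hv
      refine (MRun.of_wp hF ?_).mono (Nat.le_of_ble_eq_true rfl : _ ≤ 450) (fun _ h => h)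
      intro x D
      simp [wp, Row.Valid, f1.mono, hyn, hxl]
      omega
  · have hyn : ¬ y < n1 := by simpa [e1, e2] using hv
    refine (MRun.of_wp hF ?_).mono (Nat.le_of_ble_eq_true rfl : _ ≤ 464) (fun _ h => h)
    intro x D
    simp [wp, g1, hyn, f1.mono]
end
end ScanSort

/-! ### Expanding the sorted sample, and merging. -/

namespace ScanSort
open ScanModel

/-- From the sorted string of names: the sorted sample into list `0`, its ranks into `aRK`, and
the preceding positions of its first part into list `1`. -/
def expand : HC :=
  forUp .vi Row.vc.v
    (.asg .vp (.cell .aSA Row.vi.v) ;;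
      .ite (.lt Row.vp.v Row.vn1.v)
        (.asg .vp (3 * Row.vp.v + 1) ;; .set (.l 1) Row.vy.v (Row.vp.v - 1) ;;
          .asg .vy (Row.vy.v + 1))
        (.asg .vp (3 * (Row.vp.v - Row.vn1.v) + 2)) ;;
      .set (.l 0) Row.vi.v Row.vp.v ;; .set .aRK Row.vp.v (Row.vi.v + 1))

def expandRows : List Row := [.vi, .vp, .vy, .l 0, .l 1, .aRK]

section
variable {C : Cfg} {m : Machine} {μ : Mem}

/-- The sample is visited in the order of its suffixes. The positions `p` congruent to `0` below `N`
are the predecessors of the first part of the sample, so they enter list `1` in the order of the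
suffixes at `p + 1`; a stable sort by one character will then order the suffixes at `p`. -/
theorem expand_run (hF : Fits C m) {N : ℕ} {s f : ℕ → ℕ} (hs : Sorted s (ssize N) fun t => spos N (f t))
    (hf : ∀ t < ssize N, f t < ssize N) (hfμ : μ .aSA = f) (hn1 : μ .vn1 0 = (N + 2) / 3)
    (hc : μ .vc 0 = ssize N) (hy : μ .vy 0 = 0) (hI : 3 * N + 10 ≤ C.I) (hN : 1 ≤ N) :
    MRun C m expand μ (450 * N) fun μ' => Frame expandRows μ μ' ∧
      (∀ t < ssize N, μ' (.l 0) t = spos N (f t)) ∧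
      (∀ t < ssize N, μ' .aRK (spos N (f t)) = t + 1) ∧
      (∀ x, (∀ t < ssize N, spos N (f t) ≠ x) → μ' .aRK x = μ .aRK x) ∧
      (∀ k < (N + 2) / 3, ∃ t < ssize N, f t < (N + 2) / 3 ∧ μ' (.l 1) k = 3 * f t) ∧
      Sorted s ((N + 2) / 3) fun k => μ' (.l 1) k + 1 := by
  have hW := hF.mul_I_le
  have hm : ssize N ≤ N + 1 := by unfold ssize; omega
  obtain ⟨fr, hfr⟩ : ∃ fr, fr = expandRows := ⟨_, rfl⟩
  have m1 : Row.vi ∈ fr := by simp [hfr, expandRows]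
  have m2 : Row.vp ∈ fr := by simp [hfr, expandRows]
  have m3 : Row.vy ∈ fr := by simp [hfr, expandRows]
  have m4 : Row.l 0 ∈ fr := by simp [hfr, expandRows]
  have m5 : Row.l 1 ∈ fr := by simp [hfr, expandRows]
  have m6 : Row.aRK ∈ fr := by simp [hfr, expandRows]
  have n1 : Row.aSA ∉ fr := by simp [hfr, expandRows]
  have n2 : Row.vn1 ∉ fr := by simp [hfr, expandRows]
  have n3 : Row.vc ∉ fr := by simp [hfr, expandRows]
  rw [← hfr]
  have hinj : ∀ t < ssize N, ∀ t' < ssize N, t ≠ t' → f t ≠ f t' := fun t ht t' ht' hne h =>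
    hs.ne ht ht' hne (by simp [h])
  set ct : ℕ → ℕ := fun i => ((Finset.range i).filter fun t => f t < (N + 2) / 3).card with hct
  have ct_succ : ∀ i, ct (i + 1) = ct i + if f i < (N + 2) / 3 then 1 else 0 := fun i => by
    simp only [hct, Finset.range_add_one, Finset.filter_insert]
    split_ifs <;> simp
  have ct_le : ∀ i, ct i ≤ i := fun i => (Finset.card_filter_le _ _).trans (by simp)
  -- The list `f` is a permutation of the sample indices, so every index of the first part is met
  -- once.
  have ct_end : ct (ssize N) = (N + 2) / 3 := by
    simp only [hct]
    rw [card_filter_perm hf hinj fun u => u < (N + 2) / 3,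
      show (Finset.range (ssize N)).filter (fun u => u < (N + 2) / 3) =
        Finset.range ((N + 2) / 3) by
        ext u
        simp only [Finset.mem_filter, Finset.mem_range, ssize]
        omega, Finset.card_range]
  refine (MRun.forUp hF (r := .vi) trivial (N := ssize N) (t := 160) (by omega) (fun i μ' =>
    Frame fr μ μ' ∧ μ' .vi 0 = i ∧ μ' .vy 0 = ct i ∧
    (∀ t < i, μ' (.l 0) t = spos N (f t)) ∧ (∀ t < i, μ' .aRK (spos N (f t)) = t + 1) ∧
    (∀ x, (∀ t < ssize N, spos N (f t) ≠ x) → μ' .aRK x = μ .aRK x) ∧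
    (∀ k < ct i, ∃ t < i, f t < (N + 2) / 3 ∧ μ' (.l 1) k = 3 * f t) ∧
    Sorted s (ct i) fun k => μ' (.l 1) k + 1) ?_ ?_ ?_).mono ?_ ?_
  · simp [Frame.refl, m1, hy, hct, Sorted]
  · rintro i μ' hi ⟨h1, h2, h3⟩
    simp [h1 _ n3, hc, h2, Row.Valid]
    omega
  · rintro i μ' hi ⟨h1, h2, h3, h4, h5, h6, h7, h8⟩
    refine (MRun.of_wp hF ?_).mono (Nat.le_of_ble_eq_true rfl) (fun _ h => h)
    intro x D
    have g1 : μ' .aSA = f := (h1 _ n1).trans hfμ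
    have g2 : μ' .vn1 0 = (N + 2) / 3 := by rw [h1 _ n2, hn1]
    have g3 := hf i hi
    have g4 := ct_le i
    have k1 : ∀ t < i + 1, Function.update (μ' (.l 0)) i (spos N (f i)) t = spos N (f t) := by
      intro t ht
      rcases Nat.lt_or_ge t i with h | h
      · rw [Function.update_of_ne (by omega), h4 t h]
      · obtain rfl : t = i := by omega
        rw [Function.update_self]
    have k2 : ∀ t < i + 1, Function.update (μ' .aRK) (spos N (f i)) (i + 1) (spos N (f t)) =
        t + 1 := by
      intro t ht
      rcases Nat.lt_or_ge t i with h | h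
      · rw [Function.update_of_ne (hs.ne (h.trans hi) hi h.ne), h5 t h]
      · obtain rfl : t = i := by omega
        rw [Function.update_self]
    have k3 : ∀ x, (∀ t < ssize N, spos N (f t) ≠ x) →
        Function.update (μ' .aRK) (spos N (f i)) (i + 1) x = μ .aRK x := fun x hx => by
      rw [Function.update_of_ne (hx i hi).symm, h6 x hx]
    have hsp := (spos_lt g3).1
    by_cases hlt : f i < (N + 2) / 3
    · have e1 : spos N (f i) = 3 * f i + 1 := by rw [spos, if_pos hlt]
      have c1 : ct (i + 1) = ct i + 1 := by rw [ct_succ, if_pos hlt]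
      have k4 : ∀ k < ct i + 1, ∃ t < i + 1, f t < (N + 2) / 3 ∧
          Function.update (μ' (.l 1)) (ct i) (3 * f i) k = 3 * f t := by
        intro k hk
        rcases Nat.lt_or_ge k (ct i) with h | h
        · obtain ⟨t, a1, a2, a3⟩ := h7 k h
          exact ⟨t, by omega, a2, by rw [Function.update_of_ne (by omega), a3]⟩
        · obtain rfl : k = ct i := by omega
          exact ⟨i, by omega, hlt, by rw [Function.update_self]⟩
      have k5 : Sorted s (ct i + 1) fun k =>
          Function.update (μ' (.l 1)) (ct i) (3 * f i) k + 1 := by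
        intro k k' hkk hk'
        simp only
        rw [Function.update_of_ne (by omega)]
        rcases Nat.lt_or_ge k' (ct i) with h | h
        · rw [Function.update_of_ne (by omega)]
          exact h8 k k' hkk h
        · obtain rfl : k' = ct i := by omega
          obtain ⟨t, a1, a2, a3⟩ := h7 k hkk
          have := hs t i a1 hi
          simp only [e1] at this
          rw [Function.update_self, a3]
          simpa [spos, a2] using this
      rw [e1] at k1 k2 k3 hsp
      simp [wp, Row.Valid, h1, h2, h3, m1, m2, m3, m4, m5, m6, g1, g2, hlt, c1]
      and_intros
      all_goals first | omega | exact k3 | exact k5 | skip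
      · exact fun t ht => k1 t (by omega)
      · exact fun t ht => k2 t (by omega)
      · intro k hk
        obtain ⟨t, a1, a2⟩ := k4 k (by omega)
        exact ⟨t, by omega, a2⟩
    · have e1 : spos N (f i) = 3 * (f i - (N + 2) / 3) + 2 := by rw [spos, if_neg hlt]
      have c1 : ct (i + 1) = ct i := by rw [ct_succ, if_neg hlt, add_zero]
      rw [e1] at k1 k2 k3 hsp
      simp [wp, Row.Valid, h1, h2, h3, m1, m2, m4, m6, g1, g2, hlt, c1]
      and_intros
      all_goals first | omega | exact k3 | exact h8 | skip
      · exact fun t ht => k1 t (by omega)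
      · exact fun t ht => k2 t (by omega)
      · intro k hk
        obtain ⟨t, a1, a2⟩ := h7 k hk
        exact ⟨t, by omega, a2⟩
  · simp only [HE.cost]; omega
  · rintro μ' ⟨h1, -, -, h2, h3, h4, h5, h6⟩
    rw [ct_end] at h5 h6
    exact ⟨h1, h2, h3, h4, h5, h6⟩

/-- Merge the lists `0` (from `vsum` on) and `2` into `aSA`. -/
def merge : HC :=
  forUp .vi Row.vN.v
    (pick ;;
      .ite Row.vnm.v
        (.set .aSA Row.vi.v (.cell (.l 2) Row.vy.v) ;; .asg .vy (Row.vy.v + 1))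
        (.set .aSA Row.vi.v (.cell (.l 0) Row.vsum.v) ;; .asg .vsum (Row.vsum.v + 1)))

def mergeRows : List Row := [.vi, .vnm, .vp, .vprev, .vy, .vsum, .aSA]

/-- Every suffix written so far precedes everything that remains in both lists. The offset `x₀`
makes it possible to skip the empty suffix at the head of list `0`. -/
theorem merge_run (hF : Fits C m) {κ o N n1 l x₀ : ℕ} {s A B : ℕ → ℕ}
    (hL : LevelAt (μ .aS) κ o N) (hs : strOf (μ .aS) o N = s)
    (hrk : RankOK s N (μ .aRK)) (ho : μ .voff 0 = o) (hn1 : μ .vn1 0 = n1)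
    (hc : μ .vc 0 = l) (hx : μ .vsum 0 = x₀) (hy : μ .vy 0 = 0) (hNv : μ .vN 0 = N)
    (hA : μ (.l 0) = A) (hB : μ (.l 2) = B)
    (hAN : ∀ x < l, x₀ ≤ x → A x < N ∧ A x % 3 ≠ 0)
    (hBN : ∀ y < n1, B y < N ∧ B y % 3 = 0) (hAs : Sorted s l A) (hBs : Sorted s n1 B)
    (hsum : l + n1 = N + x₀) (hx₀ : x₀ ≤ l) (hlI : l < C.I) (hn1I : n1 < C.I)
    (hI : o + N + 5 ≤ C.I) :
    MRun C m merge μ (700 * N + 26) fun μ' => Frame mergeRows μ μ' ∧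
      Sorted s N (μ' .aSA) ∧ ∀ t < N, μ' .aSA t < N := by
  have hW := hF.mul_I_le
  obtain ⟨fr, hfr⟩ : ∃ fr, fr = mergeRows := ⟨_, rfl⟩
  have m1 : Row.vi ∈ fr := by simp [hfr, mergeRows]
  have m2 : Row.vy ∈ fr := by simp [hfr, mergeRows]
  have m3 : Row.vsum ∈ fr := by simp [hfr, mergeRows]
  have m4 : Row.aSA ∈ fr := by simp [hfr, mergeRows]
  have n1' : Row.l 0 ∉ fr := by simp [hfr, mergeRows]
  have n2 : Row.l 2 ∉ fr := by simp [hfr, mergeRows]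
  have n3 : Row.vN ∉ fr := by simp [hfr, mergeRows]
  have n4 : Row.vn1 ∉ fr := by simp [hfr, mergeRows]
  have n5 : Row.vc ∉ fr := by simp [hfr, mergeRows]
  have n6 : Row.voff ∉ fr := by simp [hfr, mergeRows]
  have n7 : Row.aS ∉ fr := by simp [hfr, mergeRows]
  have n8 : Row.aRK ∉ fr := by simp [hfr, mergeRows]
  have mpick : ∀ r ∈ [Row.vnm, Row.vp, Row.vprev], r ∈ fr := by simp [hfr, mergeRows]
  rw [← hfr]
  have hstr : IsStr s N := hs ▸ hL.isStr
  refine (MRun.forUp hF (r := .vi) trivial (N := N) (t := 600) (by omega) (fun i μ' =>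
    Frame fr μ μ' ∧ μ' .vi 0 = i ∧ ∃ x y, μ' .vsum 0 = x ∧ μ' .vy 0 = y ∧ x + y = i + x₀ ∧
    x₀ ≤ x ∧ x ≤ l ∧ y ≤ n1 ∧ (∀ t < i, μ' .aSA t < N) ∧ Sorted s i (μ' .aSA) ∧
    (∀ t < i, ∀ x' < l, x ≤ x' → slt s (μ' .aSA t) (A x')) ∧
    ∀ t < i, ∀ y' < n1, y ≤ y' → slt s (μ' .aSA t) (B y')) ?_ ?_ ?_).mono ?_ ?_
  · simp only [m1, Frame.set_iff, Frame.refl, Mem.set_self, Function.update_self, true_and]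
    exact ⟨x₀, 0, by simp [hx], by simp [hy], by omega, le_rfl, hx₀, by omega, by simp,
      by simp [Sorted], by simp, by simp⟩
  · rintro i μ' hi ⟨h1, h2, h3⟩
    simp [h1 _ n3, hNv, h2, Row.Valid]
    omega
  · rintro i μ' hi ⟨h1, h2, x, y, h3, h4, h5, h6, h7, h8, h9, h10, h11, h12⟩
    have eS := h1 _ n7
    refine ((pick_run hF (κ := κ) (o := o) (N := N) (n1 := n1) (l := l) (A := A) (B := B)
      (by rwa [eS]) (by rwa [eS, h1 _ n8, hs]) (by rw [h1 _ n6, ho]) (by rw [h1 _ n4, hn1])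
      (by rw [h1 _ n5, hc]) h3 h4 (by rw [h1 _ n1', hA]) (by rw [h1 _ n2, hB])
      (fun h => hAN x h h6) (fun h => hBN y h) hlI hn1I hI).bind (t' := 100) ?_).mono (by omega)
      fun _ h => h
    rw [eS, hs]
    rintro μ2 ⟨f2, g⟩
    have h1' : Frame fr μ μ2 := h1.trans f2 mpick
    have e1 := f2 .vi (by simp)
    have e2 := f2 .vsum (by simp)
    have e3 := f2 .vy (by simp)
    have e4 := f2 .aSA (by simp)
    rw [← e1] at h2
    rw [← e2] at h3
    rw [← e3] at h4
    rw [← e4] at h9 h10 h11 h12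
    clear f2 e1 e2 e3 e4 h1 eS
    have hA2 : μ2 (.l 0) = A := (h1' _ n1').trans hA
    have hB2 : μ2 (.l 2) = B := (h1' _ n2).trans hB
    -- appending a position that precedes all remaining ones
    have app : ∀ v x' y', v < N → x ≤ x' → y ≤ y' → (∀ t < i, slt s (μ2 .aSA t) v) →
        (∀ k < l, x' ≤ k → slt s v (A k)) → (∀ k < n1, y' ≤ k → slt s v (B k)) →
        (∀ t < i + 1, Function.update (μ2 .aSA) i v t < N) ∧
        Sorted s (i + 1) (Function.update (μ2 .aSA) i v) ∧
        (∀ t < i + 1, ∀ k < l, x' ≤ k → slt s (Function.update (μ2 .aSA) i v t) (A k)) ∧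
        ∀ t < i + 1, ∀ k < n1, y' ≤ k → slt s (Function.update (μ2 .aSA) i v t) (B k) := by
      intro v x' y' hv hxx hyy q1 q2 q3
      have u1 : Function.update (μ2 .aSA) i v i = v := Function.update_self ..
      have u2 : ∀ t < i, Function.update (μ2 .aSA) i v t = μ2 .aSA t := fun t ht =>
        Function.update_of_ne ht.ne _ _
      refine ⟨fun t ht => ?_, fun t t' htt ht' => ?_, fun t ht k hk hk' => ?_,
        fun t ht k hk hk' => ?_⟩
      · rcases (Nat.lt_succ_iff.1 ht).lt_or_eq with h | rfl
        · rw [u2 t h]; exact h9 t h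
        · rwa [u1]
      · rw [u2 t (by omega)]
        rcases (Nat.lt_succ_iff.1 ht').lt_or_eq with h | rfl
        · rw [u2 t' h]; exact h10 t t' htt h
        · rw [u1]; exact q1 t htt
      · rcases (Nat.lt_succ_iff.1 ht).lt_or_eq with h | rfl
        · rw [u2 t h]; exact h11 t h k hk (by omega)
        · rw [u1]; exact q2 k hk hk'
      · rcases (Nat.lt_succ_iff.1 ht).lt_or_eq with h | rfl
        · rw [u2 t h]; exact h12 t h k hk (by omega)
        · rw [u1]; exact q3 k hk hk'
    by_cases hnm : μ2 .vnm 0 = 0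
    · have hnot : ¬ (y < n1 ∧ (x < l → slt s (B y) (A x))) := fun h => g.2 h hnm
      have hxl : x < l := by
        by_contra hc
        exact hnot ⟨by omega, fun h => absurd h hc⟩
      have hAB : y < n1 → slt s (A x) (B y) := fun h => by
        have a1 : ¬ slt s (B y) (A x) := fun hc => hnot ⟨h, fun _ => hc⟩
        have a2 := hAN x hxl h6
        have a3 := hBN y h
        rcases hstr.slt_total (i := A x) (j := B y) (by omega) a2.1 with a4 | a4
        · exact a4
        · exact absurd a4 a1
      obtain ⟨r1, r2, r3, r4⟩ := app (A x) (x + 1) y (hAN x hxl h6).1 (by omega) le_rfl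
        (fun t ht => h11 t ht x hxl le_rfl) (fun k hk hk' => hAs x k (by omega) hk) fun k hk hk' => by
          rcases hk'.lt_or_eq with h | rfl
          · exact slt_trans (hAB (by omega)) (hBs y k h hk)
          · exact hAB hk
      refine (MRun.of_wp hF ?_).mono (Nat.le_of_ble_eq_true rfl) (fun _ h => h)
      intro x1 D
      simp [wp, Row.Valid, hnm, h1', h2, h3, h4, hA2, m1, m3, m4]
      and_intros
      any_goals first | omega | exact r2
      exacts [fun t ht => r1 t (by omega), fun t ht => r3 t (by omega),
        fun t ht => r4 t (by omega)]
    · obtain ⟨hyn, hBA⟩ := g.1 hnm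
      obtain ⟨r1, r2, r3, r4⟩ := app (B y) x (y + 1) (hBN y hyn).1 le_rfl (by omega)
        (fun t ht => h12 t ht y hyn le_rfl) (fun k hk hk' => by
          rcases hk'.lt_or_eq with h | rfl
          · exact slt_trans (hBA (by omega)) (hAs x k h hk)
          · exact hBA hk) fun k hk hk' => hBs y k (by omega) hk
      refine (MRun.of_wp hF ?_).mono (Nat.le_of_ble_eq_true rfl) (fun _ h => h)
      intro x1 D
      simp [wp, Row.Valid, hnm, h1', h2, h3, h4, hB2, m1, m2, m4]
      and_intros
      any_goals first | omega | exact r2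
      exacts [fun t ht => r1 t (by omega), fun t ht => r3 t (by omega),
        fun t ht => r4 t (by omega)]
  · simp only [HE.cost]; omega
  · rintro μ' ⟨h1, -, x, y, -, -, -, -, -, -, h2, h3, -, -⟩
    exact ⟨h1, h3, h2⟩
end
end ScanSort

/-! ### The ascent, and suffix sorting in linear time. -/

namespace ScanSort
open ScanModel

def popLevel (κ : ℕ) : HC :=
  .asg .vlev (Row.vlev.v - 1) ;; .asg .vN (.cell .aNN Row.vlev.v) ;;
  .asg .voff (Row.voff.v - (Row.vN.v + 3)) ;; .asg .vn1 ((Row.vN.v + 2) / 3) ;;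
  .asg .vc (Row.vn1.v + Row.vN.v / 3) ;; .asg .vkk (Row.vN.v + .lit κ) ;;
  .set .aRK Row.vN.v 0 ;; .set .aRK (Row.vN.v + 1) 0 ;; .asg .vy 0

/-- One step of the ascent: from the suffix array of the string of names to that of the string. -/
def ascend (κ : ℕ) : HC :=
  popLevel κ ;; expand ;; .asg .vc Row.vn1.v ;; csort 1 2 0 ;;
  (.asg .vc (Row.vn1.v + Row.vN.v / 3) ;; .asg .vsum (.eq (Row.vN.v % 3) 1) ;; .asg .vy 0) ;;
  merge

def ascendRows : List Row :=
  [.vlev, .vN, .voff, .vn1, .vc, .vkk, .aRK, .vy, .vi, .vk, .vsum, .acnt, .l 0, .l 1, .l 2, .vp,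
    .vnm, .vprev, .aSA]

/-- `f` is the suffix array of the string `s` of length `N`. -/
def IsSA (s : ℕ → ℕ) (N : ℕ) (f : ℕ → ℕ) : Prop := (∀ t < N, f t < N) ∧ Sorted s N f

section
variable {C : Cfg} {m : Machine} {μ : Mem}

/-- The larger suffix of a comparison is nonempty, hence listed with a positive rank. A smaller one
that is not listed begins at `N` or `N + 1` and has rank `0`. -/
theorem rankOK_of_sorted {s : ℕ → ℕ} {N : ℕ} (hs : IsStr s N) {f rk : ℕ → ℕ}
    (hf : ∀ t < ssize N, f t < ssize N) (hsort : Sorted s (ssize N) fun t => spos N (f t))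
    (h1 : ∀ t < ssize N, rk (spos N (f t)) = t + 1)
    (h2 : ∀ x, N ≤ x → x ≤ N + 1 → (∀ t < ssize N, spos N (f t) ≠ x) → rk x = 0) :
    RankOK s N rk := by
  have hinj : ∀ t < ssize N, ∀ t' < ssize N, t ≠ t' → f t ≠ f t' := fun t ht t' ht' hne h =>
    hsort.ne ht ht' hne (by simp [h])
  have hlist : ∀ y < N, y % 3 ≠ 0 → ∃ t < ssize N, spos N (f t) = y := fun y hy hy3 => by
    obtain ⟨a1, a2⟩ := spos_sidx (.inl ⟨hy, hy3⟩)
    obtain ⟨t, ht, ht'⟩ := exists_index hf hinj a1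
    exact ⟨t, ht, by rw [ht', a2]⟩
  intro x y hx hy hx3 hy3 hxy
  obtain ⟨t', ht', rfl⟩ := hlist y (hs.lt_of_slt hxy) hy3
  rw [h1 t' ht']
  by_cases hex : ∃ t < ssize N, spos N (f t) = x
  · obtain ⟨t, ht, rfl⟩ := hex
    rw [h1 t ht]
    have := (hsort.lt_iff ht ht').1 hxy
    omega
  · push Not at hex
    rw [h2 x ?_ hx hex]
    · omega
    · by_contra hc
      obtain ⟨t, ht, h⟩ := hlist x (by omega) hx3
      exact hex t ht h

/-- The order of the names gives the order of the sample. A suffix at a position divisible by `3` is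
a character followed by a sample suffix, so list `1`, already ordered by the latter, needs only a
stable sort by that character. The two sorted lists are then merged. -/
theorem ascend_run (hF : Fits C m) {κ lev o N : ℕ} (hL : LevelAt (μ .aS) κ o N) (hN : 2 ≤ N)
    (hZ : μ .aNN lev = N)
    (hnam : IsNaming (strOf (μ .aS) o N) N (strOf (μ .aS) (o + N + 3) (ssize N)))
    (hlev : μ .vlev 0 = lev + 1) (ho : μ .voff 0 = o + N + 3)
    (hSA : IsSA (strOf (μ .aS) (o + N + 3) (ssize N)) (ssize N) (μ .aSA))
    (hlI : lev + 2 ≤ C.I) (hI : o + 3 * N + 3 * κ + 10 ≤ C.I) :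
    MRun C m (ascend κ) μ (3000 * (N + κ)) fun μ' => Frame ascendRows μ μ' ∧
      IsSA (strOf (μ .aS) o N) N (μ' .aSA) ∧ μ' .vlev 0 = lev ∧ μ' .voff 0 = o := by
  have hW := hF.mul_I_le
  have hm : ssize N ≤ N := by unfold ssize; omega
  have hm' : (N + 2) / 3 + N / 3 = ssize N := rfl
  obtain ⟨s, hs⟩ : ∃ s, s = strOf (μ .aS) o N := ⟨_, rfl⟩
  obtain ⟨f, hf⟩ : ∃ f, f = μ .aSA := ⟨_, rfl⟩
  have hstr := hL.isStr
  rw [← hf] at hSA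
  rw [← hs] at hnam hstr ⊢
  obtain ⟨hfl, hfs⟩ := hSA
  have hsort := hnam.sorted hstr hfl hfs
  have hn1N : (N + 2) / 3 ≤ N := by omega
  -- restoring the level
  have r1 : MRun C m (popLevel κ) μ 300 fun μ' =>
      Frame [.vlev, .vN, .voff, .vn1, .vc, .vkk, .aRK, .vy] μ μ' ∧ μ' .vlev 0 = lev ∧
      μ' .vN 0 = N ∧ μ' .voff 0 = o ∧ μ' .vn1 0 = (N + 2) / 3 ∧ μ' .vc 0 = ssize N ∧
      μ' .vkk 0 = N + κ ∧ μ' .aRK N = 0 ∧ μ' .aRK (N + 1) = 0 ∧ μ' .vy 0 = 0 := by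
    refine (MRun.of_wp hF ?_).mono (Nat.le_of_ble_eq_true rfl) (fun _ h => h)
    intro x D
    simp [popLevel, wp, Row.Valid, Frame.refl, hlev, hZ, ho, hm']
    omega
  refine (r1.bind (t' := 2600 * (N + κ)) ?_).mono (by omega) fun _ h => h
  rintro μ1 ⟨f1, a1, a2, a3, a4, a5, a6, a7, a8, a9⟩
  have eS1 : μ1 .aS = μ .aS := f1 _ (by simp)
  have eA1 : μ1 .aSA = f := (f1 _ (by simp)).trans hf.symm
  have g1 : Frame ascendRows μ μ1 := f1.mono (by simp [ascendRows])
  -- the sorted sample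
  refine ((expand_run hF hsort hfl eA1 a4 a5 a9 (by omega) (by omega)).bind
    (t' := 2100 * (N + κ)) ?_).mono (by omega) fun _ h => h
  rintro μ2 ⟨f2, b1, b2, b3, b4, b5⟩
  have hrk : RankOK s N (μ2 .aRK) := rankOK_of_sorted hstr hfl hsort b2 fun x hx hx' hne => by
    rw [b3 x hne]
    rcases (by omega : x = N ∨ x = N + 1) with rfl | rfl <;> assumption
  have eS2 : μ2 .aS = μ .aS := (f2 _ (by simp [expandRows])).trans eS1
  have c1 : μ2 .vlev 0 = lev := by rw [f2 _ (by simp [expandRows]), a1]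
  have c2 : μ2 .vN 0 = N := by rw [f2 _ (by simp [expandRows]), a2]
  have c3 : μ2 .voff 0 = o := by rw [f2 _ (by simp [expandRows]), a3]
  have c4 : μ2 .vn1 0 = (N + 2) / 3 := by rw [f2 _ (by simp [expandRows]), a4]
  have c6 : μ2 .vkk 0 = N + κ := by rw [f2 _ (by simp [expandRows]), a6]
  have g2 : Frame ascendRows μ μ2 := g1.trans f2 (by simp [expandRows, ascendRows])
  clear f1 f2 a1 a2 a3 a4 a5 a6 a7 a8 a9 eS1 eA1 g1 b2 b3
  have r3 : MRun C m (.asg .vc Row.vn1.v) μ2 15 fun μ' => Frame [.vc] μ2 μ' ∧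
      μ' .vc 0 = (N + 2) / 3 := by
    refine (MRun.of_wp hF ?_).mono (Nat.le_of_ble_eq_true rfl) (fun _ h => h)
    intro x D
    simp [wp, Row.Valid, Frame.refl, c4]
    omega
  refine (r3.bind (t' := 2000 * (N + κ)) ?_).mono (by omega) fun _ h => h
  rintro μ3 ⟨f3, d1⟩
  -- sorting the positions divisible by `3`
  have hl1 : ∀ k < (N + 2) / 3, μ2 (.l 1) k < N ∧ μ2 (.l 1) k % 3 = 0 := fun k hk => by
    obtain ⟨t, -, e1, e2⟩ := b4 k hk
    omega
  have hkey : ∀ p < N, μ .aS (o + p + 0) = s p := fun p hp => by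
    rw [hs, add_zero, hL.apply (by omega)]
  have eS3 : μ3 .aS = μ .aS := (f3 _ (by simp)).trans eS2
  have el3 : μ3 (.l 1) = μ2 (.l 1) := f3 _ (by simp)
  refine ((csort_run hF (j := 1) (k := 2) (by decide) 0 (K := N + κ) (o := o) d1
    (by rw [f3 _ (by simp), c6]) (by rw [f3 _ (by simp), c3]) (by omega) (by omega) (T := N + κ) ?_
    (by omega) le_rfl (by omega)).bind (t' := 1200 * (N + κ)) ?_).mono (by omega) fun _ h => h
  · intro t ht
    rw [el3, eS3]
    have := (hl1 t ht).1
    have h := hL.lt (i := μ2 (.l 1) t) (by omega)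
    exact ⟨by omega, by simpa using h⟩
  rintro μ4 ⟨f4, π, p1, p2, p3⟩
  rw [el3] at p1
  rw [eS3] at p3
  have g4 : Frame ascendRows μ μ4 :=
    (g2.trans f3 (by simp [ascendRows])).trans f4 (by simp [ascendRows])
  have e1 : μ4 .vlev 0 = lev := by rw [f4 _ (by simp), f3 _ (by simp), c1]
  have e2 : μ4 .vN 0 = N := by rw [f4 _ (by simp), f3 _ (by simp), c2]
  have e3 : μ4 .voff 0 = o := by rw [f4 _ (by simp), f3 _ (by simp), c3]
  have e4 : μ4 .vn1 0 = (N + 2) / 3 := by rw [f4 _ (by simp), f3 _ (by simp), c4]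
  have eS4 : μ4 .aS = μ .aS := (f4 _ (by simp)).trans eS3
  have eR4 : μ4 .aRK = μ2 .aRK := (f4 _ (by simp)).trans (f3 _ (by simp))
  have el4 : μ4 (.l 0) = μ2 (.l 0) := (f4 _ (by simp)).trans (f3 _ (by simp))
  have hB : ∀ y < (N + 2) / 3, μ4 (.l 2) y < N ∧ μ4 (.l 2) y % 3 = 0 := fun y hy => by
    rw [(p1 y hy).2]
    exact hl1 _ (p1 y hy).1
  -- Equal first characters keep their order in list `1`, which is the order of the suffixes one
  -- position later.
  have hBs : Sorted s ((N + 2) / 3) (μ4 (.l 2)) := fun t t' htt ht' => by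
    have q := p3 t t' htt ht'
    simp only [hkey _ (hB t (htt.trans ht')).1, hkey _ (hB t' ht').1] at q
    rw [slt_iff]
    refine q.imp_right fun q => ⟨q.1, ?_⟩
    have := b5 _ _ q.2 (p1 t' ht').1
    simpa only [(p1 t (htt.trans ht')).2, (p1 t' ht').2] using this
  clear f3 f4 eS3 el3 d1 p3 p2 p1 hl1 r3 r1 b4 b5 g2 c1 c2 c3 c4 c6
  have r5 : MRun C m (.asg .vc (Row.vn1.v + Row.vN.v / 3) ;; .asg .vsum (.eq (Row.vN.v % 3) 1) ;;
      .asg .vy 0) μ4 60 fun μ' => Frame [.vc, .vsum, .vy] μ4 μ' ∧ μ' .vc 0 = ssize N ∧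
      (μ' .vsum 0 = if N % 3 = 1 then 1 else 0) ∧ μ' .vy 0 = 0 := by
    refine (MRun.of_wp hF ?_).mono (Nat.le_of_ble_eq_true rfl) (fun _ h => h)
    intro x D
    simp [wp, Row.Valid, Frame.refl, e2, e4, hm']
    omega
  refine (r5.bind (t' := 1000 * (N + κ)) ?_).mono (by omega) fun _ h => h
  rintro μ5 ⟨f5, k1, k2, k3⟩
  have eS5 : μ5 .aS = μ .aS := (f5 _ (by simp)).trans eS4
  have el5 : μ5 (.l 0) = μ2 (.l 0) := (f5 _ (by simp)).trans el4
  have eR5 : μ5 .aRK = μ2 .aRK := (f5 _ (by simp)).trans eR4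
  have hAs : Sorted s (ssize N) (μ5 (.l 0)) := fun t t' htt ht' => by
    rw [el5, b1 t (htt.trans ht'), b1 t' ht']
    exact hsort t t' htt ht'
  refine (merge_run hF (κ := κ) (o := o) (N := N) (n1 := (N + 2) / 3) (l := ssize N) (s := s)
    (by rwa [eS5]) (by rw [eS5, hs]) (by rwa [eR5]) (by rw [f5 _ (by simp), e3])
    (by rw [f5 _ (by simp), e4]) k1 k2 k3 (by rw [f5 _ (by simp), e2]) rfl rfl ?_ ?_ hAs ?_ ?_ ?_
    (by omega) (by omega) (by omega)).mono (by omega) ?_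
  · intro x hx hx0
    rw [el5, b1 x hx]
    have q := spos_lt (hfl x hx)
    -- The empty suffix at `N` can stand only at index `0` of the sorted sample, since every later
    -- entry exceeds another suffix. If it occurs, `vsum` starts at `1` and skips it.
    refine ⟨lt_of_le_of_ne q.1 fun he => ?_, q.2⟩
    rw [if_pos (spos_eq_iff (hfl x hx) he)] at hx0
    have : spos N (f x) < N := hstr.lt_of_slt (hsort 0 x (by omega) hx)
    omega
  · intro y hy
    rw [f5 _ (by simp)]
    exact hB y hy
  · rw [f5 _ (by simp)]
    exact hBs
  · unfold ssize
    split_ifs <;> omega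
  · unfold ssize
    split_ifs <;> omega
  · rintro μ6 ⟨f6, h1, h2⟩
    refine ⟨(g4.trans f5 (by simp [ascendRows])).trans f6 (by simp [ascendRows, mergeRows]),
      ⟨h2, h1⟩, ?_, ?_⟩
    · rw [f6 _ (by simp [mergeRows]), f5 _ (by simp), e1]
    · rw [f6 _ (by simp [mergeRows]), f5 _ (by simp), e3]

/-- Suffix array of the string of length `vL` stored in `aS`. -/
def sufSort (κ : ℕ) : HC :=
  (.asg .vlev 0 ;; .asg .voff 0 ;; .asg .vN Row.vL.v) ;;
  .loop (.lt 1 Row.vN.v) (descend κ) ;;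
  .set .aSA 0 0 ;;
  .loop Row.vlev.v (ascend κ)

/-- The sample has about `2 / 3` of the positions; `8 / 9` also covers rounding and the additional
position `N`. The three estimates bound the total time by a geometric sum, the number of levels, and
the cells for all strings with their zeros. -/
theorem ssize_le {N : ℕ} (h : 2 ≤ N) : 9 * ssize N + N ≤ 9 * N ∧ ssize N < N ∧
    N + 3 + 36 * ssize N ≤ 36 * N := by
  unfold ssize
  omega

theorem Chain.bounds {S Z : ℕ → ℕ} {κ L lev o N : ℕ} (h : Chain S Z κ L lev o N) :
    o + 36 * N ≤ 36 * L ∧ lev + N ≤ L ∧ L ≤ o + N := by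
  induction h with
  | base h => omega
  | step h1 h2 h3 h4 h5 ih =>
    have := ssize_le h2
    omega

theorem sufSort_run (hF : Fits C m) {κ L : ℕ} (hκ : 1 ≤ κ) (hL : LevelAt (μ .aS) κ 0 L)
    (hLv : μ .vL 0 = L) (hI : 36 * L + 3 * κ + 20 ≤ C.I) :
    MRun C m (sufSort κ) μ (200000 * (κ + 1) * L) fun μ' =>
      Frame (descendRows ++ ascendRows) μ μ' ∧ IsSA (strOf (μ .aS) 0 L) L (μ' .aSA) := by
  have hW := hF.mul_I_le
  have hL1 := hL.pos
  -- `Q * N` pays for one step on a string of length `N`; the summand `9` is the cost of the loop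
  -- test.
  obtain ⟨Q, hQ⟩ : ∃ Q, Q = 3000 * (κ + 1) + 9 := ⟨_, rfl⟩
  have hQN : ∀ N, 1 ≤ N → 3000 * (N + κ) + 9 ≤ Q * N := fun N hN => by
    have : N + κ ≤ (κ + 1) * N := by nlinarith
    rw [hQ]
    nlinarith
  -- With `9 * (Q * N)` as time reserve, the loss of length in one descent pays for a step on a
  -- string of length `N`.
  have hQs : ∀ N, 2 ≤ N → Q * N + 9 * (Q * ssize N) ≤ 9 * (Q * N) := fun N hN => by
    have := Nat.mul_le_mul_left Q (ssize_le hN).1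
    linarith
  have hQL : 9 * (Q * L) + 9 * (Q * L) + 200 ≤ 200000 * (κ + 1) * L := by
    have : 1 ≤ (κ + 1) * L := Nat.mul_pos (by omega) hL1
    have : κ * L + L = (κ + 1) * L := by ring
    rw [hQ]
    nlinarith
  obtain ⟨fr, hfr⟩ : ∃ fr, fr = descendRows ++ ascendRows := ⟨_, rfl⟩
  have r1 : MRun C m (.asg .vlev 0 ;; .asg .voff 0 ;; .asg .vN Row.vL.v) μ 50 fun μ' =>
      Frame [.vlev, .voff, .vN] μ μ' ∧ μ' .vlev 0 = 0 ∧ μ' .voff 0 = 0 ∧ μ' .vN 0 = L := by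
    refine (MRun.of_wp hF ?_).mono (Nat.le_of_ble_eq_true rfl) (fun _ h => h)
    intro x D
    simp [wp, Row.Valid, Frame.refl, hLv]
    omega
  refine (r1.bind (t' := 9 * (Q * L) + 9 * (Q * L) + 100) ?_).mono (by omega) fun _ h => h
  rintro μ1 ⟨f1, a1, a2, a3⟩
  have g1 : Frame fr μ μ1 := f1.mono (by simp [hfr, descendRows, ascendRows])
  have eS1 : μ1 .aS = μ .aS := f1 _ (by simp)
  refine ((MRun.loop hF (fun k μ' => Frame fr μ μ' ∧ ∃ lev o N, k = 9 * (Q * N) ∧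
    Chain (μ' .aS) (μ' .aNN) κ L lev o N ∧ μ' .vlev 0 = lev ∧ μ' .voff 0 = o ∧ μ' .vN 0 = N ∧
      ∀ a < L + 3, μ' .aS a = μ .aS a) (k := 9 * (Q * L)) ⟨g1, 0, 0, L, rfl,
        .base (by rwa [eS1]), a1, a2, a3, fun a _ => by rw [eS1]⟩ ?_ ?_).bind
        (t' := 9 * (Q * L) + 50) ?_).mono
        (by simp only [HE.cost]; omega) fun _ h => h
  · rintro k μ' ⟨-, lev, o, N, -, -, -, -, h, -⟩
    simp [Row.Valid]
    omega
  · rintro k μ' ⟨hf, lev, o, N, rfl, hc, h1, h2, h3, h4⟩ hv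
    simp [h3] at hv
    have hb := hc.bounds
    have hs := hQs N hv
    have hq := hQN N (by omega)
    refine ⟨3000 * (N + κ), 9 * (Q * ssize N), by simp only [HE.cost]; omega, ?_⟩
    refine (descend_run hF hc hv hκ h1 h2 h3 (by omega) (by omega)).mono le_rfl ?_
    rintro μ2 ⟨k1, k2, k3, k4, k5, k6⟩
    exact ⟨hf.trans k1 (by rw [hfr]; exact fun r hr => List.mem_append_left _ hr), _, _, _, rfl, k2, k3, k4, k5,
      fun a ha => by rw [k6 a (by omega), h4 a ha]⟩
  rintro μ2 ⟨-, ⟨hf, lev, o, N, -, hc, h1, h2, h3, h4⟩, hv⟩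
  simp [h3] at hv
  have hN1 : N = 1 := le_antisymm hv hc.levelAt.pos
  subst hN1
  clear hv g1 f1 eS1
  have r2 : MRun C m (.set .aSA 0 0) μ2 20 fun μ' => Frame [.aSA] μ2 μ' ∧ μ' .aSA 0 = 0 := by
    refine (MRun.of_wp hF ?_).mono (Nat.le_of_ble_eq_true rfl) (fun _ h => h)
    intro x D
    simp [wp, Row.Valid, Frame.refl]
    omega
  refine (r2.bind (t' := 9 * (Q * L) + 30) ?_).mono (by omega) fun _ h => h
  rintro μ3 ⟨f3, d1⟩
  -- The same reserve is used in the opposite direction: the time left is `9 * Q` for each unit of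
  -- length still to be regained.
  refine (MRun.loop hF (fun k μ' => Frame fr μ μ' ∧ ∃ lev o N, k + 9 * (Q * N) = 9 * (Q * L) ∧
    Chain (μ' .aS) (μ' .aNN) κ L lev o N ∧ μ' .vlev 0 = lev ∧ μ' .voff 0 = o ∧
      IsSA (strOf (μ' .aS) o N) N (μ' .aSA) ∧
      ∀ a < L + 3, μ' .aS a = μ .aS a) (k := 9 * (Q * L) - 9 * (Q * 1)) ⟨?_, lev, o, 1, ?_, ?_, ?_,
        ?_, ?_, ?_⟩ ?_ ?_).mono (by simp only [HE.cost]; omega) ?_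
  · exact hf.trans f3 (by simp [hfr, descendRows, ascendRows])
  · have : Q * 1 ≤ Q * L := Nat.mul_le_mul_left _ hL1
    omega
  · rwa [f3 _ (by simp), f3 _ (by simp)]
  · rw [f3 _ (by simp), h1]
  · rw [f3 _ (by simp), h2]
  · refine ⟨fun t ht => ?_, fun t t' h h' => by omega⟩
    obtain rfl : t = 0 := by omega
    omega
  · intro a ha
    rw [f3 _ (by simp), h4 a ha]
  · rintro k μ' ⟨-, lev, o, N, -, -, h, -⟩
    simp [Row.Valid]
    omega
  · clear h1 h2 h3 h4 hc hf f3 d1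
    rintro k μ' ⟨hf, lev, o, N, hk, hc, h1, h2, h3, h4⟩ hv
    simp [h1] at hv
    have hb := hc.bounds
    cases hc with
    | base => omega
    | @step lev o N hc hN hZ hlv hnam =>
      have hb' := hc.bounds
      have hs := hQs N hN
      have hq := hQN N (by omega)
      have hNL : Q * N ≤ Q * L := Nat.mul_le_mul_left _ (by omega)
      refine ⟨3000 * (N + κ), 9 * (Q * L) - 9 * (Q * N), by simp only [HE.cost]; omega, ?_⟩
      refine (ascend_run hF hc.levelAt hN hZ hnam h1 h2 h3 (by omega) (by omega)).mono le_rfl ?_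
      rintro μ4 ⟨k1, k2, k3, k4⟩
      have eS : μ4 .aS = μ' .aS := k1 _ (by simp [ascendRows])
      have eN : μ4 .aNN = μ' .aNN := k1 _ (by simp [ascendRows])
      exact ⟨hf.trans k1 (by rw [hfr]; exact fun r hr => List.mem_append_right _ hr), lev, o, N,
        by omega, by rwa [eS, eN], k3, k4, by rwa [eS], by rwa [eS]⟩
  · rintro μ5 ⟨k, ⟨hf, lev, o, N, hk, hc, h1, h2, h3, h4⟩, hv⟩
    simp [h1] at hv
    subst hv
    cases hc
    refine ⟨hfr ▸ hf, ?_⟩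
    rwa [strOf_congr fun a ha => h4 a (by omega)] at h3
end
end ScanSort

namespace ScanSort
open ScanModel

/-! ## One block of the text -/

/-- The characters of a block, each followed by the bit that says whether the rest of the text
exceeds the text after the block. -/
theorem slt_of_slt_block {τ S : ℕ → ℕ} {n a L : ℕ} {e : ℕ → ℕ} (hτ : IsStr τ n)
    (hLn : a + L ≤ n) (hS : ∀ i < L, S i + 1 = 2 * τ (a + i) + e i)
    (he : ∀ i < L, e i ≤ 1) (he1 : ∀ i < L, e i = 1 ↔ i + 1 = L ∨ slt τ (a + L) (a + i + 1)) :
    ∀ i j, i < L → j < L → slt τ (a + i) (a + j) → slt (strOf S 0 L) i j := by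
  intro i
  induction hk : L - i using Nat.strong_induction_on generalizing i with
  | _ k ih =>
    intro j hi hj h
    have y1 : strOf S 0 L i = S i := by simp [strOf, hi]
    have y2 : strOf S 0 L j = S j := by simp [strOf, hj]
    have s1 := hS i hi
    have s2 := hS j hj
    have e1 := he i hi
    have e2 := he j hj
    have q1 := he1 i hi
    have q2 := he1 j hj
    have t1 := hτ (a + i)
    have t2 := hτ (a + j)
    have hij : i ≠ j := fun hh => slt_irrefl _ _ (hh ▸ h)
    rw [slt_iff, y1, y2]
    rcases (slt_iff _ _ _).1 h with h | ⟨h0, h⟩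
    · exact .inl (by omega)
    -- What follows `i` is the suffix at `a + L`, which precedes what follows `j`; so both bits are
    -- `1` and the new characters agree. Then the block string ends behind `i` but not behind `j`.
    · by_cases hi' : i + 1 = L
      · have e3 : e i = 1 := q1.2 (.inl hi')
        rw [show a + i + 1 = a + L by omega] at h
        have e4 : e j = 1 := q2.2 (.inr h)
        refine .inr ⟨by omega, 0, by simp, ?_⟩
        have s3 := hS (j + 1) (by omega)
        have t3 := hτ (a + (j + 1))
        have : j + 1 < L := by omega
        simp [strOf, hi', this]
        omega
      -- What follows `i` precedes the suffix at `a + L`, so the bit of `i` is `0`, and the bit of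
      -- the last position is `1`.
      · by_cases hj' : j + 1 = L
        · rw [show a + j + 1 = a + L by omega] at h
          have := slt_asymm h
          simp only [hi', this, or_self, iff_false] at q1
          simp only [hj', true_or, iff_true] at q2
          exact .inl (by omega)
        -- Bits are monotone in the suffixes that follow. If they differ, they decide correctly; if
        -- they agree, the induction hypothesis applies to what follows.
        · have hle : e i = 1 → e j = 1 := fun hh =>
            q2.2 (.inr (slt_trans ((q1.1 hh).resolve_left hi') h))
          by_cases hee : e i = e j
          · exact .inr ⟨by omega, ih (L - (i + 1)) (by omega) (i + 1) rfl (j + 1) (by omega)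
              (by omega) (by simpa [add_assoc] using h)⟩
          · exact .inl (by omega)

theorem sorted_of_block {τ y : ℕ → ℕ} {n a L : ℕ} (hτ : IsStr τ n) (hLn : a + L ≤ n)
    (hy : ∀ i j, i < L → j < L → slt τ (a + i) (a + j) → slt y i j) {f : ℕ → ℕ}
    (hf : IsSA y L f) : Sorted τ L fun t => a + f t := by
  intro t t' h h'
  have h1 := hf.2 t t' h h'
  have l1 := hf.1 t (h.trans h')
  have l2 := hf.1 t' h'
  have hne : a + f t ≠ a + f t' := fun hh => slt_irrefl y (f t) (by
    rwa [show f t' = f t by omega] at h1)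
  rcases hτ.slt_total hne (by omega) with h2 | h2
  · exact h2
  · exact (slt_asymm h1 (hy _ _ l2 l1 h2)).elim

/-- A downward closed set of indices is an initial segment, and its cardinality is its end. -/
theorem lt_card_filter_of_lower {L : ℕ} {p : ℕ → Prop} [DecidablePred p]
    (hp : ∀ t t', t < t' → t' < L → p t' → p t) {t : ℕ} (ht : t < L) :
    p t ↔ t < ((Finset.range L).filter p).card := by
  constructor
  · intro h
    have : Finset.range (t + 1) ⊆ (Finset.range L).filter p := fun u hu => by
      simp only [Finset.mem_range, Finset.mem_filter] at hu ⊢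
      rcases (by omega : u = t ∨ u < t) with rfl | hut
      · exact ⟨ht, h⟩
      · exact ⟨by omega, hp u t hut ht h⟩
    have := Finset.card_le_card this
    rw [Finset.card_range] at this
    omega
  · intro h
    by_contra hc
    have : (Finset.range L).filter p ⊆ Finset.range t := fun u hu => by
      simp only [Finset.mem_range, Finset.mem_filter] at hu ⊢
      by_contra hh
      rcases (by omega : u = t ∨ t < u) with rfl | hut
      · exact hc hu.2
      · exact hc (hp t u hut hu.1 hu.2)
    have := Finset.card_le_card this
    rw [Finset.card_range] at this
    omega

/-! ### Ranks of suffixes in a block. -/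

open scoped Classical in
/-- Number of suffixes that begin in the block `[a, a + L)` and precede the suffix at `j`. -/
noncomputable def rk (τ : ℕ → ℕ) (a L j : ℕ) : ℕ :=
  ((Finset.range L).filter fun i => slt τ (a + i) j).card

/-- The suffix array of a block. -/
structure BlockSA (τ : ℕ → ℕ) (n a L : ℕ) (f : ℕ → ℕ) : Prop where
  str : IsStr τ n
  le : a + L ≤ n
  lt : ∀ t < L, f t < L
  sorted : Sorted τ L fun t => a + f t

/-- Number of `i < L` with `X i < c`, plus the number of `q < r` for which the character before
position `f q` is `c`. -/
def occ (X f : ℕ → ℕ) (L c r : ℕ) : ℕ :=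
  ((Finset.range L).filter fun i => X i < c).card +
    ((Finset.range r).filter fun q => 1 ≤ f q ∧ X (f q - 1) = c).card

theorem rk_le (τ : ℕ → ℕ) (a L j : ℕ) : rk τ a L j ≤ L := by
  classical
  exact (Finset.card_filter_le _ _).trans (by simp)

section
variable {τ f : ℕ → ℕ} {n a L : ℕ}

theorem BlockSA.ne (h : BlockSA τ n a L f) : ∀ t < L, ∀ t' < L, t ≠ t' → f t ≠ f t' :=
  fun t ht t' ht' hne hh => h.sorted.ne ht ht' hne (by simp [hh])

theorem BlockSA.slt_iff_lt_rk (h : BlockSA τ n a L f) {t : ℕ} (ht : t < L) (j : ℕ) :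
    slt τ (a + f t) j ↔ t < rk τ a L j := by
  classical
  have := lt_card_filter_of_lower (L := L) (p := fun t => slt τ (a + f t) j)
    (fun t t' h1 h2 h3 => slt_trans (h.sorted t t' h1 h2) h3) ht
  rw [this, card_filter_perm h.lt h.ne fun i => slt τ (a + i) j]
  simp only [rk]

theorem rk_end (hτ : IsStr τ n) : rk τ a L n = 0 := by
  classical
  rw [rk, Finset.card_eq_zero, Finset.filter_eq_empty_iff]
  exact fun i _ h => by
    have := hτ.lt_of_slt h
    omega

open scoped Classical in
-- A block suffix precedes the suffix at `j` if its first character is smaller, or if it is equal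
-- and what follows precedes the suffix at `j + 1`. The block suffixes of the latter kind are
-- exactly the first ones in `f`, as many as the rank at `j + 1`, so a table of counts over prefixes
-- of `f` answers the question. Only the last position of the block, whose continuation lies
-- outside, needs the bit at `j + 1`.
theorem BlockSA.rk_step (h : BlockSA τ n a L f) (hL : 0 < L) {X : ℕ → ℕ}
    (hX : ∀ i < L, X i + 1 = τ (a + i)) {j c : ℕ} (hc : c + 1 = τ j) :
    rk τ a L j = occ X f L c (rk τ a L (j + 1)) +
      if c = X (L - 1) ∧ slt τ (a + L) (j + 1) then 1 else 0 := by
  have hr := rk_le τ a L (j + 1)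
  have e1 : rk τ a L j = ((Finset.range L).filter fun i => X i < c).card +
      ((Finset.range L).filter fun i => X i = c ∧ slt τ (a + i + 1) (j + 1)).card := by
    rw [rk, ← Finset.card_union_of_disjoint]
    · congr 1
      ext i
      simp only [Finset.mem_filter, Finset.mem_range, Finset.mem_union, ← and_or_left,
        and_congr_right_iff]
      intro hi
      have := hX i hi
      rw [slt_iff]
      exact or_congr (by omega) (and_congr (by omega) Iff.rfl)
    · rw [Finset.disjoint_filter]
      intro i _ h1 h2
      omega
  -- The last position of the block is split off.
  have e2 : ((Finset.range L).filter fun i => X i = c ∧ slt τ (a + i + 1) (j + 1)).card =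
      ((Finset.range (L - 1)).filter fun i => X i = c ∧ slt τ (a + i + 1) (j + 1)).card +
        if c = X (L - 1) ∧ slt τ (a + L) (j + 1) then 1 else 0 := by
    obtain ⟨k, rfl⟩ : ∃ k, L = k + 1 := ⟨L - 1, by omega⟩
    rw [Finset.range_add_one, Finset.filter_insert, Nat.add_sub_cancel,
      show a + k + 1 = a + (k + 1) by omega]
    by_cases h1 : c = X k ∧ slt τ (a + (k + 1)) (j + 1)
    · rw [if_pos h1, if_pos ⟨h1.1.symm, h1.2⟩, Finset.card_insert_of_notMem (by simp)]
    · rw [if_neg h1, if_neg fun h2 => h1 ⟨h2.1.symm, h2.2⟩, add_zero]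
  -- Shift by one: count the continuations, which begin inside the block, instead of their
  -- predecessors.
  have e3 : ((Finset.range (L - 1)).filter fun i => X i = c ∧ slt τ (a + i + 1) (j + 1)).card =
      ((Finset.range L).filter fun i => 1 ≤ i ∧ X (i - 1) = c ∧ slt τ (a + i) (j + 1)).card := by
    rw [← Finset.card_image_of_injective (f := fun i => i + 1) _ (fun x y h => by simpa using h)]
    congr 1
    ext i
    simp only [Finset.mem_image, Finset.mem_filter, Finset.mem_range]
    constructor
    · rintro ⟨i, ⟨h1, h2, h3⟩, rfl⟩
      exact ⟨by omega, by omega, by simpa using h2, by simpa [add_assoc] using h3⟩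
    · rintro ⟨h1, h2, h3, h4⟩
      exact ⟨i - 1, ⟨by omega, h3, by rwa [show a + (i - 1) + 1 = a + i by omega]⟩, by omega⟩
  -- In the order of `f` the continuations that precede the suffix at `j + 1` form a prefix.
  have e4 : ((Finset.range L).filter fun q => 1 ≤ f q ∧ X (f q - 1) = c ∧
      slt τ (a + f q) (j + 1)) =
      (Finset.range (rk τ a L (j + 1))).filter fun q => 1 ≤ f q ∧ X (f q - 1) = c := by
    ext q
    simp only [Finset.mem_filter, Finset.mem_range]
    constructor
    · rintro ⟨h1, h2, h3, h4⟩
      exact ⟨(h.slt_iff_lt_rk h1 _).1 h4, h2, h3⟩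
    · rintro ⟨h1, h2, h3⟩
      have h4 : q < L := by omega
      exact ⟨h4, h2, h3, (h.slt_iff_lt_rk h4 _).2 h1⟩
  rw [e1, e2, e3, ← card_filter_perm h.lt h.ne
    (fun i => 1 ≤ i ∧ X (i - 1) = c ∧ slt τ (a + i) (j + 1)), occ, e4, add_assoc]

/-! ## Merging a block with the sorted suffixes behind it -/

/-- `g` lists the suffixes that begin at or after `b` in increasing order. -/
structure TailSA (τ : ℕ → ℕ) (n b : ℕ) (g : ℕ → ℕ) : Prop where
  ge : ∀ q < n - b, b ≤ g q
  lt : ∀ q < n - b, g q < n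
  sorted : Sorted τ (n - b) g

/-- State of the merge after the suffixes `f 0, …, f (r - 1)` of the block and
`g 0, …, g (q - 1)`. -/
structure Merged (τ : ℕ → ℕ) (n a L : ℕ) (f g : ℕ → ℕ) (r q : ℕ) (out gap : ℕ → ℕ) : Prop where
  rle : r ≤ L
  qle : q ≤ n - (a + L)
  rank : ∀ q', q ≤ q' → q' < n - (a + L) → r ≤ rk τ a L (g q')
  gap : ∀ r', r ≤ r' → r' ≤ L →
    gap r' = ((Finset.Ico q (n - (a + L))).filter fun q' => rk τ a L (g q') = r').card
  ge : ∀ t < r + q, a ≤ out t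
  lt : ∀ t < r + q, out t < n
  sorted : Sorted τ (r + q) out
  ltf : ∀ t < r + q, ∀ r', r ≤ r' → r' < L → slt τ (out t) (a + f r')
  ltg : ∀ t < r + q, ∀ q', q ≤ q' → q' < n - (a + L) → slt τ (out t) (g q')

variable {g : ℕ → ℕ} {r q : ℕ} {out gap : ℕ → ℕ}

/-- The counts are taken over text positions, whereas the merge runs over indices in `g`. Both agree
because `g` consists of `n - (a + L)` distinct positions of the tail, hence of all of them. -/
theorem Merged.start (hg : TailSA τ n (a + L) g) (hgap : ∀ r ≤ L, gap r =
      ((Finset.Ico (a + L) n).filter fun x => rk τ a L x = r).card) :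
    Merged τ n a L f g 0 0 out gap := by
  refine ⟨by omega, by omega, by omega, fun r' _ hr' => ?_, by omega, by omega, ?_, by omega,
    by omega⟩
  · have h1 : ∀ t < n - (a + L), g t - (a + L) < n - (a + L) := fun t ht => by
      have := hg.ge t ht
      have := hg.lt t ht
      omega
    have h2 : ∀ t < n - (a + L), ∀ t' < n - (a + L), t ≠ t' → g t - (a + L) ≠ g t' - (a + L) :=
      fun t ht t' ht' hne hh => by
        have := hg.ge t ht
        have := hg.ge t' ht'
        exact hg.sorted.ne ht ht' hne (by omega)
    have h3 := card_filter_perm h1 h2 fun x => rk τ a L (a + L + x) = r'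
    rw [hgap r' hr', ← Finset.range_eq_Ico]
    have e1 : ((Finset.range (n - (a + L))).filter fun t => rk τ a L (g t) = r') =
        (Finset.range (n - (a + L))).filter fun t => rk τ a L (a + L + (g t - (a + L))) = r' := by
      refine Finset.filter_congr fun t ht => ?_
      have := hg.ge t (Finset.mem_range.1 ht)
      rw [Nat.add_sub_cancel' this]
    rw [e1, h3]
    symm
    rw [← Finset.card_image_of_injective (f := fun x => a + L + x) _
      (fun x y h => by simpa using h)]
    congr 1
    ext x
    simp only [Finset.mem_image, Finset.mem_filter, Finset.mem_range, Finset.mem_Ico]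
    constructor
    · rintro ⟨x, ⟨h4, h5⟩, rfl⟩
      exact ⟨⟨by omega, by omega⟩, h5⟩
    · rintro ⟨⟨h4, h5⟩, h6⟩
      exact ⟨x - (a + L), ⟨by omega, by rwa [Nat.add_sub_cancel' h4]⟩, by omega⟩
  · intro t t' h h'
    omega

/-- Once the block is exhausted, every remaining tail suffix has the maximal rank `L` and is counted
in `gap L`. -/
theorem Merged.gap_pos (h : Merged τ n a L f g r q out gap)
    (hx : r + q < n - a) (hL : a + L ≤ n) : 0 < gap r ∨ r < L := by
  by_contra! hc
  have h1 := h.rle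
  have h2 := h.rank q le_rfl (by omega)
  have h3 := rk_le τ a L (g q)
  have h4 := h.gap r le_rfl h1
  rw [show gap r = 0 by omega, eq_comm, Finset.card_eq_zero, Finset.filter_eq_empty_iff] at h4
  exact h4 (Finset.mem_Ico.2 ⟨le_rfl, by omega⟩ : q ∈ Finset.Ico q (n - (a + L))) (by omega)

theorem TailSA.rk_mono (hg : TailSA τ n (a + L) g) {q q' : ℕ}
    (h : q ≤ q') (h' : q' < n - (a + L)) : rk τ a L (g q) ≤ rk τ a L (g q') := by
  rcases h.eq_or_lt with rfl | h
  · exact le_rfl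
  · classical
    refine Finset.card_le_card fun i hi => ?_
    simp only [Finset.mem_filter] at hi ⊢
    exact ⟨hi.1, slt_trans hi.2 (hg.sorted _ _ h h')⟩

theorem Sorted.update {s out : ℕ → ℕ} {N v : ℕ} (h : Sorted s N out)
    (hv : ∀ t < N, slt s (out t) v) : Sorted s (N + 1) (Function.update out N v) := by
  intro t t' h1 h2
  rw [Function.update_of_ne (by omega)]
  by_cases ht : t' = N
  · rw [ht, Function.update_self]
    exact hv t (by omega)
  · rw [Function.update_of_ne ht]
    exact h t t' h1 (by omega)

/-- Ranks increase along `g`, so if any remaining tail suffix has rank `r`, the next one has. It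
then precedes all remaining block suffixes. -/
theorem Merged.stepg (h : Merged τ n a L f g r q out gap) (hf : BlockSA τ n a L f)
    (hg : TailSA τ n (a + L) g) (hr : 0 < gap r) :
    q < n - (a + L) ∧ Merged τ n a L f g r (q + 1) (Function.update out (r + q) (g q))
      (Function.update gap r (gap r - 1)) := by
  have h4 := h.gap r le_rfl h.rle
  obtain ⟨q', hq'⟩ : ((Finset.Ico q (n - (a + L))).filter fun q' => rk τ a L (g q') = r).Nonempty := by
    rw [← Finset.card_pos]
    omega
  simp only [Finset.mem_filter, Finset.mem_Ico] at hq'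
  have hq : q < n - (a + L) := by omega
  have hrk : rk τ a L (g q) = r := le_antisymm
    (hq'.2 ▸ hg.rk_mono hq'.1.1 hq'.1.2) (h.rank q le_rfl hq)
  have hins : Finset.Ico q (n - (a + L)) = insert q (Finset.Ico (q + 1) (n - (a + L))) :=
    (Finset.insert_Ico_add_one_left_eq_Ico hq).symm
  refine ⟨hq, h.rle, hq, fun q' h1 h2 => h.rank q' (by omega) h2, fun r' h1 h2 => ?_,
    fun t ht => ?_, fun t ht => ?_, ?_, fun t ht r' h1 h2 => ?_, fun t ht q' h1 h2 => ?_⟩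
  · have h3 := h.gap r' h1 h2
    rw [hins, Finset.filter_insert] at h3
    by_cases hrr : r' = r
    · subst hrr
      rw [if_pos hrk, Finset.card_insert_of_notMem (by simp)] at h3
      simp [h3]
    · rw [if_neg (by omega)] at h3
      rw [Function.update_of_ne hrr, h3]
  · by_cases htt : t = r + q
    · rw [htt, Function.update_self]
      have := hg.ge q hq
      omega
    · rw [Function.update_of_ne htt]
      exact h.ge t (by omega)
  · by_cases htt : t = r + q
    · rw [htt, Function.update_self]
      exact hg.lt q hq
    · rw [Function.update_of_ne htt]
      exact h.lt t (by omega)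
  · exact h.sorted.update fun t ht => h.ltg t ht q le_rfl hq
  · by_cases htt : t = r + q
    · rw [htt, Function.update_self]
      have e1 := hf.slt_iff_lt_rk h2 (g q)
      rw [hrk] at e1
      have e2 := hf.lt r' h2
      have e3 := hg.ge q hq
      exact (hf.str.slt_total (by omega) (hg.lt q hq)).resolve_right fun hh => by
        have := e1.1 hh
        omega
    · rw [Function.update_of_ne htt]
      exact h.ltf t (by omega) r' h1 h2
  · by_cases htt : t = r + q
    · rw [htt, Function.update_self]
      exact hg.sorted q q' (by omega) h2
    · rw [Function.update_of_ne htt]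
      exact h.ltg t (by omega) q' (by omega) h2

/-- If no remaining tail suffix has rank `r`, all of them have a larger rank, which says that block
suffix `r` precedes them. -/
theorem Merged.stepf (h : Merged τ n a L f g r q out gap) (hf : BlockSA τ n a L f)
    (hr : gap r = 0) (hrL : r < L) :
    Merged τ n a L f g (r + 1) q (Function.update out (r + q) (a + f r)) gap := by
  have h4 := h.gap r le_rfl h.rle
  rw [hr, eq_comm, Finset.card_eq_zero, Finset.filter_eq_empty_iff] at h4
  have hrank : ∀ q', q ≤ q' → q' < n - (a + L) → r + 1 ≤ rk τ a L (g q') := fun q' h1 h2 => by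
    have := h4 (Finset.mem_Ico.2 ⟨h1, h2⟩)
    have := h.rank q' h1 h2
    omega
  have hfr := hf.lt r hrL
  have hle := hf.le
  have e : r + 1 + q = r + q + 1 := by omega
  refine ⟨hrL, h.qle, hrank, fun r' h1 h2 => h.gap r' (by omega) h2,
    fun t ht => ?_, fun t ht => ?_, ?_, fun t ht r' h1 h2 => ?_, fun t ht q' h1 h2 => ?_⟩
  · by_cases htt : t = r + q
    · rw [htt, Function.update_self]
      omega
    · rw [Function.update_of_ne htt]
      exact h.ge t (by omega)
  · by_cases htt : t = r + q
    · rw [htt, Function.update_self]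
      omega
    · rw [Function.update_of_ne htt]
      exact h.lt t (by omega)
  · rw [e]
    exact h.sorted.update fun t ht => h.ltf t ht r le_rfl hrL
  · by_cases htt : t = r + q
    · rw [htt, Function.update_self]
      exact hf.sorted r r' (by omega) h2
    · rw [Function.update_of_ne htt]
      exact h.ltf t (by omega) r' (by omega) h2
  · by_cases htt : t = r + q
    · rw [htt, Function.update_self]
      exact (hf.slt_iff_lt_rk hrL _).2 (hrank q' h1 h2)
    · rw [Function.update_of_ne htt]
      exact h.ltg t (by omega) q' h1 h2

theorem Merged.finish (h : Merged τ n a L f g r q out gap) (hx : r + q = n - a) :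
    TailSA τ n a out :=
  ⟨fun t ht => h.ge t (by omega), fun t ht => h.lt t (by omega), hx ▸ h.sorted⟩

end
end ScanSort

namespace ScanSort
open ScanModel

/-! ## Preparation of a block in the internal memory -/

theorem card_filter_range_succ (p : ℕ → Prop) [DecidablePred p] (i : ℕ) :
    ((Finset.range (i + 1)).filter p).card =
      ((Finset.range i).filter p).card + if p i then 1 else 0 := by
  rw [Finset.card_filter, Finset.sum_range_succ, ← Finset.card_filter]

theorem Fits.two_mul_le {C : Cfg} {m : Machine} (hF : Fits C m) : 78 + 2 * C.σ ≤ C.W := by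
  have h := hF.small
  have : (rowBase + C.σ) * 2 ≤ (rowBase + C.σ) * C.I := Nat.mul_le_mul_left _ hF.pos
  simp only [rowBase] at *
  omega

/-- The string that is sorted for a block. -/
def buildS : HC :=
  .set .aG Row.vL.v 0 ;;
  forUp .vi Row.vL.v
    (.set .aS Row.vi.v (2 * .cell .aX Row.vi.v + 2 - .cell .aG (Row.vi.v + 1))) ;;
  (.set .aS Row.vL.v 0 ;; .set .aS (Row.vL.v + 1) 0 ;; .set .aS (Row.vL.v + 2) 0)

def countLess : HC :=
  .setz Row.vc.v 0 0 ;;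
  forUp .vi Row.vL.v
    (.setz Row.vc.v 0 (.zc Row.vc.v 0 + .lt (.cell .aX Row.vi.v) Row.vc.v))

/-- If an entry of the suffix array is `0`, the cut-off subtraction reads an irrelevant cell, but
the first factor vanishes. -/
def countOcc : HC :=
  forUp .vi Row.vL.v
    (.setz Row.vc.v (Row.vi.v + 1) (.zc Row.vc.v Row.vi.v + .lt 0 (.cell .aSA Row.vi.v) *
      .eq (.cell .aX (.cell .aSA Row.vi.v - 1)) Row.vc.v))

/-- The tables from which the ranks of the suffixes are computed. -/
def tables (σ : ℕ) : HC :=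
  forUp .vc (.lit σ) (countLess ;; countOcc) ;;
  forUp .vi Row.vL.v (.set .agap Row.vi.v 0 ;;
    .ite (.eq (.cell .aSA Row.vi.v) 0) (.asg .vpa Row.vi.v) .skip) ;;
  (.set .agap Row.vL.v 0 ;; .asg .vR 0 ;; .asg .vg 1)

def prepare (σ : ℕ) : HC := buildS ;; sufSort (2 * σ + 3) ;; tables σ

def zRows (σ : ℕ) : List Row := .vi :: .vc :: (List.range σ).map Row.z

def prepRows (σ : ℕ) : List Row :=
  [.aG, .aS, .agap, .vpa, .vR, .vg] ++ zRows σ ++ (descendRows ++ ascendRows)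

section
variable {C : Cfg} {m : Machine} {μ : Mem}

/-- Bits are stored negated: `0` means that the suffix exceeds the one at the end of the block. With
`e = 1 - G` the character is `2 * τ + e - 1`, as `slt_of_slt_block` requires, and the `0` stored
behind the bits gives the last character `e = 1`. -/
theorem buildS_run (hF : Fits C m) {L : ℕ} (hL : μ .vL 0 = L) (hX : ∀ i < L, μ .aX i < C.σ)
    (hI : L + 3 < C.I) :
    MRun C m buildS μ (300 * (L + 1)) fun μ' => Frame [.aG, .aS, .vi] μ μ' ∧
      (∀ i < L, μ' .aS i = 2 * μ .aX i + 2 - if i + 1 = L then 0 else μ .aG (i + 1)) ∧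
      ∀ d < 3, μ' .aS (L + d) = 0 := by
  have hW := hF.mul_I_le
  have hσ := hF.two_mul_le
  have r1 : MRun C m (.set .aG Row.vL.v 0) μ 20 fun μ' => Frame [.aG] μ μ' ∧
      μ' .aG = Function.update (μ .aG) L 0 := by
    refine (MRun.of_wp hF ?_).mono (Nat.le_of_ble_eq_true rfl) (fun _ h => h)
    intro x D
    simp [wp, Row.Valid, Frame.refl, hL]
    omega
  refine (r1.bind (t' := 280 * (L + 1)) ?_).mono (by omega) fun _ h => h
  rintro μ1 ⟨f1, a1⟩
  refine ((MRun.forUp hF (r := .vi) trivial (N := L) (t := 100) (by omega) (fun i μ' =>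
    Frame [.aG, .aS, .vi] μ μ' ∧ μ' .aG = Function.update (μ .aG) L 0 ∧ μ' .vi 0 = i ∧
    (∀ u < i, μ' .aS u = 2 * μ .aX u + 2 - if u + 1 = L then 0 else μ .aG (u + 1)))
      ⟨?_, ?_, ?_, ?_⟩ ?_ ?_).bind (t' := 100) ?_).mono ?_ fun _ h => h
  · exact (f1.mono (by simp)).set (by simp) _ _
  · simpa using a1
  · simp
  · simp
  · rintro i μ' hi ⟨h1, h2, h3, h4⟩
    simp [Row.Valid, h3, h1 .vL (by simp), hL]
    omega
  · rintro i μ' hi ⟨h1, h2, h3, h4⟩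
    refine (MRun.of_wp hF ?_).mono (Nat.le_of_ble_eq_true rfl) (fun _ h => h)
    intro x D
    have hx := hX i hi
    simp [wp, Row.Valid, h1, h2, h3, h1 .aX]
    and_intros
    all_goals try omega
    intro u hu
    by_cases hui : u = i
    · subst hui
      rw [Function.update_self, Function.update_apply]
    · rw [Function.update_of_ne hui, h4 u (by omega)]
  · rintro μ2 ⟨h1, h2, h3, h4⟩
    refine (MRun.of_wp hF ?_).mono (Nat.le_of_ble_eq_true rfl) (fun _ h => h)
    intro x D
    simp [wp, Row.Valid, h1, h1 .vL (by simp), hL]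
    and_intros
    all_goals try omega
    · intro i hi
      rw [Function.update_of_ne (by omega), Function.update_of_ne (by omega),
        Function.update_of_ne (by omega), h4 i hi]
    · intro d hd
      interval_cases d <;> simp
  · simp only [HE.cost]
    omega

theorem countLess_run (hF : Fits C m) {L c : ℕ} (hL : μ .vL 0 = L) (hc : μ .vc 0 = c)
    (hcσ : c < C.σ) (hI : L + 1 < C.I) :
    MRun C m countLess μ (200 * (L + 1)) fun μ' => Frame [.z c, .vi] μ μ' ∧
      μ' (.z c) 0 = ((Finset.range L).filter fun i => μ .aX i < c).card := by
  have hW := hF.mul_I_le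
  have hσ := hF.two_mul_le
  have r1 : MRun C m (.setz Row.vc.v 0 0) μ 20 fun μ' => Frame [.z c] μ μ' ∧ μ' (.z c) 0 = 0 := by
    refine (MRun.of_wp hF ?_).mono (Nat.le_of_ble_eq_true rfl) (fun _ h => h)
    intro x D
    simp [wp, Row.Valid, Frame.refl, hc]
    omega
  refine (r1.bind (t' := 180 * (L + 1)) ?_).mono (by omega) fun _ h => h
  rintro μ1 ⟨f1, a1⟩
  refine (MRun.forUp hF (r := .vi) trivial (N := L) (t := 100) (by omega) (fun i μ' =>
    Frame [.z c, .vi] μ μ' ∧ μ' .vi 0 = i ∧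
    μ' (.z c) 0 = ((Finset.range i).filter fun i => μ .aX i < c).card)
      ⟨?_, ?_, ?_⟩ ?_ ?_).mono ?_ ?_
  · exact (f1.mono (by simp)).set (by simp) _ _
  · simp
  · simpa using a1
  · rintro i μ' hi ⟨h1, h2, h3⟩
    simp [Row.Valid, h2, h1 .vL (by simp), hL]
    omega
  · rintro i μ' hi ⟨h1, h2, h3⟩
    refine (MRun.of_wp hF ?_).mono (Nat.le_of_ble_eq_true rfl) (fun _ h => h)
    intro x D
    have e1 : μ' .vc 0 = c := by rw [h1 _ (by simp), hc]
    have e2 : ((Finset.range i).filter fun i => μ .aX i < c).card ≤ i :=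
      (Finset.card_filter_le _ _).trans (by simp)
    simp [wp, Row.Valid, h1, h2, h3, h1 .aX, e1, card_filter_range_succ]
    split_ifs <;> omega
  · simp only [HE.cost]
    omega
  · rintro μ' ⟨h1, h2, h3⟩
    exact ⟨h1, h3⟩

theorem countOcc_run (hF : Fits C m) {L c : ℕ} (hL : μ .vL 0 = L) (hc : μ .vc 0 = c)
    (hcσ : c < C.σ) (hI : 2 * L + 1 < C.I) (hS : ∀ t < L, μ .aSA t < L)
    (h0 : μ (.z c) 0 = ((Finset.range L).filter fun i => μ .aX i < c).card) :
    MRun C m countOcc μ (200 * (L + 1)) fun μ' => Frame [.z c, .vi] μ μ' ∧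
      ∀ r ≤ L, μ' (.z c) r = occ (μ .aX) (μ .aSA) L c r := by
  have hW := hF.mul_I_le
  have hσ := hF.two_mul_le
  refine (MRun.forUp hF (r := .vi) trivial (N := L) (t := 100) (by omega) (fun i μ' =>
    Frame [.z c, .vi] μ μ' ∧ μ' .vi 0 = i ∧
    ∀ r ≤ i, μ' (.z c) r = occ (μ .aX) (μ .aSA) L c r)
      ⟨?_, ?_, ?_⟩ ?_ ?_).mono ?_ ?_
  · exact (Frame.refl _ _).set (by simp) _ _
  · simp
  · intro r hr
    obtain rfl : r = 0 := by omega
    simp [occ, h0]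
  · rintro i μ' hi ⟨h1, h2, h3⟩
    simp [Row.Valid, h2, h1 .vL (by simp), hL]
    omega
  · rintro i μ' hi ⟨h1, h2, h3⟩
    refine (MRun.of_wp hF ?_).mono (Nat.le_of_ble_eq_true rfl) (fun _ h => h)
    intro x D
    have e1 : μ' .vc 0 = c := by rw [h1 _ (by simp), hc]
    have e2 : occ (μ .aX) (μ .aSA) L c i ≤ L + i :=
      Nat.add_le_add ((Finset.card_filter_le _ _).trans (by simp))
        ((Finset.card_filter_le _ _).trans (by simp))
    have e3 := h3 i le_rfl
    have e4 := hS i hi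
    have e5 : ∀ P Q : Prop, [Decidable P] → [Decidable Q] →
        (if P then 1 else 0) * (if Q then 1 else 0) ≤ 1 := fun P Q _ _ => by
      split_ifs <;> omega
    simp [wp, Row.Valid, h1, h2, e3, h1 .aX, h1 .aSA, e1]
    and_intros
    all_goals try omega
    all_goals try (split_ifs <;> omega)
    intro r hr
    by_cases hri : r = i + 1
    · subst hri
      rw [Function.update_self, occ, occ, card_filter_range_succ, add_assoc]
      congr 2
      by_cases hpos : 1 ≤ μ .aSA i
      · simp [hpos, show 0 < μ .aSA i by omega]
      · simp [hpos, show ¬ 0 < μ .aSA i by omega]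
    · rw [Function.update_of_ne hri, h3 r (by omega)]
  · simp only [HE.cost]
    omega
  · rintro μ' ⟨h1, h2, h3⟩
    exact ⟨h1, h3⟩

theorem zRows_not {σ : ℕ} {r : Row} (h : ∀ c, r ≠ .z c) (h1 : r ≠ .vi) (h2 : r ≠ .vc) :
    r ∉ zRows σ := by
  simp only [zRows, List.mem_cons, List.mem_map, not_or]
  exact ⟨h1, h2, fun ⟨c, _, hc⟩ => h c hc.symm⟩

theorem tables_run (hF : Fits C m) {L : ℕ} (hL : μ .vL 0 = L) (hL0 : 0 < L)
    (hI : 2 * L + C.σ + 1 < C.I) (hS : ∀ t < L, μ .aSA t < L)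
    (hinj : ∀ t < L, ∀ t' < L, t ≠ t' → μ .aSA t ≠ μ .aSA t') :
    MRun C m (tables C.σ) μ (1000 * (C.σ + 1) * (L + 1)) fun μ' =>
      Frame ([.agap, .vpa, .vR, .vg] ++ zRows C.σ) μ μ' ∧
      (∀ c < C.σ, ∀ r ≤ L, μ' (.z c) r = occ (μ .aX) (μ .aSA) L c r) ∧
      (∀ r ≤ L, μ' .agap r = 0) ∧ μ' .vpa 0 < L ∧ μ .aSA (μ' .vpa 0) = 0 ∧
      μ' .vR 0 = 0 ∧ μ' .vg 0 = 1 := by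
  have hW := hF.mul_I_le
  have hσ := hF.two_mul_le
  have r1 : MRun C m (forUp .vc (.lit C.σ) (countLess ;; countOcc)) μ
      (500 * C.σ * (L + 1) + 30) fun μ' => Frame (zRows C.σ) μ μ' ∧
      (∀ c < C.σ, ∀ r ≤ L, μ' (.z c) r = occ (μ .aX) (μ .aSA) L c r) := by
    refine (MRun.forUp hF (r := .vc) trivial (N := C.σ) (t := 400 * (L + 1)) (by omega)
      (fun i μ' => Frame (zRows C.σ) μ μ' ∧ μ' .vc 0 = i ∧
        ∀ c < i, ∀ r ≤ L, μ' (.z c) r = occ (μ .aX) (μ .aSA) L c r) ⟨?_, ?_, ?_⟩ ?_ ?_).mono ?_ ?_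
    · exact (Frame.refl _ _).set (by simp [zRows]) _ _
    · simp
    · simp
    · rintro i μ' hi ⟨h1, h2, h3⟩
      simp [h2]
      omega
    · rintro i μ' hi ⟨h1, h2, h3⟩
      have hmem : ∀ r ∈ [Row.z i, .vi], r ∈ zRows C.σ := by simp [zRows, hi]
      have eL : μ' .vL 0 = L := by rw [h1 _ (zRows_not (by simp) (by simp) (by simp)), hL]
      have eX : μ' .aX = μ .aX := h1 _ (zRows_not (by simp) (by simp) (by simp))
      have eA : μ' .aSA = μ .aSA := h1 _ (zRows_not (by simp) (by simp) (by simp))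
      refine ((countLess_run hF eL h2 hi (by omega)).bind (t' := 200 * (L + 1)) ?_).mono (by omega)
        fun _ h => h
      rintro μ2 ⟨k1, k2⟩
      have eX2 : μ2 .aX = μ .aX := (k1 _ (by simp)).trans eX
      have eA2 : μ2 .aSA = μ .aSA := (k1 _ (by simp)).trans eA
      refine (countOcc_run hF (by rw [k1 _ (by simp), eL]) (by rw [k1 _ (by simp), h2]) hi
        (by omega) (by rwa [eA2]) (by rw [k2, eX, eX2])).mono le_rfl ?_
      rintro μ3 ⟨k3, k4⟩
      rw [eX2, eA2] at k4
      refine ⟨by rw [k3 _ (by simp), k1 _ (by simp), h2],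
        ((h1.trans k1 hmem).trans k3 hmem).set (by simp [zRows]) _ _, by simp, fun c hc r hr => ?_⟩
      rw [Mem.set_of_ne _ (by simp)]
      by_cases hci : c = i
      · rw [hci, k4 r hr]
      · rw [k3 _ (by simpa using hci), k1 _ (by simpa using hci), h3 c (by omega) r hr]
    · simp only [HE.cost]
      nlinarith
    · rintro μ' ⟨h1, h2, h3⟩
      exact ⟨h1, h3⟩
  refine (r1.bind (t' := 400 * (L + 1) + 100) ?_).mono (by nlinarith) fun _ h => h
  rintro μ1 ⟨f1, a1⟩
  obtain ⟨fr, hfr⟩ : ∃ fr, fr = [.agap, .vpa, .vR, .vg] ++ zRows C.σ := ⟨_, rfl⟩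
  -- `vpa` is to hold this index, the rank in the block of the suffix at `a`; the new bits are
  -- obtained by comparison with it.
  obtain ⟨t0, ht0, hz⟩ := exists_index hS hinj hL0
  have mi : Row.vi ∈ fr := by simp [hfr, zRows]
  have mg : Row.agap ∈ fr := by simp [hfr]
  have mp : Row.vpa ∈ fr := by simp [hfr]
  have mR : Row.vR ∈ fr := by simp [hfr]
  have mG : Row.vg ∈ fr := by simp [hfr]
  have g1 : Frame fr μ μ1 := f1.mono (by rw [hfr]; exact fun r hr => List.mem_append_right _ hr)
  have nL : Row.vL ∉ fr := by
    rw [hfr, List.mem_append, not_or]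
    exact ⟨by simp, zRows_not (by simp) (by simp) (by simp)⟩
  have nA : Row.aSA ∉ fr := by
    rw [hfr, List.mem_append, not_or]
    exact ⟨by simp, zRows_not (by simp) (by simp) (by simp)⟩
  rw [← hfr]
  clear f1 r1
  refine ((MRun.forUp hF (r := .vi) trivial (N := L) (t := 100) (by omega) (fun i μ' =>
    Frame fr μ μ' ∧ μ' .vi 0 = i ∧
    (∀ c < C.σ, ∀ r ≤ L, μ' (.z c) r = occ (μ .aX) (μ .aSA) L c r) ∧ (∀ r < i, μ' .agap r = 0) ∧
      (t0 < i → μ' .vpa 0 = t0))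
      ⟨?_, ?_, ?_, ?_, ?_⟩ ?_ ?_).bind (t' := 50) ?_).mono ?_ fun _ h => h
  · exact g1.set mi _ _
  · simp
  · simpa using a1
  · simp
  · simp
  · rintro i μ' hi ⟨h1, h2, -⟩
    simp [Row.Valid, h2, h1 _ nL, hL]
    omega
  · rintro i μ' hi ⟨h1, h2, h3, h4, h5⟩
    refine (MRun.of_wp hF ?_).mono (Nat.le_of_ble_eq_true rfl) (fun _ h => h)
    intro x D
    have e1 := hinj i hi t0 ht0
    have e3 : ∀ r ≤ i, Function.update (μ' .agap) i 0 r = 0 := fun r hr => by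
      by_cases hri : r = i
      · rw [hri, Function.update_self]
      · rw [Function.update_of_ne hri, h4 r (by omega)]
    simp [wp, Row.Valid, h1, h2, h1 _ nA, mi, mg, mp]
    and_intros
    all_goals try omega
    · intro hi0
      and_intros
      all_goals omega
    · intro hi0
      refine ⟨h3, e3, fun hh => h5 ?_⟩
      by_contra hne
      obtain rfl : t0 = i := by omega
      exact hi0 hz
  · rintro μ2 ⟨h1, h2, h3, h4, h5⟩
    refine (MRun.of_wp hF ?_).mono (Nat.le_of_ble_eq_true rfl) (fun _ h => h)
    intro x D
    simp [wp, Row.Valid, h1, h1 _ nL, hL, mg, mR, mG, h5 ht0]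
    and_intros
    all_goals first | omega | exact h3 | skip
    · intro r hr
      by_cases hri : r = L
      · rw [hri, Function.update_self]
      · rw [Function.update_of_ne hri, h4 r (by omega)]
  · simp only [HE.cost]
    omega

theorem prepRows_not {σ : ℕ} {r : Row} (h : r ∈ [Row.vn, .vM, .vB, .vx, .va, .vb, .vL, .aX]) :
    r ∉ prepRows σ := by
  simp only [prepRows, List.mem_append, not_or]
  refine ⟨⟨?_, zRows_not ?_ ?_ ?_⟩, ?_, ?_⟩ <;>
  · simp only [List.mem_cons, List.not_mem_nil, or_false] at h
    rcases h with rfl | rfl | rfl | rfl | rfl | rfl | rfl | rfl <;> simp [descendRows, ascendRows]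

open scoped Classical in
theorem prepare_run (hF : Fits C m) {τ : ℕ → ℕ} {n a L : ℕ} (hτ : IsStr τ n) (hn : a + L ≤ n)
    (hL : μ .vL 0 = L) (hL0 : 0 < L) (hX : ∀ i < L, μ .aX i + 1 = τ (a + i))
    (hXσ : ∀ i < L, μ .aX i < C.σ)
    (hG : ∀ i < L, μ .aG i = if slt τ (a + L) (a + i) then 0 else 1)
    (hI : 36 * L + 6 * C.σ + 50 ≤ C.I) :
    MRun C m (prepare C.σ) μ (1000000 * (C.σ + 1) * (L + 1)) fun μ' =>
      Frame (prepRows C.σ) μ μ' ∧ BlockSA τ n a L (μ' .aSA) ∧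
      (∀ c < C.σ, ∀ r ≤ L, μ' (.z c) r = occ (μ .aX) (μ' .aSA) L c r) ∧
      (∀ r ≤ L, μ' .agap r = 0) ∧ μ' .vpa 0 < L ∧ μ' .aSA (μ' .vpa 0) = 0 ∧
      μ' .vR 0 = 0 ∧ μ' .vg 0 = 1 := by
  refine ((buildS_run hF hL hXσ (by omega)).bind (t' := 900000 * (C.σ + 1) * (L + 1)) ?_).mono
    (by nlinarith) fun _ h => h
  rintro μ1 ⟨f1, a1, a2⟩
  -- The new characters lie between `1` and `2 * σ`.
  have hlev : LevelAt (μ1 .aS) (2 * C.σ + 3) 0 L := by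
    refine ⟨hL0, fun i hi => ?_, fun d hd => by simpa using a2 d hd⟩
    have h1 := a1 i hi
    have h2 := hXσ i hi
    rw [zero_add, h1]
    split_ifs with h3
    · omega
    · rw [hG _ (by omega)]
      split_ifs <;> omega
  have hord := slt_of_slt_block (S := μ1 .aS) (e := fun i =>
      if i + 1 = L ∨ slt τ (a + L) (a + i + 1) then 1 else 0) hτ hn (fun i hi => by
        have h1 := a1 i hi
        have h2 := hX i hi
        by_cases h3 : i + 1 = L
        · rw [if_pos h3] at h1
          rw [if_pos (.inl h3)]
          omega
        · rw [if_neg h3, hG _ (by omega)] at h1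
          by_cases h4 : slt τ (a + L) (a + i + 1)
          · rw [if_pos (by simpa [add_assoc] using h4)] at h1
            rw [if_pos (.inr h4)]
            omega
          · rw [if_neg (by simpa [add_assoc] using h4)] at h1
            rw [if_neg (by simp [h3, h4])]
            omega)
      (fun i _ => by split_ifs <;> omega)
      (fun i _ => by by_cases h : i + 1 = L ∨ slt τ (a + L) (a + i + 1) <;> simp [h])
  refine ((sufSort_run hF (κ := 2 * C.σ + 3) (by omega) hlev (by rw [f1 _ (by simp), hL])
    (by omega)).bind (t' := 1000 * (C.σ + 1) * (L + 1)) ?_).mono (by nlinarith) fun _ h => h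
  rintro μ2 ⟨f2, a3⟩
  have hSA : BlockSA τ n a L (μ2 .aSA) := ⟨hτ, hn, a3.1, sorted_of_block hτ hn hord a3⟩
  have eX : μ2 .aX = μ .aX := (f2 _ (by simp [descendRows, ascendRows])).trans (f1 _ (by simp))
  refine (tables_run hF (by rw [f2 _ (by simp [descendRows, ascendRows]), f1 _ (by simp), hL]) hL0
    (by omega) hSA.lt hSA.ne).mono le_rfl ?_
  rintro μ3 ⟨f3, k1, k2, k3, k4, k5, k6⟩
  have eA : μ3 .aSA = μ2 .aSA := f3 _ (by
    rw [List.mem_append, not_or]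
    exact ⟨by simp, zRows_not (by simp) (by simp) (by simp)⟩)
  rw [eX] at k1
  refine ⟨((f1.mono ?_).trans f2 fun r hr => List.mem_append_right _ hr).trans f3 fun r hr => ?_,
    by rwa [eA], by rwa [eA], k2, k3, by rwa [eA], k5, k6⟩
  · simp [zRows]
  · rw [List.append_assoc, List.mem_append]
    rw [List.mem_append] at hr
    rw [List.mem_append]
    rcases hr with hr | hr
    · left
      simp at hr ⊢
      tauto
    · exact .inr (.inl hr)

end
end ScanSort

namespace ScanSort
open ScanModel

/-! ## Sweeps over the disks -/

/-- Move the heads of all disks. -/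
def moves (r : Bool) : Cmd :=
  .seq (.atom (.move .input r)) (.seq (.atom (.move .output r)) (.atom (.move .work r)))

/-- Memory, disks and the common position of the heads. -/
structure Sync (C : Cfg) (s : State) (μ : Mem) (D : Contents) (x : ℕ) : Prop where
  rep : Rep C s.mem μ
  disk : s.disk = D
  head : ∀ d, s.head d = x

/-- Number of disks that are not scanned in direction `r`. -/
def pot (r : Bool) (s : State) : ℕ :=
  (if s.right .input = r then 0 else 1) + (if s.right .output = r then 0 else 1) +
    if s.right .work = r then 0 else 1

theorem pot_le (r : Bool) (s : State) : pot r s ≤ 3 := by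
  unfold pot
  split_ifs <;> omega

/-- Total page number of the cells `x`. -/
def pages (m : Machine) (x : ℕ) : ℕ := m.page .input x + m.page .output x + m.page .work x

theorem page_mono (m : Machine) (d : Disk) {x y : ℕ} (h : x ≤ y) : m.page d x ≤ m.page d y :=
  Nat.div_le_div_right h

theorem pages_mono (m : Machine) {x y : ℕ} (h : x ≤ y) : pages m x ≤ pages m y := by
  have h1 := page_mono m .input h
  have h2 := page_mono m .output h
  have h3 := page_mono m .work h
  unfold pages
  omega

/-- Page accesses of a scan in direction `r` up to cell `x`. -/
def scanned (m : Machine) : Bool → ℕ → ℕ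
  | true, x => 2 * pages m x
  | false, x => 2 * (pages m (m.textLen - 1) - pages m x)

theorem scanned_le (m : Machine) (r : Bool) {x : ℕ} (hx : x ≤ m.textLen - 1) :
    scanned m r x ≤ 2 * pages m (m.textLen - 1) := by
  have := pages_mono m hx
  cases r <;> simp only [scanned] <;> omega

/-- The program moves the heads from cell `x` to cell `x'` in direction `r`. -/
def DRun (C : Cfg) (m : Machine) (r : Bool) (p : Cmd) (x x' : ℕ) (μ : Mem) (D : Contents) (t : ℕ)
    (P : Mem → Contents → Prop) : Prop :=
  ∀ s, Sync C s μ D x → ∃ s' μ' D', Exec m p s s' ∧ P μ' D' ∧ Sync C s' μ' D' x' ∧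
    s'.time ≤ s.time + t ∧ s'.passes + pot r s' ≤ s.passes + pot r s ∧
    s'.accesses + scanned m r x ≤ s.accesses + scanned m r x'

section
variable {C : Cfg} {m : Machine} {r : Bool} {p q : Cmd} {e : HE} {x x' x'' : ℕ} {μ : Mem}
  {D : Contents} {t t' k k' l l' : ℕ} {P P' : Mem → Contents → Prop}

theorem BRun.drun {p : HC} (h : BRun C m x p μ D t P) : DRun C m r (p.compile C.σ) x x μ D t P := by
  rintro s ⟨h1, h2, h3⟩
  obtain ⟨s', μ', D', g1, g2, g3, g4, g5, g6, g7, g8, g9⟩ := h s h1 h2 h3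
  exact ⟨s', μ', D', g1, g2, ⟨g3, g4, by simpa [g5] using h3⟩, g9, by simp only [pot, g6, g7]; omega,
    by rw [g8]⟩

theorem DRun.mono (h : DRun C m r p x x' μ D t P) (ht : t ≤ t') (hP : ∀ μ D, P μ D → P' μ D) :
    DRun C m r p x x' μ D t' P' := by
  intro s hs
  obtain ⟨s', μ', D', g1, g2, g3, g4, g5, g6⟩ := h s hs
  exact ⟨s', μ', D', g1, hP _ _ g2, g3, by omega, g5, g6⟩

/-- The potential `pot` and the page counts `scanned` telescope, so consecutive pieces of one sweep
together pay for at most one turn of each disk and for each page boundary once. -/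
theorem DRun.bind {P₁ : Mem → Contents → Prop} (h : DRun C m r p x x' μ D t P₁)
    (h' : ∀ μ D, P₁ μ D → DRun C m r q x' x'' μ D t' P) :
    DRun C m r (.seq p q) x x'' μ D (t + t') P := by
  intro s hs
  obtain ⟨s', μ', D', g1, g2, g3, g4, g5, g6⟩ := h s hs
  obtain ⟨s2, μ2, D2, k1, k2, k3, k4, k5, k6⟩ := h' _ _ g2 s' g3
  exact ⟨s2, μ2, D2, .seq g1 k1, k2, k3, by omega, by omega, by omega⟩

theorem DRun.skip : DRun C m r .skip x x μ D t fun μ' D' => μ' = μ ∧ D' = D :=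
  fun s hs => ⟨s, μ, D, .skip s, ⟨rfl, rfl⟩, hs, by omega, le_rfl, le_rfl⟩

theorem DRun.ite (hF : Fits C m) (he : e.ok C μ) (hp : e.val μ ≠ 0 → DRun C m r p x x' μ D t P)
    (hq : e.val μ = 0 → DRun C m r q x x' μ D t P) :
    DRun C m r (.ite (e.compile C.σ) p q) x x' μ D (t + e.cost + 1) P := by
  intro s hs
  have e2 := e.eval_compile hF hs.rep he
  have hs' : Sync C (s.tick ((e.compile C.σ).cost + 1)) μ D x := ⟨hs.rep, hs.disk, hs.head⟩
  by_cases h0 : e.val μ = 0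
  · obtain ⟨s', μ', D', g1, g2, g3, g4, g5, g6⟩ := hq h0 _ hs'
    refine ⟨s', μ', D', .ite_false (h0 ▸ e2.1) g1, g2, g3, ?_, g5, g6⟩
    simp only [State.tick, HE.cost_compile] at *
    omega
  · obtain ⟨s', μ', D', g1, g2, g3, g4, g5, g6⟩ := hp h0 _ hs'
    refine ⟨s', μ', D', .ite_true e2.1 h0 g1, g2, g3, ?_, g5, g6⟩
    simp only [State.tick, HE.cost_compile] at *
    omega

/-- A loop with `N` iterations; iteration `j` moves the heads from `h j` to `h (j + 1)`. -/
theorem DRun.loop (hF : Fits C m) {N : ℕ} (h : ℕ → ℕ) (Inv : ℕ → Mem → Contents → Prop)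
    (he : ∀ j μ D, j ≤ N → Inv j μ D → e.ok C μ ∧ (e.val μ ≠ 0 ↔ j < N))
    (hstep : ∀ j μ D, j < N → Inv j μ D → DRun C m r p (h j) (h (j + 1)) μ D t (Inv (j + 1)))
    {j : ℕ} (hj : j ≤ N) (h0 : Inv j μ D) :
    DRun C m r (.loop (e.compile C.σ) p) (h j) (h N) μ D
      ((N - j) * (t + e.cost + 1) + (e.cost + 1)) (Inv N) := by
  induction hk : N - j generalizing j μ D with
  | zero =>
    obtain rfl : j = N := by omega
    intro s hs
    obtain ⟨h1, h2⟩ := he j μ D hj h0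
    have e2 := e.eval_compile hF hs.rep h1
    have hv : e.val μ = 0 := by
      by_contra hc
      exact lt_irrefl _ (h2.1 hc)
    refine ⟨_, μ, D, .loop_done (hv ▸ e2.1), h0, ⟨hs.rep, hs.disk, hs.head⟩, ?_, le_rfl, le_rfl⟩
    simp only [State.tick, HE.cost_compile]
    omega
  | succ k ih =>
    intro s hs
    obtain ⟨h1, h2⟩ := he j μ D hj h0
    have e2 := e.eval_compile hF hs.rep h1
    obtain ⟨s', μ', D', g1, g2, g3, g4, g5, g6⟩ := hstep j μ D (by omega) h0
      (s.tick ((e.compile C.σ).cost + 1)) ⟨hs.rep, hs.disk, hs.head⟩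
    obtain ⟨s2, μ2, D2, k1, k2, k3, k4, k5, k6⟩ := ih (by omega) g2 (by omega) s' g3
    have g5' : s'.passes + pot r s' ≤ s.passes + pot r s := g5
    have g6' : s'.accesses + scanned m r (h j) ≤ s.accesses + scanned m r (h (j + 1)) := g6
    refine ⟨s2, μ2, D2, .loop_step e2.1 (h2.2 (by omega)) g1 k1, k2, k3, ?_, by omega, by omega⟩
    simp only [State.tick, HE.cost_compile] at *
    rw [Nat.add_mul]
    omega

/-- All disks have `textLen` cells. -/
theorem moves_drun (hlen : ∀ d, m.len d = m.textLen) (hx : m.neighbour .input x r = some x')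
    (hxl : x ≤ m.textLen - 1) :
    DRun C m r (moves r) x x' μ D 3 fun μ' D' => μ' = μ ∧ D' = D := by
  intro s hs
  have hn : ∀ d, m.neighbour d x r = some x' := fun d => by
    rw [← hx]
    cases r <;> simp only [Machine.neighbour, hlen]
  have step : ∀ (s : State) d, s.head d = x → Exec m (.atom (.move d r)) s
      { s with
        head := Function.update s.head d x'
        right := Function.update s.right d r
        time := s.time + 1
        passes := s.passes + if s.right d = r then 0 else 1
        accesses := s.accesses + if m.page d x' = m.page d x then 0 else 2 } := fun s d hd => by
    refine .atom ?_
    simp only [Atom.exec, hd, hn, Option.bind_some]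
  refine ⟨_, μ, D, .seq (step s .input (hs.head _)) (.seq (step _ .output (by simp [hs.head]))
    (step _ .work (by simp [hs.head]))), ⟨rfl, rfl⟩, ⟨hs.rep, hs.disk, ?_⟩, le_rfl, ?_, ?_⟩
  · intro d
    cases d <;> simp
  · simp [pot]
    omega
  · have key : ∀ {y z : ℕ}, y ≤ z → ∀ d : Disk,
        (if m.page d z = m.page d y then 0 else 2) + 2 * m.page d y ≤ 2 * m.page d z :=
      fun h d => by
        have := page_mono m d h
        split_ifs <;> omega
    dsimp only
    cases r with
    | true =>
      simp only [Machine.neighbour] at hx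
      split_ifs at hx
      obtain rfl : x + 1 = x' := by simpa using hx
      have k1 := key (Nat.le_add_right x 1) .input
      have k2 := key (Nat.le_add_right x 1) .output
      have k3 := key (Nat.le_add_right x 1) .work
      simp only [scanned, pages]
      omega
    | false =>
      simp only [Machine.neighbour] at hx
      split_ifs at hx
      obtain rfl : x - 1 = x' := by simpa using hx
      have k1 := key (Nat.sub_le x 1) .input
      have k2 := key (Nat.sub_le x 1) .output
      have k3 := key (Nat.sub_le x 1) .work
      have k4 := pages_mono m hxl
      simp only [scanned]
      simp only [eq_comm (a := m.page _ x)] at k1 k2 k3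
      unfold pages at *
      omega

/-- Run `body` on all cells from left to right. -/
def sweepR (σ : ℕ) (body : HC) : Cmd :=
  .seq (HC.compile σ (.asg .vx 0)) (.loop (HE.compile σ (.lt Row.vx.v Row.vn.v))
    (.seq (HC.compile σ (body ;; .asg .vx (Row.vx.v + 1)))
      (.ite (HE.compile σ (.lt Row.vx.v Row.vn.v)) (moves true) .skip)))

/-- Run `body` on all cells from right to left. -/
def sweepL (σ : ℕ) (body : HC) : Cmd :=
  .seq (HC.compile σ (.asg .vx Row.vn.v)) (.loop (HE.compile σ (.lt 0 Row.vx.v))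
    (.seq (HC.compile σ (.asg .vx (Row.vx.v - 1) ;; body))
      (.ite (HE.compile σ (.lt 0 Row.vx.v)) (moves false) .skip)))

/-- There are `n` cells but only `n - 1` moves: after `j` iterations the heads stand on `min j (n -
1)`, and the last iteration does not move them off the disks. -/
theorem sweepR_run (hF : Fits C m) (hlen : ∀ d, m.len d = m.textLen) {n : ℕ} (hn : m.textLen = n)
    (hn0 : 0 < n) (hW : n < C.W) {body : HC} (Inv : ℕ → Mem → Contents → Prop)
    (hinv : ∀ x μ D v, Inv x μ D → Inv x (μ.set .vx 0 v) D) (hvn : ∀ x μ D, Inv x μ D → μ .vn 0 = n)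
    (hstep : ∀ x μ D, x < n → Inv x μ D → μ .vx 0 = x →
      BRun C m x body μ D t fun μ' D' => μ' .vx 0 = x ∧ Inv (x + 1) μ' D')
    (h0 : Inv 0 μ D) :
    DRun C m true (sweepR C.σ body) 0 (n - 1) μ D (n * (t + 100) + 100) (Inv n) := by
  have hI := hF.pos
  have hW1 := hF.two_mul_le
  have hA : BRun C m 0 (.asg .vx 0) μ D (HC.bound (.asg .vx 0))
      fun μ' D' => μ' .vx 0 = 0 ∧ Inv 0 μ' D' :=
    .of_wp hF <| by
      simp [wp, Row.Valid, hinv _ _ _ _ h0]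
      omega
  refine (hA.drun.bind (x'' := n - 1) (t' := n * (t + 100) + 50) ?_).mono
    (by simp only [HC.bound, HE.cost]; omega) fun _ _ h => h
  rintro μ1 D1 ⟨a1, a2⟩
  have hstep' : ∀ j μ D, j < n → μ .vx 0 = j ∧ Inv j μ D → DRun C m true
      (.seq (HC.compile C.σ (body ;; .asg .vx (Row.vx.v + 1)))
      (.ite (HE.compile C.σ (.lt Row.vx.v Row.vn.v)) (moves true) .skip)) (min j (n - 1))
      (min (j + 1) (n - 1)) μ D (t + 60) fun μ' D' => μ' .vx 0 = j + 1 ∧ Inv (j + 1) μ' D' := by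
    rintro j μ D hj ⟨h1, h2⟩
    rw [min_eq_left (by omega)]
    have hB : ∀ μ D, μ .vx 0 = j ∧ Inv (j + 1) μ D → BRun C m j (.asg .vx (Row.vx.v + 1)) μ D
        (HC.bound (.asg .vx (Row.vx.v + 1))) fun μ' D' => μ' .vx 0 = j + 1 ∧ Inv (j + 1) μ' D' :=
      fun μ D h => .of_wp hF <| by
        simp [wp, Row.Valid, h.1, hinv _ _ _ _ h.2]
        omega
    refine (((hstep j μ D hj h2 h1).bind hB).drun.bind (t' := 25) ?_).mono
      (by simp only [HC.bound, HE.cost]; omega) fun _ _ h => h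
    rintro μ2 D2 ⟨k1, k2⟩
    have k3 := hvn _ _ _ k2
    refine (DRun.ite (t := 3) hF ?_ ?_ ?_).mono (by simp only [HE.cost]; omega)
      (P := fun μ' D' => μ' = μ2 ∧ D' = D2) ?_
    · simp [Row.Valid]
      omega
    · intro hv
      simp [k1, k3] at hv
      rw [min_eq_left (by omega)]
      exact moves_drun hlen (by simp [Machine.neighbour, hlen, hn, hv]) (by omega)
    · intro hv
      simp [k1, k3] at hv
      rw [min_eq_right (by omega), show n - 1 = j by omega]
      exact DRun.skip
    · rintro μ' D' ⟨rfl, rfl⟩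
      exact ⟨k1, k2⟩
  have := DRun.loop (r := true) (e := .lt Row.vx.v Row.vn.v) hF (N := n) (fun j => min j (n - 1))
    (fun j μ D => μ .vx 0 = j ∧ Inv j μ D) (fun j μ D hj h => ?_) hstep' (Nat.zero_le n) ⟨a1, a2⟩
  · simp only [Nat.zero_min, Nat.sub_zero] at this
    rw [min_eq_right (by omega)] at this
    exact this.mono (Nat.add_le_add (Nat.mul_le_mul_left _ (by simp only [HE.cost]; omega))
      (by simp only [HE.cost]; omega)) fun _ _ h => h.2
  · simp [Row.Valid, h.1, hvn _ _ _ h.2]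
    omega

theorem sweepL_run (hF : Fits C m) (hlen : ∀ d, m.len d = m.textLen) {n : ℕ} (hn : m.textLen = n)
    (hn0 : 0 < n) (hW : n < C.W) {body : HC} (Inv : ℕ → Mem → Contents → Prop)
    (hinv : ∀ x μ D v, Inv x μ D → Inv x (μ.set .vx 0 v) D) (hvn : ∀ x μ D, Inv x μ D → μ .vn 0 = n)
    (hstep : ∀ x μ D, x < n → Inv (x + 1) μ D → μ .vx 0 = x →
      BRun C m x body μ D t fun μ' D' => μ' .vx 0 = x ∧ Inv x μ' D')
    (h0 : Inv n μ D) :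
    DRun C m false (sweepL C.σ body) (n - 1) 0 μ D (n * (t + 100) + 100) (Inv 0) := by
  have hI := hF.pos
  have hW1 := hF.two_mul_le
  have hA : BRun C m (n - 1) (.asg .vx Row.vn.v) μ D (HC.bound (.asg .vx Row.vn.v))
      fun μ' D' => μ' .vx 0 = n ∧ Inv n μ' D' :=
    .of_wp hF <| by
      simp [wp, Row.Valid, hvn _ _ _ h0, hinv _ _ _ _ h0]
      omega
  refine (hA.drun.bind (x'' := 0) (t' := n * (t + 100) + 50) ?_).mono
    (by simp only [HC.bound, HE.cost]; omega) fun _ _ h => h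
  rintro μ1 D1 ⟨a1, a2⟩
  have hstep' : ∀ j μ D, j < n → μ .vx 0 = n - j ∧ Inv (n - j) μ D → DRun C m false
      (.seq (HC.compile C.σ (.asg .vx (Row.vx.v - 1) ;; body))
      (.ite (HE.compile C.σ (.lt 0 Row.vx.v)) (moves false) .skip)) (n - 1 - j)
      (n - 1 - (j + 1)) μ D (t + 60) fun μ' D' => μ' .vx 0 = n - (j + 1) ∧ Inv (n - (j + 1)) μ' D' := by
    rintro j μ D hj ⟨h1, h2⟩
    obtain ⟨x, hx⟩ : ∃ x, n - j = x + 1 := ⟨n - j - 1, by omega⟩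
    rw [hx] at h1 h2
    rw [show n - (j + 1) = x by omega, show n - 1 - j = x by omega,
      show n - 1 - (j + 1) = x - 1 by omega]
    have hB : BRun C m x (.asg .vx (Row.vx.v - 1)) μ D (HC.bound (.asg .vx (Row.vx.v - 1)))
        fun μ' D' => μ' .vx 0 = x ∧ Inv (x + 1) μ' D' :=
      .of_wp hF <| by
        simp [wp, Row.Valid, h1, hinv _ _ _ _ h2]
        omega
    refine (((hB.mono (t' := 30) (Nat.le_of_ble_eq_true rfl) fun _ _ h => h).bind
      fun μ2 D2 h => hstep x μ2 D2 (by omega) h.2 h.1).drun.bind (t' := 25) ?_).mono (by omega) fun _ _ h => h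
    rintro μ2 D2 ⟨k1, k2⟩
    refine (DRun.ite (t := 3) hF ?_ ?_ ?_).mono (by simp only [HE.cost]; omega)
      (P := fun μ' D' => μ' = μ2 ∧ D' = D2) ?_
    · simp [Row.Valid]
      omega
    · intro hv
      simp [k1] at hv
      exact moves_drun hlen (by simp [Machine.neighbour]; omega) (by omega)
    · intro hv
      simp [k1] at hv
      subst hv
      exact DRun.skip
    · rintro μ' D' ⟨rfl, rfl⟩
      exact ⟨k1, k2⟩
  have := DRun.loop (r := false) (e := .lt 0 Row.vx.v) hF (N := n) (fun j => n - 1 - j)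
    (fun j μ D => μ .vx 0 = n - j ∧ Inv (n - j) μ D) (fun j μ D hj h => ?_) hstep' (Nat.zero_le n)
    ⟨a1, a2⟩
  · simp only [Nat.sub_zero, Nat.sub_self] at this
    rw [show n - 1 - n = 0 by omega] at this
    exact this.mono (Nat.add_le_add (Nat.mul_le_mul_left _ (by simp only [HE.cost]; omega))
      (by simp only [HE.cost]; omega)) fun _ _ h => h.2
  · simp [Row.Valid, h.1]
    omega

/-! ## Programs that sweep -/

/-- The program takes at most `t` units of time, `k` passes and `l` page accesses. -/
def TRun (C : Cfg) (m : Machine) (p : Cmd) (x x' : ℕ) (μ : Mem) (D : Contents) (t k l : ℕ)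
    (P : Mem → Contents → Prop) : Prop :=
  ∀ s, Sync C s μ D x → ∃ s' μ' D', Exec m p s s' ∧ P μ' D' ∧ Sync C s' μ' D' x' ∧
    s'.time ≤ s.time + t ∧ s'.passes ≤ s.passes + k ∧ s'.accesses ≤ s.accesses + l

theorem DRun.trun (h : DRun C m r p x x' μ D t P) (hx : x' ≤ m.textLen - 1)
    (hl : 2 * pages m (m.textLen - 1) ≤ l) : TRun C m p x x' μ D t 3 l P := by
  intro s hs
  obtain ⟨s', μ', D', g1, g2, g3, g4, g5, g6⟩ := h s hs
  have := pot_le r s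
  have := scanned_le m r hx
  exact ⟨s', μ', D', g1, g2, g3, g4, by omega, by omega⟩

theorem BRun.trun {p : HC} (h : BRun C m x p μ D t P) :
    TRun C m (p.compile C.σ) x x μ D t 0 0 P := by
  rintro s ⟨h1, h2, h3⟩
  obtain ⟨s', μ', D', g1, g2, g3, g4, g5, g6, g7, g8, g9⟩ := h s h1 h2 h3
  exact ⟨s', μ', D', g1, g2, ⟨g3, g4, by simpa [g5] using h3⟩, g9, g7.le, g8.le⟩

theorem TRun.mono (h : TRun C m p x x' μ D t k l P) (ht : t ≤ t') (hk : k ≤ k') (hl : l ≤ l')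
    (hP : ∀ μ D, P μ D → P' μ D) : TRun C m p x x' μ D t' k' l' P' := by
  intro s hs
  obtain ⟨s', μ', D', g1, g2, g3, g4, g5, g6⟩ := h s hs
  exact ⟨s', μ', D', g1, hP _ _ g2, g3, by omega, by omega, by omega⟩

theorem TRun.bind {P₁ : Mem → Contents → Prop} (h : TRun C m p x x' μ D t k l P₁)
    (h' : ∀ μ D, P₁ μ D → TRun C m q x' x'' μ D t' k' l' P) :
    TRun C m (.seq p q) x x'' μ D (t + t') (k + k') (l + l') P := by
  intro s hs
  obtain ⟨s', μ', D', g1, g2, g3, g4, g5, g6⟩ := h s hs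
  obtain ⟨s2, μ2, D2, k1, k2, k3, k4, k5, k6⟩ := h' _ _ g2 s' g3
  exact ⟨s2, μ2, D2, .seq g1 k1, k2, k3, by omega, by omega, by omega⟩

/-- A loop; `Inv j` holds if at most `j` iterations remain. -/
theorem TRun.loop (hF : Fits C m) (Inv : ℕ → Mem → Contents → Prop)
    (hok : ∀ j μ D, Inv j μ D → e.ok C μ) (h1 : ∀ μ D, Inv 0 μ D → e.val μ = 0)
    (hstep : ∀ j μ D, Inv (j + 1) μ D → e.val μ ≠ 0 → TRun C m p x x μ D t k l (Inv j)) {j : ℕ}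
    (h0 : Inv j μ D) :
    TRun C m (.loop (e.compile C.σ) p) x x μ D (j * (t + e.cost + 1) + (e.cost + 1)) (j * k)
      (j * l) fun μ' D' => ∃ j, Inv j μ' D' ∧ e.val μ' = 0 := by
  induction j generalizing μ D with
  | zero =>
    intro s hs
    have e2 := e.eval_compile hF hs.rep (hok _ _ _ h0)
    have hv := h1 _ _ h0
    refine ⟨_, μ, D, .loop_done (hv ▸ e2.1), ⟨_, h0, hv⟩, ⟨hs.rep, hs.disk, hs.head⟩, ?_,
      Nat.le_add_right _ _, Nat.le_add_right _ _⟩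
    simp only [State.tick, HE.cost_compile]
    omega
  | succ j ih =>
    intro s hs
    have e2 := e.eval_compile hF hs.rep (hok _ _ _ h0)
    by_cases hv : e.val μ = 0
    · refine ⟨_, μ, D, .loop_done (hv ▸ e2.1), ⟨_, h0, hv⟩, ⟨hs.rep, hs.disk, hs.head⟩, ?_,
        Nat.le_add_right _ _, Nat.le_add_right _ _⟩
      simp only [State.tick, HE.cost_compile]
      omega
    · obtain ⟨s', μ', D', g1, g2, g3, g4, g5, g6⟩ := hstep j μ D h0 hv
        (s.tick ((e.compile C.σ).cost + 1)) ⟨hs.rep, hs.disk, hs.head⟩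
      obtain ⟨s2, μ2, D2, k1, k2, k3, k4, k5, k6⟩ := ih g2 s' g3
      have g5' : s'.passes ≤ s.passes + k := g5
      have g6' : s'.accesses ≤ s.accesses + l := g6
      refine ⟨s2, μ2, D2, .loop_step e2.1 hv g1 k1, k2, k3, ?_, ?_, ?_⟩
      · simp only [State.tick, HE.cost_compile] at *
        rw [Nat.add_mul]
        omega
      · rw [Nat.add_mul]
        omega
      · rw [Nat.add_mul]
        omega

end
end ScanSort

namespace ScanSort
open ScanModel

/-! ## The sweeps of one phase -/

/-- Load the characters and the bits of a block. -/
def load : HC :=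
  .ite (.lt Row.vx.v Row.va.v) .skip (.ite (.lt Row.vx.v Row.vb.v)
    (.read .input .aX (Row.vx.v - Row.va.v) ;; .read .work .aG (Row.vx.v - Row.va.v)) .skip)

/-- Compute the rank of a suffix among the suffixes of the block, and its new bit. -/
def rank : HC :=
  .read .input .vch 0 ;;
  .asg .vR (.zc Row.vch.v Row.vR.v +
    .eq Row.vch.v (.cell .aX (Row.vL.v - 1)) * .eq Row.vg.v 0) ;;
  .read .work .vg 0 ;;
  .write .work (1 - .lt Row.vpa.v Row.vR.v) ;;
  .ite (.lt Row.vx.v Row.vb.v) .skip (.set .agap Row.vR.v (.cell .agap Row.vR.v + 1))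

def fetchOld : HC :=
  .ite (.lt Row.vx.v (Row.vn.v - Row.vb.v)) (.read .output .aQ (Row.vx.v % (Row.vM.v + 1))) .skip

def emit : HC :=
  .ite (.lt Row.vx.v (Row.vn.v - Row.va.v))
    (.ite (.lt 0 (.cell .agap Row.vr.v))
      (.set .agap Row.vr.v (.cell .agap Row.vr.v - 1) ;;
        .write .output (.cell .aQ (Row.vq.v % (Row.vM.v + 1))) ;; .asg .vq (Row.vq.v + 1))
      (.write .output (.cell .aSA Row.vr.v + Row.va.v + 1) ;; .asg .vr (Row.vr.v + 1)))
    .skip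

section
variable {C : Cfg} {m : Machine} {μ : Mem} {D : Contents} {n a L : ℕ}

theorem load_run (hF : Fits C m) (hlen : ∀ d, m.len d = m.textLen) (hn : m.textLen = n)
    (hn0 : 0 < n) (hW : n < C.W) (hvn : μ .vn 0 = n) (ha : μ .va 0 = a) (hb : μ .vb 0 = a + L)
    (hLI : L ≤ C.I) (hi : ∀ j < n, D .input j < C.W) (hw : ∀ j < n, D .work j < C.W)
    (hbn : a + L ≤ n) :
    DRun C m true (sweepR C.σ load) 0 (n - 1) μ D (n * 300 + 100) fun μ' D' => D' = D ∧
      Frame [.vx, .aX, .aG] μ μ' ∧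
      (∀ i < L, μ' .aX i = D .input (a + i)) ∧ ∀ i < L, μ' .aG i = D .work (a + i) := by
  have hI := hF.pos
  have hW1 := hF.two_mul_le
  refine (sweepR_run (t := 200) hF hlen hn hn0 hW (fun x μ' D' => D' = D ∧
    Frame [.vx, .aX, .aG] μ μ' ∧ (∀ i < L, a + i < x → μ' .aX i = D .input (a + i)) ∧
      ∀ i < L, a + i < x → μ' .aG i = D .work (a + i)) ?_ ?_ ?_ ?_).mono (by omega) ?_
  · rintro x μ' D' v ⟨h1, h2, h3, h4⟩
    simp [h1, h2]
    exact ⟨h3, h4⟩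
  · rintro x μ' D' ⟨h1, h2, h3, h4⟩
    rw [h2 _ (by simp), hvn]
  · rintro x μ' D' hx ⟨rfl, h2, h3, h4⟩ hvx
    refine (BRun.of_wp hF ?_).mono (Nat.le_of_ble_eq_true rfl) (fun _ _ h => h)
    have h5 := hi x hx
    have h6 := hw x hx
    simp [wp, load, Row.Valid, hvx, h2, h2 .va, h2 .vb, ha, hb]
    and_intros
    all_goals try omega
    · intro h
      exact ⟨fun i hi hi' => h3 i hi (by omega), fun i hi hi' => h4 i hi (by omega)⟩
    · intro h7
      and_intros
      all_goals try omega
      rotate_left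
      · exact fun h => ⟨fun i hi hi' => h3 i hi (by omega), fun i hi hi' => h4 i hi (by omega)⟩
      intro h8
      and_intros
      all_goals try omega
      · intro i hi hi'
        by_cases he : i = x - a
        · rw [he, Function.update_self, show a + (x - a) = x by omega]
        · rw [Function.update_of_ne he, h3 i hi (by omega)]
      · intro i hi hi'
        by_cases he : i = x - a
        · rw [he, Function.update_self, show a + (x - a) = x by omega]
        · rw [Function.update_of_ne he, h4 i hi (by omega)]
  · exact ⟨rfl, Frame.refl _ _, by simp, by simp⟩
  · rintro μ' D' ⟨h1, h2, h3, h4⟩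
    exact ⟨h1, h2, fun i hi => h3 i hi (by omega), fun i hi => h4 i hi (by omega)⟩

open scoped Classical in
-- The old bit of a cell is read into `vg`, where it serves the next cell to the left, and then
-- gives way to the new bit; thus `n` bits hold both generations. The sweep covers the whole text,
-- because later blocks need the new bits at positions before `a`. Ranks are counted in `agap` only
-- behind the block.
theorem rank_run (hF : Fits C m) (hlen : ∀ d, m.len d = m.textLen) (hn : m.textLen = n)
    (hn0 : 0 < n) (hW : 2 * n < C.W) {τ X f : ℕ → ℕ} (hf : BlockSA τ n a L f) (hL0 : 0 < L)
    (hvn : μ .vn 0 = n) (hb : μ .vb 0 = a + L) (hL : μ .vL 0 = L)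
    (hLI : 2 * L + 1 < C.I) (hi : ∀ j < n, D .input j + 1 = τ j ∧ D .input j < C.σ)
    (hw : ∀ j < n, D .work j = if slt τ (a + L) j then 0 else 1)
    (hX : μ .aX = X) (hXτ : ∀ i < L, X i + 1 = τ (a + i))
    (hz : ∀ c < C.σ, ∀ r ≤ L, μ (.z c) r = occ X f L c r)
    (hgap : ∀ r ≤ L, μ .agap r = 0) (hpa : μ .vpa 0 < L) (hpf : f (μ .vpa 0) = 0)
    (hR : μ .vR 0 = 0) (hg : μ .vg 0 = 1) :
    DRun C m false (sweepL C.σ rank) (n - 1) 0 μ D (n * 400 + 100) fun μ' D' =>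
      Frame [.vx, .vch, .vR, .vg, .agap] μ μ' ∧ D' .input = D .input ∧ D' .output = D .output ∧
      (∀ j < n, D' .work j = if slt τ a j then 0 else 1) ∧
      ∀ r ≤ L, μ' .agap r = ((Finset.Ico (a + L) n).filter fun x => rk τ a L x = r).card := by
  have hI := hF.pos
  have hW1 := hF.two_mul_le
  have hle := hf.le
  refine (sweepL_run (t := 300) hF hlen hn hn0 (by omega) (fun x μ' D' =>
    Frame [.vx, .vch, .vR, .vg, .agap] μ μ' ∧ (D' .input = D .input ∧ D' .output = D .output) ∧
      (∀ j < n, D' .work j = if x ≤ j then (if slt τ a j then 0 else 1) else D .work j) ∧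
      (∀ r ≤ L, μ' .agap r = ((Finset.Ico (max (a + L) x) n).filter fun x => rk τ a L x = r).card) ∧
      μ' .vR 0 = rk τ a L x ∧ μ' .vg 0 = if slt τ (a + L) x then 0 else 1) ?_ ?_ ?_ ?_).mono
      (by omega) ?_
  · rintro x μ' D' v ⟨h1, h2, h3, h4⟩
    simp [h1, h2]
    exact ⟨h3, h4⟩
  · rintro x μ' D' ⟨h1, -⟩
    rw [h1 _ (by simp), hvn]
  · rintro x μ' D' hx ⟨h1, ⟨h2, h3⟩, h4, h5, h6, h7⟩ hvx
    obtain ⟨c, hc⟩ : ∃ c, c = D .input x := ⟨_, rfl⟩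
    obtain ⟨i1, i2⟩ := hi x hx
    rw [← hc] at i1 i2
    have hrk := hf.rk_step hL0 hXτ i1
    have hrL := rk_le τ a L (x + 1)
    have hrL' := rk_le τ a L x
    have ez : μ' (.z c) (rk τ a L (x + 1)) = occ X f L c (rk τ a L (x + 1)) := by
      rw [h1 _ (by simp), hz c i2 _ hrL]
    have eR : occ X f L c (rk τ a L (x + 1)) + (if c = X (L - 1) then 1 else 0) *
        (if (if slt τ (a + L) (x + 1) then 0 else 1) = 0 then 1 else 0) = rk τ a L x := by
      rw [hrk]
      congr 1
      by_cases q1 : c = X (L - 1) <;> by_cases q2 : slt τ (a + L) (x + 1) <;> simp [q1, q2]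
    have ew : D' .work x = if slt τ (a + L) x then 0 else 1 := by
      rw [h4 x hx, if_neg (by omega), hw x hx]
    have hwid : m.width .work = 1 := rfl
    -- The suffix at `a` precedes the suffix at `x` exactly if its index `vpa` in the block order is
    -- below the rank of `x`.
    have hbit := (hf.slt_iff_lt_rk hpa x).symm
    rw [hpf, add_zero] at hbit
    have hg0 := h5 (rk τ a L x) hrL'
    have hgle : ((Finset.Ico (max (a + L) (x + 1)) n).filter
        fun y => rk τ a L y = rk τ a L x).card ≤ n :=
      (Finset.card_filter_le _ _).trans (by simp)
    have hb' : μ' .vb 0 = a + L := by rw [h1 _ (by simp), hb]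
    have hL' : μ' .vL 0 = L := by rw [h1 _ (by simp), hL]
    have hX' : μ' .aX = X := by rw [h1 _ (by simp), hX]
    have hp' : μ' .vpa 0 = μ .vpa 0 := by rw [h1 _ (by simp)]
    have hD : D' .input x = c := by rw [h2, hc]
    refine (BRun.of_wp hF ?_).mono (Nat.le_of_ble_eq_true rfl) (fun _ _ h => h)
    simp only [wp, rank, Row.Valid, HE.ok_ofNat, HE.val_ofNat, HE.ok_cell, HE.ok_add, HE.ok_mul,
      HE.ok_eq, HE.ok_zc, HE.val_cell, HE.val_lit, HE.ok_lit, HE.val_zc, HE.val_add, HE.val_mul,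
      HE.val_eq, HE.val_sub, HE.ok_sub, HE.ok_lt, HE.val_lt, Mem.set_self, Function.update_self,
      Mem.set_of_ne, ne_eq, reduceCtorEq, not_false_eq_true, hb', hL', hX', hp', hD, h6, h7, ez, eR,
      ew, hvx, hwid, hbit]
    have hv : (1 - if slt τ a x then 1 else 0) % 2 ^ 1 = if slt τ a x then 0 else 1 := by
      split_ifs <;> rfl
    have hbits : ∀ j < n, D'.put .work x (if slt τ a x then 0 else 1) .work j =
        if x ≤ j then if slt τ a j then 0 else 1 else D .work j := fun j hj => by
      by_cases hjx : j = x
      · simp [Contents.put, hjx]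
      · simp only [Contents.put, Function.update_self, Function.update_of_ne hjx, h4 j hj]
        simp only [show x + 1 ≤ j ↔ x ≤ j by omega]
    have hin : D'.put .work x (if slt τ a x then 0 else 1) .input = D .input := by
      simp [Contents.put, h2]
    have hout : D'.put .work x (if slt τ a x then 0 else 1) .output = D .output := by
      simp [Contents.put, h3]
    have s1 : (if slt τ (a + L) x then 0 else 1) < C.W := by split_ifs <;> omega
    have s2 : ((if c = X (L - 1) then 1 else 0) *
        if (if slt τ (a + L) (x + 1) then 0 else 1) = 0 then 1 else 0) < C.W := by
      split_ifs <;> omega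
    rw [hv]
    simp only [Frame.set_iff, List.mem_cons, reduceCtorEq, true_or, or_true, h1, hin, hout,
      s1, s2]
    and_intros
    all_goals try first | omega | trivial | exact hbits
    · intro h8
      have h9 : x < a + L := by
        by_contra hc
        simp [hc] at h8
      rw [max_eq_left (by omega)] at h5
      rw [max_eq_left (by omega)]
      simp only [true_and]
      exact ⟨hbits, h5, trivial⟩
    · intro h8
      have h9 : a + L ≤ x := by
        by_contra hc
        simp [not_le.1 hc] at h8
      rw [max_eq_right (by omega)] at h5 hg0 hgle
      rw [max_eq_right h9]
      and_intros
      all_goals try first | omega | trivial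
      intro r hr
      rw [← Finset.insert_Ico_add_one_left_eq_Ico hx, Finset.filter_insert]
      by_cases hrx : r = rk τ a L x
      · rw [hrx, Function.update_self, if_pos rfl, Finset.card_insert_of_notMem (by simp), hg0]
      · rw [Function.update_of_ne hrx, if_neg fun h => hrx h.symm, h5 r hr]
  -- The sweep starts with the empty suffix at `n`: no suffix precedes it, so its rank is `0` and
  -- its bit `1`.
  · exact ⟨Frame.refl _ _, ⟨rfl, rfl⟩, fun j hj => by rw [if_neg (by omega)], fun r hr => by
      rw [hgap r hr, max_eq_right hle, Finset.Ico_self]; rfl, by rw [hR, rk_end hf.str],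
      by rw [hg, if_neg fun h => (hf.str.lt_of_slt h).false]⟩
  · rintro μ' D' ⟨h1, ⟨h2, h3⟩, h4, h5, -⟩
    refine ⟨h1, h2, h3, fun j hj => by rw [h4 j hj, if_pos (by omega)], fun r hr => ?_⟩
    rw [h5 r hr, max_eq_left (by omega)]

/-- Indices within a window of `M + 1` have different slots in the cyclic buffer. -/
theorem mod_succ_ne {M x y : ℕ} (h : y < x) (hM : x ≤ y + M) : y % (M + 1) ≠ x % (M + 1) := by
  intro he
  have := (Nat.modEq_iff_dvd' h.le).1 he
  have := Nat.le_of_dvd (by omega) this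
  omega

/-- The state of the third sweep before cell `x`; the first `y` entries of `g` have been read. -/
structure Merging (τ : ℕ → ℕ) (n a L M : ℕ) (f g : ℕ → ℕ) (D : Contents) (x y : ℕ) (μ : Mem)
    (D' : Contents) (r q : ℕ) (out : ℕ → ℕ) : Prop where
  input : D' .input = D .input
  work : D' .work = D .work
  vr : μ .vr 0 = r
  vq : μ .vq 0 = q
  sum : r + q = min x (n - a)
  merged : Merged τ n a L f g r q out (μ .agap)
  done : ∀ t < r + q, D' .output t = out t + 1
  old : ∀ t, x ≤ t → t < n - (a + L) → D' .output t = g t + 1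
  buf : ∀ t, q ≤ t → t < y → t < n - (a + L) → μ .aQ (t % (M + 1)) = g t + 1

/-- An old entry is fetched into the buffer before its cell is overwritten. Before a write to a cell
`x` with `x < n - a`, the entries that wait have indices among `q, …, x`; since `r + q = x`, there
are at most `r + 1 ≤ M + 1` of them. -/
theorem merge_sweep_run (hF : Fits C m) (hlen : ∀ d, m.len d = m.textLen) (hn : m.textLen = n)
    (hn0 : 0 < n) {M : ℕ} (hW : 2 * n + M + 2 < C.W) {τ f g : ℕ → ℕ} (hf : BlockSA τ n a L f)
    (hg : TailSA τ n (a + L) g) (hvn : μ .vn 0 = n) (ha : μ .va 0 = a) (hb : μ .vb 0 = a + L)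
    (hM : μ .vM 0 = M) (hLM : L ≤ M) (hMI : M + 2 < C.I) (hfA : μ .aSA = f)
    (hgap : ∀ r ≤ L, μ .agap r = ((Finset.Ico (a + L) n).filter fun x => rk τ a L x = r).card)
    (hr : μ .vr 0 = 0) (hq : μ .vq 0 = 0) (hD : ∀ t < n - (a + L), D .output t = g t + 1) :
    DRun C m true (sweepR C.σ (fetchOld ;; emit)) 0 (n - 1) μ D (n * 400 + 100) fun μ' D' =>
      Frame [.vx, .vr, .vq, .agap, .aQ] μ μ' ∧ D' .input = D .input ∧ D' .work = D .work ∧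
      ∃ out, TailSA τ n a out ∧ ∀ t < n - a, D' .output t = out t + 1 := by
  have hI := hF.pos
  have hW1 := hF.two_mul_le
  have hle := hf.le
  have hwid : m.width .output = Nat.size n := by rw [← hn]; rfl
  have hsize : n < 2 ^ Nat.size n := Nat.lt_size_self n
  obtain ⟨fr, hfr⟩ : ∃ fr : List Row, fr = [.vx, .vr, .vq, .agap, .aQ] := ⟨_, rfl⟩
  have m1 : Row.vx ∈ fr := by simp [hfr]
  have m2 : Row.vr ∈ fr := by simp [hfr]
  have m3 : Row.vq ∈ fr := by simp [hfr]
  have m4 : Row.agap ∈ fr := by simp [hfr]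
  have m5 : Row.aQ ∈ fr := by simp [hfr]
  have n1 : Row.vn ∉ fr := by simp [hfr]
  have n2 : Row.va ∉ fr := by simp [hfr]
  have n3 : Row.vb ∉ fr := by simp [hfr]
  have n4 : Row.vM ∉ fr := by simp [hfr]
  have n5 : Row.aSA ∉ fr := by simp [hfr]
  rw [← hfr]
  clear hfr
  refine (sweepR_run (t := 300) hF hlen hn hn0 (by omega) (fun x μ' D' => Frame fr μ μ' ∧
    ∃ r q out, Merging τ n a L M f g D x x μ' D' r q out) ?_ ?_ ?_ ?_).mono (by omega) ?_
  · rintro x μ' D' v ⟨h1, r, q, out, h2⟩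
    refine ⟨h1.set m1 _ _, r, q, out, h2.1, h2.2, ?_, ?_, h2.5, ?_, h2.7, h2.8, ?_⟩
    · simpa using h2.3
    · simpa using h2.4
    · simpa using h2.6
    · simpa using h2.9
  · rintro x μ' D' ⟨h1, -⟩
    rw [h1 _ n1, hvn]
  · rintro x μ' D' hx ⟨h1, r, q, out, h2⟩ hvx
    have hrL := h2.merged.rle
    have hqn := h2.merged.qle
    have hsum := h2.sum
    refine (BRun.bind (t := 100) (t' := 200) (P₁ := fun μ1 D1 => D1 = D' ∧ Frame fr μ μ1 ∧
      μ1 .vx 0 = x ∧ Merging τ n a L M f g D x (x + 1) μ1 D' r q out) ?_ ?_).mono (by omega)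
      fun _ _ h => h
    · refine (BRun.of_wp hF ?_).mono (Nat.le_of_ble_eq_true rfl) (fun _ _ h => h)
      simp [wp, fetchOld, Row.Valid, hvx, h1, h1 _ n1, h1 _ n3, h1 _ n4, hvn, hb, hM, m5]
      and_intros
      all_goals try omega
      · intro h3
        have h4 := h2.old x le_rfl (by omega)
        have h5 := hg.lt x (by omega)
        have h6 : x % (M + 1) ≤ M := Nat.le_of_lt_succ (Nat.mod_lt _ (by omega))
        and_intros
        all_goals try omega
        refine ⟨h2.1, h2.2, ?_, ?_, h2.5, ?_, h2.7, h2.8, fun t ht1 ht2 ht3 => ?_⟩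
        · simpa using h2.3
        · simpa using h2.4
        · simpa using h2.6
        · rw [Mem.set_self]
          by_cases htx : t = x
          · rw [htx, Function.update_self, h4]
          · rw [Function.update_of_ne (mod_succ_ne (by omega) (by omega)),
              h2.buf t ht1 (by omega) ht3]
      · intro h3
        exact ⟨h2.1, h2.2, h2.3, h2.4, h2.5, h2.6, h2.7, h2.8, fun t ht1 ht2 ht3 =>
          h2.buf t ht1 (by omega) ht3⟩
    · rintro μ1 D1 ⟨rfl, f1, k1, k2⟩
      have hr1 := k2.vr
      have hq1 := k2.vq
      have c1 := f1 _ n1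
      have c2 := f1 _ n2
      have c4 := f1 _ n4
      have c5 := f1 _ n5
      rw [hfA] at c5
      have e1 : μ1 .vn 0 = n := by rw [c1, hvn]
      have e2 : μ1 .va 0 = a := by rw [c2, ha]
      have e4 : μ1 .vM 0 = M := by rw [c4, hM]
      have hqM : q % (M + 1) ≤ M := Nat.le_of_lt_succ (Nat.mod_lt _ (by omega))
      refine (BRun.of_wp hF ?_).mono (Nat.le_of_ble_eq_true rfl) (fun _ _ h => h)
      by_cases hxa : x < n - a
      · have hsum' : r + q = x := by omega
        have old' : ∀ v t, x + 1 ≤ t → t < n - (a + L) → D1.put .output x v .output t = g t + 1 :=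
          fun v t h3 h4 => by
            simp only [Contents.put, Function.update_self]
            rw [Function.update_of_ne (by omega), k2.old t (by omega) h4]
        -- Entries are at most `n` and fit into a cell of the output disk, so the reduction on
        -- writing changes nothing.
        have done' : ∀ v, v + 1 ≤ n → ∀ t < x + 1,
            D1.put .output x ((v + 1) % 2 ^ n.size) .output t = Function.update out x v t + 1 :=
          fun v hv t ht => by
            simp only [Contents.put, Function.update_self]
            by_cases htx : t = x
            · rw [htx, Function.update_self, Function.update_self, Nat.mod_eq_of_lt (by omega)]
            · rw [Function.update_of_ne htx, Function.update_of_ne htx, k2.done t (by omega)]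
        have hin : ∀ v, D1.put .output x v .input = D .input := fun v => by
          simp [Contents.put, k2.input]
        have hwk : ∀ v, D1.put .output x v .work = D .work := fun v => by
          simp [Contents.put, k2.work]
        by_cases hpos : 0 < μ1 .agap r
        · obtain ⟨hq2, hm⟩ := k2.merged.stepg hf hg hpos
          have hbuf := k2.buf q le_rfl (by omega) hq2
          have hgq := hg.lt q hq2
          have hgapW : μ1 .agap r ≤ n := by
            rw [k2.merged.gap r le_rfl hrL]
            exact (Finset.card_filter_le _ _).trans (by simp; omega)
          rw [hsum'] at hm
          simp [wp, emit, Row.Valid, hwid, k1, e1, e2, e4, hr1, hq1, hbuf, hxa, hpos, f1, m4, m3]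
          and_intros
          all_goals try omega
          refine ⟨r, q + 1, Function.update out x (g q), hin _, hwk _, ?_, ?_, by omega, ?_, ?_, old' _, ?_⟩
          · simpa using hr1
          · simp
          · simpa using hm
          · rw [show r + (q + 1) = x + 1 by omega]
            exact done' _ (by omega)
          · intro t h3 h4 h5
            simpa using k2.buf t (by omega) h4 h5
        · have hrL' := (k2.merged.gap_pos (by omega) hle).resolve_left hpos
          have hm := k2.merged.stepf hf (by omega) hrL'
          have hfr := hf.lt r hrL'
          rw [hsum'] at hm
          simp [wp, emit, Row.Valid, hwid, k1, e1, e2, e4, hr1, hq1, hxa, hpos, f1, m2, c5]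
          and_intros
          all_goals try omega
          refine ⟨r + 1, q, Function.update out x (a + f r), hin _, hwk _, ?_, ?_, by omega, ?_, ?_, old' _, ?_⟩
          · simp
          · simpa using hq1
          · simpa using hm
          · rw [show r + 1 + q = x + 1 by omega, Nat.add_comm (f r) a]
            exact done' _ (by omega)
          · intro t h3 h4 h5
            simpa using k2.buf t (by omega) h4 h5
      · simp [wp, emit, Row.Valid, hwid, k1, e1, e2, hxa, f1]
        and_intros
        all_goals try omega
        exact ⟨r, q, out, k2.1, k2.2, k2.3, k2.4, by omega, k2.6, k2.7,
          fun t h3 h4 => k2.old t (by omega) h4, k2.buf⟩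
  · refine ⟨Frame.refl _ _, 0, 0, fun _ => 0, rfl, rfl, hr, hq, by simp, Merged.start hg hgap,
      by omega, fun t _ => hD t, by omega⟩
  · rintro μ' D' ⟨h1, r, q, out, h2⟩
    have hs := h2.sum
    rw [min_eq_right (by omega)] at hs
    exact ⟨h1, h2.input, h2.work, out, h2.merged.finish hs, hs ▸ h2.done⟩

end
end ScanSort

namespace ScanSort
open ScanModel

/-! ## The external algorithm -/

/-- Extend the sorted list of suffixes by one block. -/
def phase (σ : ℕ) : Cmd :=
  .seq (HC.compile σ (.asg .va (Row.vb.v - Row.vM.v) ;; .asg .vL (Row.vb.v - Row.va.v))) <|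
  .seq (sweepR σ load) <| .seq (HC.compile σ (prepare σ)) <| .seq (sweepL σ rank) <|
  .seq (HC.compile σ (.asg .vr 0 ;; .asg .vq 0)) <| .seq (sweepR σ (fetchOld ;; emit)) <|
  .seq (sweepL σ .skip) (HC.compile σ (.asg .vb Row.va.v))

def scanSort (σ : ℕ) : Cmd :=
  .seq (HC.compile σ (.asg .vb Row.vn.v)) (.loop (HE.compile σ Row.vb.v) (phase σ))

open scoped Classical in
/-- The suffixes that begin at or after `b` are sorted. -/
structure PhaseInv (σ : ℕ) (τ : ℕ → ℕ) (n M b : ℕ) (μ : Mem) (D : Contents) : Prop where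
  vn : μ .vn 0 = n
  vM : μ .vM 0 = M
  vb : μ .vb 0 = b
  le : b ≤ n
  input : ∀ j < n, D .input j + 1 = τ j ∧ D .input j < σ
  work : ∀ j < n, D .work j = if slt τ b j then 0 else 1
  output : ∃ g, TailSA τ n b g ∧ ∀ t < n - b, D .output t = g t + 1

section
variable {C : Cfg} {m : Machine} {μ : Mem} {D : Contents} {n M b : ℕ} {τ : ℕ → ℕ}

theorem rewind_run (hF : Fits C m) (hlen : ∀ d, m.len d = m.textLen) (hn : m.textLen = n)
    (hn0 : 0 < n) (hW : n < C.W) (hvn : μ .vn 0 = n) :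
    DRun C m false (sweepL C.σ .skip) (n - 1) 0 μ D (n * 100 + 100) fun μ' D' =>
      D' = D ∧ Frame [.vx] μ μ' := by
  refine (sweepL_run (t := 0) hF hlen hn hn0 hW (fun x μ' D' => D' = D ∧ Frame [.vx] μ μ')
    ?_ ?_ ?_ ⟨rfl, Frame.refl _ _⟩).mono (by omega) fun _ _ h => h
  · rintro x μ' D' v ⟨h1, h2⟩
    exact ⟨h1, h2.set (by simp) _ _⟩
  · rintro x μ' D' ⟨-, h2⟩
    rw [h2 _ (by simp), hvn]
  · rintro x μ' D' hx ⟨h1, h2⟩ hvx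
    exact BRun.of_wp (p := .skip) (P := fun μ' D' => μ' .vx 0 = x ∧ D' = D ∧ Frame [.vx] μ μ') hF
      ⟨hvx, h1, h2⟩

theorem phase_run (hF : Fits C m) (hlen : ∀ d, m.len d = m.textLen) (hn : m.textLen = n)
    (hτ : IsStr τ n) (hM : 1 ≤ M) (hMn : M ≤ n) (hW : 2 * n + M + 2 < C.W)
    (hI : 36 * M + 6 * C.σ + 50 ≤ C.I) (h : PhaseInv C.σ τ n M b μ D) (hb : 0 < b) :
    TRun C m (phase C.σ) 0 0 μ D (3000000 * (C.σ + 1) * n) 12 (8 * pages m (n - 1))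
      (PhaseInv C.σ τ n M (b - M)) := by
  have hW1 := hF.two_mul_le
  obtain ⟨hvn, hvM, hvb, hbn, hin, hwk, g, hg, hout⟩ := h
  -- If fewer than `M` characters remain, the cut-off subtraction gives `a = 0` and a shorter block.
  obtain ⟨a, ha⟩ : ∃ a, a = b - M := ⟨_, rfl⟩
  obtain ⟨L, hL⟩ : ∃ L, L = b - a := ⟨_, rfl⟩
  have hbL : b = a + L := by omega
  have hL0 : 0 < L := by omega
  have hLM : L ≤ M := by omega
  rw [← ha]
  -- `K` bounds the time of the internal work on the block, using `L + 1 ≤ 2 * n`; the sweeps take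
  -- the rest.
  obtain ⟨K, hK, tL⟩ : ∃ K, K + 2000 * n + 700 ≤ 3000000 * (C.σ + 1) * n ∧
      ∀ k ≤ 1000000 * (C.σ + 1) * (L + 1), k ≤ K := by
    have h1 : (C.σ + 1) * (L + 1) ≤ (C.σ + 1) * (2 * n) := Nat.mul_le_mul_left _ (by omega)
    have h2 : n ≤ (C.σ + 1) * n := Nat.le_mul_of_pos_left _ (by omega)
    exact ⟨2000000 * (C.σ + 1) * n, by nlinarith, fun k hk => hk.trans (by nlinarith)⟩
  refine TRun.mono (t := K + 2000 * n + 700) ?_ hK le_rfl le_rfl fun _ _ h => h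
  clear hK
  have r1 : BRun C m 0 (.asg .va (Row.vb.v - Row.vM.v) ;; .asg .vL (Row.vb.v - Row.va.v)) μ D 50
      fun μ' D' => D' = D ∧ Frame [.va, .vL] μ μ' ∧ μ' .va 0 = a ∧ μ' .vL 0 = L := by
    refine (BRun.of_wp hF ?_).mono (Nat.le_of_ble_eq_true rfl) (fun _ _ h => h)
    simp [wp, Row.Valid, Frame.refl, hvb, hvM, ← ha, ← hL]
    omega
  obtain ⟨A, hA', hA⟩ : ∃ A, 2 * pages m (m.textLen - 1) ≤ A ∧ 4 * A ≤ 8 * pages m (n - 1) :=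
    ⟨2 * pages m (n - 1), by rw [hn], by omega⟩
  refine TRun.mono (l := 4 * A) ?_ le_rfl le_rfl hA fun _ _ h => h
  clear hA
  refine (r1.trun.bind (x'' := 0) (k' := 12) (l' := 4 * A)
    (t' := K + 2000 * n + 600) ?_).mono
    (by omega) (by omega) (by omega) fun _ _ h => h
  rintro μ1 D1 ⟨rfl, f1, a1, a2⟩
  subst hbL
  -- loading the block
  refine (((load_run (n := n) hF hlen hn (by omega) (by omega) (by rw [f1 _ (by simp), hvn]) a1
    (by rw [f1 _ (by simp), hvb]) (by omega) (fun j hj => ?_) (fun j hj => ?_) hbn).trun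
    (by omega) hA').bind (x'' := 0) (k' := 9) (l' := 3 * A)
    (t' := K + 1700 * n + 500) ?_).mono (by omega) (by omega) (by omega)
    fun _ _ h => h
  · have := (hin j hj).2
    omega
  · rw [hwk j hj]
    split_ifs <;> omega
  rintro μ2 D2 ⟨rfl, f2, a3, a4⟩
  have b1 : μ2 .va 0 = a := by rw [f2 _ (by simp), a1]
  have b2 : μ2 .vL 0 = L := by rw [f2 _ (by simp), a2]
  have b3 : μ2 .vn 0 = n := by rw [f2 _ (by simp), f1 _ (by simp), hvn]
  have b4 : μ2 .vM 0 = M := by rw [f2 _ (by simp), f1 _ (by simp), hvM]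
  have b5 : μ2 .vb 0 = a + L := by rw [f2 _ (by simp), f1 _ (by simp), hvb]
  have hX : ∀ i < L, μ2 .aX i + 1 = τ (a + i) := fun i hi => by
    rw [a3 i hi, (hin _ (by omega)).1]
  have hXσ : ∀ i < L, μ2 .aX i < C.σ := fun i hi => by
    rw [a3 i hi]
    exact (hin _ (by omega)).2
  clear f1 f2 a1 a2 a3 r1 hvn hvM hvb
  -- sorting it
  refine (((prepare_run hF hτ hbn b2 hL0 hX hXσ (fun i hi => by rw [a4 i hi, hwk _ (by omega)])
    (by omega) (n - 1) D2).trun.mono (tL _ le_rfl) le_rfl le_rfl fun _ _ h => h).bind (x'' := 0) (k' := 9) (l' := 3 * A)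
    (t' := 1700 * n + 500) ?_).mono (by omega) (by omega) (by omega) fun _ _ h => h
  rintro μ3 D3 ⟨rfl, f3, hf, hz, hgap, hpa, hpf, hR, hgg⟩
  have c1 : μ3 .va 0 = a := by rw [f3 _ (prepRows_not (by simp)), b1]
  have c2 : μ3 .vL 0 = L := by rw [f3 _ (prepRows_not (by simp)), b2]
  have c3 : μ3 .vn 0 = n := by rw [f3 _ (prepRows_not (by simp)), b3]
  have c4 : μ3 .vM 0 = M := by rw [f3 _ (prepRows_not (by simp)), b4]
  have c5 : μ3 .vb 0 = a + L := by rw [f3 _ (prepRows_not (by simp)), b5]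
  have cX : μ3 .aX = μ2 .aX := f3 _ (prepRows_not (by simp))
  obtain ⟨f, hfA⟩ : ∃ f, f = μ3 .aSA := ⟨_, rfl⟩
  rw [← hfA] at hf hz hpf
  clear f3 b1 b2 b3 b4 b5 a4
  -- computing the ranks
  refine (((rank_run hF hlen hn (by omega) (by omega) hf hL0 c3 c5 c2 (by omega) hin hwk cX hX hz
    hgap hpa hpf hR hgg).trun (by omega) hA').bind (x'' := 0) (k' := 6) (l' := 2 * A)
    (t' := 1300 * n + 400) ?_).mono (by omega) (by omega) (by omega) fun _ _ h => h
  rintro μ4 D4 ⟨f4, d1, d2, d3, d4⟩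
  have r5 : BRun C m 0 (.asg .vr 0 ;; .asg .vq 0) μ4 D4 50
      fun μ' D' => D' = D4 ∧ Frame [.vr, .vq] μ4 μ' ∧ μ' .vr 0 = 0 ∧ μ' .vq 0 = 0 := by
    refine (BRun.of_wp hF ?_).mono (Nat.le_of_ble_eq_true rfl) (fun _ _ h => h)
    simp [wp, Row.Valid, Frame.refl]
    omega
  refine (r5.trun.bind (x'' := 0) (k' := 6) (l' := 2 * A) (t' := 1300 * n + 350) ?_).mono
    (by omega) (by omega) (by omega) fun _ _ h => h
  rintro μ5 D5 ⟨rfl, f5, e1, e2⟩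
  have g1 : μ5 .va 0 = a := by rw [f5 _ (by simp), f4 _ (by simp), c1]
  have g3 : μ5 .vn 0 = n := by rw [f5 _ (by simp), f4 _ (by simp), c3]
  have g4 : μ5 .vM 0 = M := by rw [f5 _ (by simp), f4 _ (by simp), c4]
  have g5 : μ5 .vb 0 = a + L := by rw [f5 _ (by simp), f4 _ (by simp), c5]
  -- merging
  refine (((merge_sweep_run hF hlen hn (by omega) hW hf hg g3 g1 g5 g4 hLM (by omega)
    (by rw [f5 _ (by simp), f4 _ (by simp), hfA]) (fun r hr => by rw [f5 _ (by simp), d4 r hr])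
    e1 e2 (by rw [d2]; exact hout)).trun (by omega) hA').bind (x'' := 0) (k' := 3) (l' := A)
    (t' := 900 * n + 200) ?_).mono (by omega) (by omega) (by omega) fun _ _ h => h
  rintro μ6 D6 ⟨f6, k1, k2, out, k3, k4⟩
  refine (((rewind_run hF hlen hn (by omega) (by omega) (by rw [f6 _ (by simp), g3])).trun
    (by omega) hA').bind (x'' := 0) (k' := 0) (l' := 0) (t' := 50) ?_).mono (by omega) (by omega)
    (by omega) fun _ _ h => h
  rintro μ7 D7 ⟨rfl, f7⟩
  have r8 : BRun C m 0 (.asg .vb Row.va.v) μ7 D7 50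
      fun μ' D' => D' = D7 ∧ Frame [.vb] μ7 μ' ∧ μ' .vb 0 = a := by
    refine (BRun.of_wp hF ?_).mono (Nat.le_of_ble_eq_true rfl) (fun _ _ h => h)
    simp [wp, Row.Valid, Frame.refl, f7 .va, f6 .va, g1]
    omega
  refine r8.trun.mono le_rfl le_rfl le_rfl ?_
  rintro μ8 D8 ⟨rfl, f8, l1⟩
  refine ⟨?_, ?_, l1, by omega, ?_, ?_, out, k3, k4⟩
  · rw [f8 _ (by simp), f7 _ (by simp), f6 _ (by simp), g3]
  · rw [f8 _ (by simp), f7 _ (by simp), f6 _ (by simp), g4]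
  · rwa [k1, d1]
  · rwa [k2]

theorem scanSort_run (hF : Fits C m) (hlen : ∀ d, m.len d = m.textLen) (hn : m.textLen = n)
    (hτ : IsStr τ n) (hM : 1 ≤ M) (hMn : M ≤ n) (hW : 2 * n + M + 2 < C.W)
    (hI : 36 * M + 6 * C.σ + 50 ≤ C.I) (hvn : μ .vn 0 = n) (hvM : μ .vM 0 = M)
    (hin : ∀ j < n, D .input j + 1 = τ j ∧ D .input j < C.σ) (hwk : ∀ j < n, D .work j = 0) :
    TRun C m (scanSort C.σ) 0 0 μ D ((n / M + 1) * (3000000 * (C.σ + 1) * n + 10) + 50)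
      ((n / M + 1) * 12) ((n / M + 1) * (8 * pages m (n - 1))) fun _ D' =>
        ∃ g, TailSA τ n 0 g ∧ ∀ t < n, D' .output t = g t + 1 := by
  have hW1 := hF.two_mul_le
  have hI1 := hF.pos
  have r1 : BRun C m 0 (.asg .vb Row.vn.v) μ D 20
      fun μ' D' => D' = D ∧ Frame [.vb] μ μ' ∧ μ' .vb 0 = n := by
    refine (BRun.of_wp hF ?_).mono (Nat.le_of_ble_eq_true rfl) (fun _ _ h => h)
    simp [wp, Row.Valid, Frame.refl, hvn]
    omega
  refine (r1.trun.bind (x'' := 0) fun μ1 D1 h1 => TRun.loop hF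
    (Inv := fun j μ D => ∃ b, PhaseInv C.σ τ n M b μ D ∧ b ≤ j * M) ?_ ?_ ?_ (e := Row.vb.v)
    (j := n / M + 1) (k := 12) (l := 8 * pages m (n - 1)) (t := 3000000 * (C.σ + 1) * n) ?_).mono
    ?_ (by omega) (by omega) ?_
  · rintro j μ D ⟨b, h1, h2⟩
    simp [Row.Valid]
    omega
  · rintro μ D ⟨b, h1, h2⟩
    simp [h1.vb]
    omega
  · rintro j μ D ⟨b, h1, h2⟩ hv
    simp [h1.vb] at hv
    refine (phase_run hF hlen hn hτ hM hMn hW hI h1 (by omega)).mono le_rfl le_rfl le_rfl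
      fun μ' D' h => ⟨_, h, ?_⟩
    rw [Nat.add_mul] at h2
    omega
  · obtain ⟨rfl, f1, a1⟩ := h1
    refine ⟨n, ⟨?_, ?_, a1, le_rfl, hin, fun j hj => ?_, fun _ => 0, ⟨?_, ?_, ?_⟩, ?_⟩, ?_⟩
    · rw [f1 _ (by simp), hvn]
    · rw [f1 _ (by simp), hvM]
    -- For `b = n` every suffix exceeds the empty one, so the correct bits are all `0`, as the work
    -- disk is initialised. This is the reason for storing the bits negated.
    · have h1 := hτ n
      have h2 := hτ j
      rw [hwk j hj, if_pos ((slt_iff _ _ _).2 (.inl (by omega)))]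
    · omega
    · omega
    · intro t t' h1 h2
      omega
    · omega
    · rw [Nat.add_mul, one_mul]
      have := Nat.div_add_mod' n M
      have := Nat.mod_lt n hM
      omega
  · have := Nat.mul_le_mul_left (n / M + 1) (show 3000000 * (C.σ + 1) * n + Row.vb.v.cost + 1 ≤
      3000000 * (C.σ + 1) * n + 10 by simp only [HE.cost]; omega)
    have : Row.vb.v.cost = 6 := rfl
    omega
  · rintro μ' D' ⟨j, ⟨b, h1, h2⟩, hv⟩
    simp [h1.vb] at hv
    subst hv
    exact h1.output

end
end ScanSort

namespace ScanSort
open ScanModel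

/-! ## Suffixes as lists, and the sizes of the machine -/

/-- The characters of `l`, increased by one, followed by zeros. -/
def code {σ : ℕ} (l : List (Fin σ)) (j : ℕ) : ℕ := if h : j < l.length then (l[j] : ℕ) + 1 else 0

theorem isStr_code {σ : ℕ} (l : List (Fin σ)) : IsStr (code l) l.length := by
  intro i
  unfold code
  split_ifs with h
  · simp [h]
  · simpa using h

theorem drop_lt_drop_of_slt {σ : ℕ} (l : List (Fin σ)) {i j : ℕ} (h : slt (code l) i j) :
    l.drop i < l.drop j := by
  obtain ⟨d, h1, h2⟩ := h
  induction d generalizing i j with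
  | zero =>
    simp only [add_zero, code] at h2
    by_cases hj : j < l.length
    · rw [dif_pos hj] at h2
      rw [List.drop_eq_getElem_cons hj]
      by_cases hi : i < l.length
      · rw [dif_pos hi] at h2
        rw [List.drop_eq_getElem_cons hi, List.cons_lt_cons_iff]
        exact .inl (Fin.lt_def.2 (by omega))
      · rw [List.drop_eq_nil_of_le (by omega)]
        exact List.nil_lt_cons _ _
    · rw [dif_neg hj] at h2
      omega
  | succ d ih =>
    have hj : j < l.length := by
      by_contra hc
      have := (isStr_code l (j + (d + 1))).2 (by omega)
      omega
    have h3 := h1 0 (by omega)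
    simp only [add_zero, code, dif_pos hj] at h3
    split_ifs at h3 with hi
    rw [List.drop_eq_getElem_cons hi, List.drop_eq_getElem_cons hj, List.cons_lt_cons_iff]
    refine .inr ⟨Fin.ext (by omega), ih (fun x hx => ?_) ?_⟩
    · simpa only [add_assoc, add_comm 1] using h1 (x + 1) (by omega)
    · simpa only [add_assoc, add_comm 1] using h2

theorem exists_isSuffixArray {n σ : ℕ} (T : Fin n → Fin σ) {g : ℕ → ℕ}
    (hg : TailSA (code (List.ofFn T)) n 0 g) :
    ∃ sa : Equiv.Perm (Fin n), IsSuffixArray T sa ∧ ∀ i : Fin n, (sa i : ℕ) = g i := by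
  have hinj : Function.Injective fun i : Fin n => (⟨g i, hg.lt i i.2⟩ : Fin n) := fun i j h => by
    by_contra hne
    exact hg.sorted.ne i.2 j.2 (fun h => hne (Fin.ext h)) (by simpa using h)
  refine ⟨Equiv.ofBijective _ (Finite.injective_iff_bijective.1 hinj), fun i j hij => ?_,
    fun i => rfl⟩
  exact drop_lt_drop_of_slt _ (hg.sorted i j hij j.2)

/-- The bit length of `n` lies between `log n` and `log n + 1`, and `log n ≥ 1` absorbs the bits of
the characters and of the work disk. -/
theorem diskBits_bounds {σ n c : ℕ} (hn : 2 ≤ n) (hc : σ + 3 ≤ c) :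
    (1 / (c : ℝ)) * (n * Real.logb 2 n) ≤ ((n * Nat.clog 2 σ + n * Nat.size n + n * 1 : ℕ) : ℝ) ∧
      ((n * Nat.clog 2 σ + n * Nat.size n + n * 1 : ℕ) : ℝ) ≤ c * (n * Real.logb 2 n) := by
  have hn0 : (0 : ℝ) < n := by positivity
  have h1 : (1 : ℝ) ≤ Real.logb 2 n := by
    rw [Real.le_logb_iff_rpow_le (by norm_num) hn0]
    simpa using (by exact_mod_cast hn : (2 : ℝ) ≤ n)
  have h2 : Real.logb 2 n ≤ Nat.size n := by
    rw [Real.logb_le_iff_le_rpow (by norm_num) hn0, Real.rpow_natCast]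
    exact_mod_cast (Nat.lt_size_self n).le
  have h3 : (Nat.size n : ℝ) ≤ Real.logb 2 n + 1 := by
    obtain ⟨k, hk⟩ : ∃ k, Nat.size n = k + 1 := ⟨Nat.size n - 1, by
      have := Nat.size_pos.2 (by omega : 0 < n)
      omega⟩
    have h4 : 2 ^ k ≤ n := Nat.lt_size.1 (by omega)
    have h5 : (k : ℝ) ≤ Real.logb 2 n := by
      rw [Real.le_logb_iff_rpow_le (by norm_num) hn0, Real.rpow_natCast]
      exact_mod_cast h4
    rw [hk]
    push_cast
    linarith
  have h4 : (Nat.clog 2 σ : ℝ) ≤ σ := by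
    exact_mod_cast (Nat.clog_le_of_le_pow (Nat.lt_two_pow_self).le)
  have h5 : (σ : ℝ) + 3 ≤ c := by exact_mod_cast hc
  have h6 : (0 : ℝ) ≤ σ := by positivity
  have h7 : (0 : ℝ) ≤ Nat.clog 2 σ := by positivity
  push_cast
  constructor
  · have h8 : 1 / (c : ℝ) ≤ 1 := by
      rw [div_le_one (by linarith)]
      linarith
    have h9 : n * Real.logb 2 n ≤ n * (Nat.size n : ℝ) := by gcongr
    have h10 : 0 ≤ n * Real.logb 2 n := by positivity
    have h11 : 0 ≤ n * (Nat.clog 2 σ : ℝ) := by positivity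
    nlinarith
  · have h8 : (Nat.clog 2 σ : ℝ) + Nat.size n + 1 ≤ c * Real.logb 2 n := by nlinarith
    have := mul_le_mul_of_nonneg_left h8 hn0.le
    linarith

/-- A cell is no wider than a word, so a page holds at least `pageWords` cells. -/
theorem page_le_div {m : Machine} (d : Disk) (x : ℕ) (h0 : 0 < m.width d)
    (h : m.width d ≤ m.wordBits) (hB : 0 < m.pageWords) : m.page d x ≤ x / m.pageWords := by
  refine Nat.div_le_div_left ?_ hB
  refine le_trans ?_ (le_max_right _ _)
  rw [Nat.le_div_iff_mul_le h0]
  exact Nat.mul_le_mul_left _ h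

/-- Words of `c * Nat.size n` bits can hold all numbers up to `c * n`, in particular all addresses.
-/
theorem mul_lt_two_pow {c s n : ℕ} (hc : 2 ≤ c) (hs : 2 ≤ s) (hn : n < 2 ^ s) :
    c * n < 2 ^ (c * s) := by
  have h1 : c < 2 ^ c := Nat.lt_two_pow_self
  have h2 : c + s ≤ c * s := by nlinarith
  calc c * n ≤ c * 2 ^ s := Nat.mul_le_mul_left _ hn.le
    _ < 2 ^ c * 2 ^ s := Nat.mul_lt_mul_of_pos_right h1 (by positivity)
    _ = 2 ^ (c + s) := (pow_add _ _ _).symm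
    _ ≤ 2 ^ (c * s) := Nat.pow_le_pow_right (by norm_num) h2

theorem one_le_div_cast {a b : ℕ} (ha : 1 ≤ a) (hab : a ≤ b) : (1 : ℝ) ≤ (b : ℝ) / a := by
  rw [one_le_div (by positivity)]
  exact_mod_cast hab

theorem phases_le {n M : ℕ} (hM : 1 ≤ M) (hMn : M ≤ n) :
    ((n / M + 1 : ℕ) : ℝ) ≤ 2 * ((n : ℝ) / M) := by
  have h1 : ((n / M : ℕ) : ℝ) ≤ (n : ℝ) / M := Nat.cast_div_le
  have h2 := one_le_div_cast hM hMn
  push_cast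
  linarith

theorem pages_le {m : Machine} {n : ℕ} (h0 : ∀ d, 0 < m.width d)
    (h : ∀ d, m.width d ≤ m.wordBits) (hB : 0 < m.pageWords) :
    (pages m (n - 1) : ℝ) ≤ 3 * ((n : ℝ) / m.pageWords) := by
  have key : ∀ d, m.page d (n - 1) ≤ n / m.pageWords := fun d =>
    (page_le_div d _ (h0 d) (h d) hB).trans (Nat.div_le_div_right (Nat.sub_le n 1))
  have h1 : pages m (n - 1) ≤ 3 * (n / m.pageWords) := by
    have h2 := key .input
    have h3 := key .output
    have h4 := key .work
    unfold pages
    linarith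
  have h2 : ((n / m.pageWords : ℕ) : ℝ) ≤ (n : ℝ) / m.pageWords := Nat.cast_div_le
  have h3 : (pages m (n - 1) : ℝ) ≤ 3 * ((n / m.pageWords : ℕ) : ℝ) := by exact_mod_cast h1
  linarith

/-- The constant of the resource bounds. -/
def bigConst (σ : ℕ) : ℕ := 10000000 * (σ + 1) ^ 2

/-- The first bound makes room for `39 + σ` rows and three page buffers, the second covers passes,
page accesses and cell widths, and the third covers the time of at most `2 * n / M` phases. -/
theorem bigConst_ge (σ : ℕ) : (39 + σ) * (96 + 6 * σ) + 3 ≤ bigConst σ ∧ σ + 60 ≤ bigConst σ ∧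
    2 * (3000000 * (σ + 1) + 10) + 100 ≤ bigConst σ := by
  unfold bigConst
  refine ⟨by nlinarith, by nlinarith, by nlinarith⟩

end ScanSort

/-! ### The constants and the final assembly. -/

theorem mainTheorem3 (σ : ℕ) :
    ∃ (prog : ScanModel.Cmd) (c : ℕ), 0 < c ∧
      ∀ (n M B : ℕ) (T : Fin n → Fin σ), 2 ≤ n → ScanModel.HasSentinel T →
        1 ≤ B → B ≤ M → M ≤ n →
        -- internal memory of `c * M` words, including one page buffer for each of the 3 disks
        let m : ScanModel.Machine :=
          { alphabet := σ
            textLen := n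
            wordBits := c * Nat.size n
            ramWords := c * M - 3 * B
            pageWords := B
            workBits := n }
        -- `Θ(n log n)` bits of disk data
        ((1 / (c : ℝ)) * (n * Real.logb 2 n) ≤
            ((m.diskBits .input + m.diskBits .output + m.diskBits .work : ℕ) : ℝ) ∧
          ((m.diskBits .input + m.diskBits .output + m.diskBits .work : ℕ) : ℝ) ≤
            c * (n * Real.logb 2 n)) ∧
        -- `n` bits of disk working space
        m.diskBits .work = n ∧
        -- the program halts with the suffix array (with entries in `[1, n]`) on the output disk
        ∃ s : ScanModel.State,
          ScanModel.Exec m prog (ScanModel.State.start T M B) s ∧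
          (∃ sa : Equiv.Perm (Fin n), ScanModel.IsSuffixArray T sa ∧
            ∀ i : Fin n, s.disk .output i = (sa i : ℕ) + 1) ∧
          (s.passes : ℝ) ≤ c * ((n : ℝ) / M) ∧
          (s.accesses : ℝ) ≤ c * ((n : ℝ) ^ 2 / (M * B)) ∧
          (s.time : ℝ) ≤ c * ((n : ℝ) ^ 2 / M) := by
  obtain ⟨hc1, hc2, hc3⟩ := ScanSort.bigConst_ge σ
  obtain ⟨c, hc⟩ : ∃ c, c = ScanSort.bigConst σ := ⟨_, rfl⟩
  rw [← hc] at hc1 hc2 hc3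
  clear hc
  refine ⟨ScanSort.scanSort σ, c, by omega, ?_⟩
  intro n M B T hn hT hB hBM hMn m
  refine ⟨ScanSort.diskBits_bounds (σ := σ) hn (by omega), Nat.mul_one n, ?_⟩
  -- The sentinel differs from the first character. Two characters are needed for cells of the input
  -- disk to have positive width.
  have hσ : 2 ≤ σ := by
    have h1 := hT ⟨0, by omega⟩ ⟨n - 1, by omega⟩ (by simp; omega)
      (by simp only [ne_eq, Fin.mk.injEq]; omega)
    have h2 := (T ⟨0, by omega⟩).2
    have h3 := Fin.lt_def.1 h1
    omega
  have hsize : 2 ≤ Nat.size n := Nat.lt_size.2 (by omega)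
  have hW : c * n < 2 ^ (c * Nat.size n) :=
    ScanSort.mul_lt_two_pow (by omega) hsize (Nat.lt_size_self n)
  have hIM : (39 + σ) * (36 * M + 6 * σ + 60) + 3 * M ≤ c * M := by
    have h1 : 36 * M + 6 * σ + 60 ≤ (96 + 6 * σ) * M := by nlinarith
    calc (39 + σ) * (36 * M + 6 * σ + 60) + 3 * M
        ≤ (39 + σ) * ((96 + 6 * σ) * M) + 3 * M := by gcongr
      _ = ((39 + σ) * (96 + 6 * σ) + 3) * M := by ring
      _ ≤ c * M := Nat.mul_le_mul_right _ hc1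
  have hcM : c * M ≤ c * n := Nat.mul_le_mul_left _ hMn
  have h60 : 60 * n ≤ c * n := Nat.mul_le_mul_right _ (by omega)
  -- The row length comes from the `36 * L` cells for the stack of strings of a block with `L ≤ M`;
  -- the terms in `σ` cover the alphabet of the block string.
  let C : ScanSort.Cfg := ⟨σ, 36 * M + 6 * σ + 60, 2 ^ (c * Nat.size n)⟩
  have hF : ScanSort.Fits C m := by
    refine ⟨rfl, ?_, ?_, ?_⟩
    · change (39 + σ) * (36 * M + 6 * σ + 60) ≤ c * M - 3 * B
      omega
    · change (39 + σ) * (36 * M + 6 * σ + 60) ≤ 2 ^ (c * Nat.size n)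
      omega
    · change 1 < 36 * M + 6 * σ + 60
      omega
  let s0 := ScanModel.State.start T M B
  -- The initial memory is read through the interleaved layout, so `vn` and `vM` hold `n` and `M`
  -- from the beginning.
  let μ : ScanSort.Mem := fun r i => s0.mem ((39 + σ) * i + r.idx)
  have hmem : ∀ x, s0.mem x ≤ n := fun x => by
    simp only [s0, ScanModel.State.start]
    split_ifs <;> omega
  have hsync : ScanSort.Sync C s0 μ s0.disk 0 := by
    refine ⟨fun r _ i _ => ⟨rfl, ?_⟩, rfl, fun _ => rfl⟩
    have := hmem ((39 + σ) * i + r.idx)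
    change s0.mem ((39 + σ) * i + r.idx) < 2 ^ (c * Nat.size n)
    omega
  have hlen : (List.ofFn T).length = n := List.length_ofFn
  obtain ⟨s, μ', D', hex, ⟨g, hg, hout⟩, hs, htime, hpass, hacc⟩ :=
    ScanSort.scanSort_run (n := n) (M := M) (τ := ScanSort.code (List.ofFn T)) hF
      (by rintro (_ | _ | _) <;> rfl) rfl (by simpa [hlen] using ScanSort.isStr_code (List.ofFn T))
      (by omega) hMn (by change 2 * n + M + 2 < 2 ^ (c * Nat.size n); omega)
      (by change 36 * M + 6 * σ + 50 ≤ 36 * M + 6 * σ + 60; omega) rfl rfl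
      (fun j hj => by simp [s0, ScanModel.State.start, ScanSort.code, hj, C])
      (fun j hj => by simp [s0, ScanModel.State.start]) s0 hsync
  obtain ⟨sa, hsa, hsag⟩ := ScanSort.exists_isSuffixArray T hg
  refine ⟨s, hex, ⟨sa, hsa, fun i => ?_⟩, ?_, ?_, ?_⟩
  · rw [hs.disk, hout i i.2, hsag i]
  · have h1 := ScanSort.one_le_div_cast (show 1 ≤ M by omega) hMn
    have h2 := ScanSort.phases_le (show 1 ≤ M by omega) hMn
    have h3 : (s.passes : ℝ) ≤ 3 + ((n / M + 1 : ℕ) : ℝ) * 12 := by exact_mod_cast hpass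
    have h4 : (60 : ℝ) ≤ c := by exact_mod_cast (by omega : 60 ≤ c)
    nlinarith
  · have h1 := ScanSort.one_le_div_cast (show 1 ≤ M by omega) hMn
    have h2 := ScanSort.phases_le (show 1 ≤ M by omega) hMn
    have h3 := ScanSort.one_le_div_cast hB (hBM.trans hMn)
    have h4 : (s.accesses : ℝ) ≤
        6 + ((n / M + 1 : ℕ) : ℝ) * (8 * (ScanSort.pages m (n - 1) : ℝ)) := by exact_mod_cast hacc
    have h5 : (ScanSort.pages m (n - 1) : ℝ) ≤ 3 * ((n : ℝ) / B) := by
      refine ScanSort.pages_le (m := m) (fun d => ?_) (fun d => ?_) hB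
      · cases d
        · exact Nat.clog_pos (by norm_num) hσ
        · exact Nat.size_pos.2 (show 0 < n by omega)
        · exact Nat.one_pos
      · have h6 : Nat.size n ≤ c * Nat.size n := Nat.le_mul_of_pos_left _ (by omega)
        have h7 : c ≤ c * Nat.size n := Nat.le_mul_of_pos_right _ (by omega)
        cases d
        · have h8 : Nat.clog 2 σ ≤ σ := Nat.clog_le_of_le_pow (Nat.lt_two_pow_self).le
          change Nat.clog 2 σ ≤ c * Nat.size n
          omega
        · exact h6
        · change 1 ≤ c * Nat.size n
          omega
    have h6 : (60 : ℝ) ≤ c := by exact_mod_cast (by omega : 60 ≤ c)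
    have h7 : (n : ℝ) ^ 2 / (M * B) = (n : ℝ) / M * ((n : ℝ) / B) := by
      rw [div_mul_div_comm, sq]
    rw [h7]
    have h8 : 1 ≤ (n : ℝ) / M * ((n : ℝ) / B) := one_le_mul_of_one_le_of_one_le h1 h3
    calc (s.accesses : ℝ)
        ≤ 6 + ((n / M + 1 : ℕ) : ℝ) * (8 * (ScanSort.pages m (n - 1) : ℝ)) := h4
      _ ≤ 6 + 2 * ((n : ℝ) / M) * (8 * (3 * ((n : ℝ) / B))) := by gcongr
      _ ≤ 60 * ((n : ℝ) / M * ((n : ℝ) / B)) := by linarith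
      _ ≤ c * ((n : ℝ) / M * ((n : ℝ) / B)) := by gcongr
  · have h1 := ScanSort.one_le_div_cast (show 1 ≤ M by omega) hMn
    have h2 := ScanSort.phases_le (show 1 ≤ M by omega) hMn
    have h3 : (1 : ℝ) ≤ n := by exact_mod_cast (by omega : 1 ≤ n)
    have h4 : (s.time : ℝ) ≤ ((n / M + 1 : ℕ) : ℝ) * (3000000 * (σ + 1) * n + 10) + 50 := by
      have h5 : s.time ≤ (n / M + 1) * (3000000 * (σ + 1) * n + 10) + 50 := by
        simpa [s0, ScanModel.State.start] using htime
      exact_mod_cast h5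
    have h6 : 2 * (3000000 * ((σ : ℝ) + 1) + 10) + 100 ≤ c := by exact_mod_cast hc3
    have h7 : (n : ℝ) ^ 2 / M = (n : ℝ) / M * n := by rw [sq, mul_div_right_comm]
    rw [h7]
    have h8 : 1 ≤ (n : ℝ) / M * n := one_le_mul_of_one_le_of_one_le h1 h3
    calc (s.time : ℝ)
        ≤ ((n / M + 1 : ℕ) : ℝ) * (3000000 * (σ + 1) * n + 10) + 50 := h4
      _ ≤ 2 * ((n : ℝ) / M) * (3000000 * (σ + 1) * n + 10 * n) + 100 * ((n : ℝ) / M * n) := by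
        gcongr <;> linarith
      _ = (2 * (3000000 * ((σ : ℝ) + 1) + 10) + 100) * ((n : ℝ) / M * n) := by ring
      _ ≤ c * ((n : ℝ) / M * n) := by gcongr
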